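/- **Setting.** There are $K\ge 2$ arms; arm $k$ pays i.i.d. rewards from a distribution on $[0,1]$ with mean $\mu_k$. Rounds are $1,\dots,T$. In each round each present player chooses an arm; players who choose the same arm collide and receive no reward. With $N_t$ the number of players present in round $t$, the regret is $\sum_{t=1}^T\big(\text{sum of the } N_t \text{ largest means}\big)-\sum_{t=1}^T\sum_j \mu_{j}(t)(1-\eta_j(t))$, where $\mu_j(t)$ is the mean of the arm chosen by player $j$ and $\eta_j(t)\in\{0,1\}$ indicates that she collides. Assume that the best arm $a_1$ is strictly better than the second best arm $a_2$, that $a_2$ is strictly better than all other arms, and $\mu_{a_2}>0$. **Scenario.** Let $0<f<1/2$. The first player is present from round $1$ and leaves at round $\lceil T/2+fT\rceil$; the second player enters at round $\lceil T/2\rceil$. **MEGA** (parameters $c,d>0$, $p_0,\alpha\in[0,1]$, $\beta\in\mathbb R$). A player keeps a local clock $t=1,2,\dots$, the empirical mean of each arm over her collision-free samples ($0$ without samples), and a persistence probability $p$, initially $p_0$. After a round with a collision she repeats her arm with probability $p$; otherwise she marks this arm unavailable until a uniformly random time in $\{t,\dots,t+\lfloor t^\beta\rfloor\}$. When she does not persist,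 she chooses with probability $\min\{1,\frac{cK^2}{d^2(K-1)t}\}$ a uniformly random available arm and else an available arm with the largest empirical mean (ties broken uniformly at random; no arm is chosen if none is available). After a round in which she chose the same arm as in the round before, $p$ is replaced by $\alpha p+(1-\alpha)$, and otherwise by $p_0$. **DMC** (parameters $T_0<T_1$). Epochs of $T_1$ rounds start at rounds $1,T_1+1,2T_1+1,\dots$. A player who enters during an epoch explores uniformly at random until the epoch ends. In the first $T_0$ rounds of each epoch a player explores uniformly; then she ranks the arms by empirical means (collision-free samples of this epoch) and estimates the number of players by $N^*=\mathrm{round}\big(\log(\tfrac{T_0-C}{T_0})/\log(1-\tfrac1K)+1\big)$, where $C$ is the number of her collisions in these rounds ($N^*=K$ if $C=T_0$). In the remaining rounds of the epoch she chooses uniformly among her first $\min(N^*,K)$ arms until she does not collide, and then stays on that arm until the epoch ends. Given $\varepsilon,\delta$, set $$T_0=\Big\lceil\max\Big(\tfrac K2\ln\tfrac{2K^2}{\delta/(2T)},\ \tfrac{16K}{\varepsilon^2}\ln\tfrac{4K^2}{\delta/(2T)},\ \tfrac{K^2\log(4T/\delta)}{0.02}\Big)\Big\rceil .$$ **Theorem.**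 1. For all such arms, all $f\in(0,1/2)$ and all $c,d>0$ there are $C>0$ and $T'$, depending only on these, such that for every $T\ge T'$ with $\frac{cK^2/(d^2(K-1))}{T}\le f\le\frac{d^2(K-1)}{8cK^2}$, all $\beta\in\mathbb R$, all $p_0\in[0,1]$ and all $0\le\alpha\le 1-\frac{4\log(4fT)}{T}$, the expected regret of MEGA in the scenario is at least $C\,T$. 2. For all $0<a\le b$ there are $C,q$ such that the following holds for all arms as above for which both $\mu_{a_1}-\mu_{a_2}$ and all $\mu_{a_2}-\mu_k$ ($k\ne a_1,a_2$) exceed $\varepsilon>0$, all $f\in(0,1/2)$, $\delta\in(0,1)$, $T\ge 2$, and all $T_1>T_0$ with $a\sqrt T\le T/T_1\le b\sqrt T$ (that is, $\Theta(\sqrt T)$ epochs). Let $G$ be the event that, in every epoch whose learning phase (the first $T_0$ rounds) is completed by round $T$, each player who is present in the whole learning phase obtains an $\varepsilon$-correct ranking (arm $i$ is listed before arm $j$ whenever $\mu_i-\mu_j>\varepsilon$), and has $N^*$ equal to the number of players if no player enters or leaves during this learning phase. Then $G$ has probability at least $1-\delta$, and the expected regret of DMC in the scenario conditioned on $G$ is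 at most $C\,(K/\varepsilon)^q\sqrt T\,\log(T/\delta)^q$. -/

import Mathlib

open MeasureTheory ProbabilityTheory

namespace MultiBandit

noncomputable section

open scoped Classical in
/-- A uniformly random element of the finite set `S`, driven by a number `u` that is uniform on
`[0, 1)`: the element of index `⌊u * |S|⌋` in the increasing enumeration of `S`.
The result is `none` if `S` is empty. -/
def pick {K : ℕ} (S : Finset (Fin K)) (u : ℝ) : Option (Fin K) :=
  (S.sort (· ≤ ·))[⌊u * (S.card : ℝ)⌋₊]?

/-- The independent random numbers that a player may use in one round. -/
inductive Coin
  | persist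
  | block
  | explore
  | arm

/-- The law of one coin: uniform on `[0, 1)`. -/
def unif : Measure ℝ := volume.restrict (Set.Ico 0 1)

/-- Sample space of a game with `N` players and `K` arms: the coins of each player in each round,
and the reward table, whose entry `(t, k)` is the reward that arm `k` pays in round `t` to a player
who is alone on it. -/
abbrev Sample (N K : ℕ) : Type := (Fin N × ℕ × Coin → ℝ) × (ℕ × Fin K → ℝ)

/-- All coins are independent and uniform, all rewards are independent, those of arm `k` have
law `ν k`, and coins and rewards are independent. -/
def law (N : ℕ) {K : ℕ} (ν : Fin K → Measure ℝ) : Measure (Sample N K) :=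
  (Measure.infinitePi fun _ : Fin N × ℕ × Coin => unif).prod
    (Measure.infinitePi fun i : ℕ × Fin K => ν i.2)

/-- The expected rewards of the arms. -/
def mean {K : ℕ} (ν : Fin K → Measure ℝ) (k : Fin K) : ℝ := ∫ x, x ∂(ν k)

/-- An algorithm run by a single player without communication. In the global round `t` it selects an
arm (or none) from its state and its own coins of the round; afterwards it updates its state from
its choice, the collision indicator and the reward that it received. -/
structure Algorithm (K : ℕ) where
  State : Type
  init : State
  choose : (t : ℕ) → (Coin → ℝ) → State → Option (Fin K)
  update : (t : ℕ) → (Coin → ℝ) → State → Option (Fin K) → (collided : Prop) → (reward : ℝ) → State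

section Game

/-! ### The game. `active j t` says that player `j` takes part in round `t`; rounds are `1, 2, …` -/

variable {N K : ℕ}

/-- Player `j` collides: some other player chose the same arm. -/
def Collides (a : Fin N → Option (Fin K)) (j : Fin N) : Prop :=
  a j ≠ none ∧ ∃ i, i ≠ j ∧ a i = a j

open scoped Classical in
/-- The arms chosen in round `t` when the players are in the states `s`. -/
def actions (alg : Algorithm K) (active : Fin N → ℕ → Prop) (ω : Sample N K) (t : ℕ)
    (s : Fin N → alg.State) (j : Fin N) : Option (Fin K) :=
  if active j t then alg.choose t (fun i => ω.1 (j, t, i)) (s j) else none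

open scoped Classical in
/-- The reward of player `j` in round `t`; it is zero in case of a collision. -/
def reward (ω : Sample N K) (t : ℕ) (a : Fin N → Option (Fin K)) (j : Fin N) : ℝ :=
  match a j with
  | none => 0
  | some k => if Collides a j then 0 else ω.2 (t, k)

open scoped Classical in
/-- The states of the players after `t` rounds. Players who are not active do not change state, so
that a player starts in the initial state when she enters. -/
def states (alg : Algorithm K) (active : Fin N → ℕ → Prop) (ω : Sample N K) :
    ℕ → Fin N → alg.State
  | 0 => fun _ => alg.init
  | t + 1 => fun j =>
      let s := states alg active ω t
      let a := actions alg active ω (t + 1) s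
      if active j (t + 1) then
        alg.update (t + 1) (fun i => ω.1 (j, t + 1, i)) (s j) (a j) (Collides a j)
          (reward ω (t + 1) a j)
      else s j

/-- The arms chosen in round `t ≥ 1`. -/
def played (alg : Algorithm K) (active : Fin N → ℕ → Prop) (ω : Sample N K) (t : ℕ) :
    Fin N → Option (Fin K) :=
  actions alg active ω t (states alg active ω (t - 1))

open scoped Classical in
/-- The number of players in round `t`. -/
def numActive (active : Fin N → ℕ → Prop) (t : ℕ) : ℕ :=
  (Finset.univ.filter fun j => active j t).card

/-- The arms sorted by decreasing value of `v` (ties by index): `ranking v i` is the arm in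
position `i`, positions being counted from `0`. -/
def ranking (v : Fin K → ℝ) : Equiv.Perm (Fin K) := Tuple.sort fun k => -v k

/-- The sum of the `n` largest values of `v`. -/
def topSum (v : Fin K → ℝ) (n : ℕ) : ℝ :=
  ∑ i : Fin K, if i.val < n then v (ranking v i) else 0

open scoped Classical in
/-- The expected reward of the arm chosen by player `j`, counted as zero if she collides. -/
def gain (v : Fin K → ℝ) (a : Fin N → Option (Fin K)) (j : Fin N) : ℝ :=
  match a j with
  | none => 0
  | some k => if Collides a j then 0 else v k

/-- The regret of the first `T` rounds, with respect to the best allocation of the players that are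
present in each round to distinct arms. -/
def regret (alg : Algorithm K) (active : Fin N → ℕ → Prop) (ν : Fin K → Measure ℝ) (T : ℕ)
    (ω : Sample N K) : ℝ :=
  (∑ t ∈ Finset.Icc 1 T, topSum (mean ν) (numActive active t))
    - ∑ t ∈ Finset.Icc 1 T, ∑ j : Fin N, gain (mean ν) (played alg active ω t) j

end Game

section Mega

/-! ### The MEGA algorithm -/

variable {K : ℕ}

/-- State of a MEGA player: `clock` is the number of the coming round on her own clock, `last` and
`collided` describe her previous round, `p` is the persistence probability, `next k` is the
time from which arm `k` is available, `obs k` and `sum k` are the number and the sum of the rewards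
that she received from arm `k` without collision. -/
structure MegaState (K : ℕ) where
  clock : ℕ
  last : Option (Fin K)
  collided : Prop
  p : ℝ
  next : Fin K → ℕ
  obs : Fin K → ℕ
  sum : Fin K → ℝ

/-- Empirical means; an arm without observations has empirical mean `0`. -/
def MegaState.est (s : MegaState K) (k : Fin K) : ℝ := s.sum k / (s.obs k : ℝ)

/-- The exploration probability in local round `t`. -/
def megaEps (K : ℕ) (c d : ℝ) (t : ℕ) : ℝ :=
  min 1 (c * (K : ℝ) ^ 2 / (d ^ 2 * ((K : ℝ) - 1) * (t : ℝ)))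

/-- After a collision the player persists with probability `p`. -/
def megaPersists (u : Coin → ℝ) (s : MegaState K) : Prop :=
  s.collided ∧ u .persist < s.p

open scoped Classical in
/-- Availability times, after a player who collided and does not persist has marked the arm as
unavailable until a uniformly random time in `{t, …, t + ⌊t ^ β⌋}`. -/
def megaNext (β : ℝ) (u : Coin → ℝ) (s : MegaState K) (k : Fin K) : ℕ :=
  if s.collided ∧ ¬ u .persist < s.p ∧ s.last = some k then
    s.clock + ⌊u .block * ((⌊(s.clock : ℝ) ^ β⌋₊ : ℝ) + 1)⌋₊
  else s.next k

open scoped Classical in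
/-- The arms that are available in the current round. -/
def megaAvail (β : ℝ) (u : Coin → ℝ) (s : MegaState K) : Finset (Fin K) :=
  Finset.univ.filter fun k => megaNext β u s k ≤ s.clock

open scoped Classical in
/-- The choice of a MEGA player: persist on the arm of the last collision, or else play
epsilon-greedily on the available arms (ties between empirical means are broken uniformly at random;
if no arm is available then the player does not choose an arm). -/
def megaChoose (c d β : ℝ) (u : Coin → ℝ) (s : MegaState K) : Option (Fin K) :=
  if megaPersists u s then s.last
  else if u .explore < megaEps K c d s.clock then pick (megaAvail β u s) (u .arm)
  else pick ((megaAvail β u s).filter fun k => ∀ l ∈ megaAvail β u s, s.est l ≤ s.est k) (u .arm)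

open scoped Classical in
/-- The MEGA algorithm with parameters `c, d, p₀, α, β`. -/
def mega (K : ℕ) (c d p₀ α β : ℝ) : Algorithm K where
  State := MegaState K
  init := ⟨1, none, False, p₀, fun _ => 1, fun _ => 0, fun _ => 0⟩
  choose _ u s := megaChoose c d β u s
  update _ u s a coll r :=
    { clock := s.clock + 1
      last := a
      collided := coll
      p := if a ≠ none ∧ a = s.last then s.p * α + (1 - α) else p₀
      next := megaNext β u s
      obs := fun k => if a = some k ∧ ¬ coll then s.obs k + 1 else s.obs k
      sum := fun k => if a = some k ∧ ¬ coll then s.sum k + r else s.sum k }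

end Mega

section DMC

/-! ### The Dynamic Musical Chairs algorithm -/

variable {K : ℕ}

/-- State of a DMC player: `synced` says that she took part in the beginning of the current
epoch or of an earlier one, `colls` counts her collisions in the learning phase of the epoch,
`obs k` and `sum k` are the number and the sum of the rewards that she received from arm `k` in that
phase, and `seat` is the arm on which she is fixed. -/
structure DMCState (K : ℕ) where
  synced : Prop
  colls : ℕ
  obs : Fin K → ℕ
  sum : Fin K → ℝ
  seat : Option (Fin K)

/-- Empirical means of the learning phase. -/
def DMCState.est (s : DMCState K) (k : Fin K) : ℝ := s.sum k / (s.obs k : ℝ)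

open scoped Classical in
/-- The estimated number of players at the end of a learning phase of `T₀` rounds. -/
def DMCState.nStar (T₀ : ℕ) (s : DMCState K) : ℕ :=
  if s.colls = T₀ then K
  else (round (Real.log (((T₀ : ℝ) - s.colls) / T₀) / Real.log (1 - 1 / (K : ℝ)) + 1)).toNat

/-- Position of round `t ≥ 1` in its epoch, counted from `0`; epochs have `T₁` rounds. -/
def epochPos (T₁ t : ℕ) : ℕ := (t - 1) % T₁

open scoped Classical in
/-- At the beginning of each epoch the algorithm is restarted. -/
def dmcRestart (T₁ t : ℕ) (s : DMCState K) : DMCState K :=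
  if epochPos T₁ t = 0 then ⟨True, 0, fun _ => 0, fun _ => 0, none⟩ else s

open scoped Classical in
/-- Explore uniformly in the first `T₀` rounds of each epoch, and also up to the first beginning of
an epoch after entering; afterwards play musical chairs on the first `N*` arms of the empirical
ranking until being fixed (there are only `K` arms, even if `N* > K`). -/
def dmcChoose (T₀ T₁ t : ℕ) (u : Coin → ℝ) (s₀ : DMCState K) : Option (Fin K) :=
  let s := dmcRestart T₁ t s₀
  if ¬ s.synced ∨ epochPos T₁ t < T₀ then pick Finset.univ (u .arm)
  else match s.seat with
    | some k => some k
    | none => (pick (Finset.univ.filter fun i => i.val < s.nStar T₀) (u .arm)).map (ranking s.est)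

open scoped Classical in
/-- The Dynamic Musical Chairs algorithm with `T₀` learning rounds in each epoch of `T₁` rounds. -/
def dmc (K T₀ T₁ : ℕ) : Algorithm K where
  State := DMCState K
  init := ⟨False, 0, fun _ => 0, fun _ => 0, none⟩
  choose t u s := dmcChoose T₀ T₁ t u s
  update t _ s₀ a coll r :=
    let s := dmcRestart T₁ t s₀
    if ¬ s.synced then s
    else if epochPos T₁ t < T₀ then
      { s with
        colls := if coll then s.colls + 1 else s.colls
        obs := fun k => if a = some k ∧ ¬ coll then s.obs k + 1 else s.obs k
        sum := fun k => if a = some k ∧ ¬ coll then s.sum k + r else s.sum k }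
    else
      { s with seat := if s.seat = none ∧ ¬ coll then a else s.seat }

/-- The number of learning rounds in each epoch, for horizon `T`, accuracy `ε` and confidence
parameter `δ`. -/
def dmcT₀ (K : ℕ) (ε δ : ℝ) (T : ℕ) : ℕ :=
  ⌈max (max ((K : ℝ) / 2 * Real.log (2 * (K : ℝ) ^ 2 / (δ / (2 * T))))
      (16 * (K : ℝ) / ε ^ 2 * Real.log (4 * (K : ℝ) ^ 2 / (δ / (2 * T)))))
    ((K : ℝ) ^ 2 * Real.log (4 * T / δ) / 0.02)⌉₊

/-- The ranking by `est` is `ε`-correct for the true values `v`. -/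
def EpsCorrect (v : Fin K → ℝ) (ε : ℝ) (est : Fin K → ℝ) : Prop :=
  ∀ i j, ε < v i - v j → (ranking est).symm i < (ranking est).symm j

/-- The event that in every epoch whose learning phase is completed by round `T`, every player who
takes part in the whole learning phase obtains an `ε`-correct ranking, and estimates the number of
players correctly if the set of players does not change during the learning phase. -/
def dmcGood {N : ℕ} (T₀ T₁ T : ℕ) (ε : ℝ) (active : Fin N → ℕ → Prop) (ν : Fin K → Measure ℝ) :
    Set (Sample N K) :=
  {ω | ∀ m : ℕ, m * T₁ + T₀ ≤ T → ∀ j : Fin N,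
    (∀ t ∈ Finset.Icc (m * T₁ + 1) (m * T₁ + T₀), active j t) →
      let s : DMCState K := states (dmc K T₀ T₁) active ω (m * T₁ + T₀) j
      EpsCorrect (mean ν) ε s.est ∧
        ((∀ i, ∀ t ∈ Finset.Icc (m * T₁ + 1) (m * T₁ + T₀),
            (active i t ↔ active i (m * T₁ + 1))) →
          s.nStar T₀ = numActive active (m * T₁ + 1))}

end DMC

/-- The two-player scenario: the first player (index `0`) is present from round `1` and leaves at
round `⌈T/2 + f T⌉`, the second player (index `1`) enters at round `⌈T/2⌉`. -/
def scenario (T : ℕ) (f : ℝ) (j : Fin 2) (t : ℕ) : Prop :=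
  if j = 0 then t < ⌈(T : ℝ) / 2 + f * T⌉₊ else ⌈(T : ℝ) / 2⌉₊ ≤ t

/-- Rewards lie in `[0, 1]`, `a₁` is the best arm, `a₂` is the second best arm, all other arms are
worse, these gaps exceed `g`, and the second best arm has a positive expected reward (which is
automatic if there is a third arm and `0 ≤ g`). -/
structure Instance {K : ℕ} (ν : Fin K → Measure ℝ) (a₁ a₂ : Fin K) (g : ℝ) : Prop where
  prob : ∀ k, IsProbabilityMeasure (ν k)
  supp : ∀ k, ∀ᵐ x ∂(ν k), x ∈ Set.Icc (0 : ℝ) 1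
  gap_one : g < mean ν a₁ - mean ν a₂
  gap_two : ∀ k, k ≠ a₁ → k ≠ a₂ → g < mean ν a₂ - mean ν k
  pos : 0 < mean ν a₂

end

end MultiBandit

open MultiBandit

namespace MultiBandit

noncomputable section

/-! ### Uniform picks -/

/-! MEGA. It suffices to find an event whose probability is bounded below independently of `T`, `α`,
`β`, `p₀`, and on which the regret is linear; Markov's inequality then finishes. On this event the
first player explores all arms round-robin in the first `n₀` rounds and never explores from round
`n₁` (about `T/8`) on. From then on she repeats the best arm, so `1 - p` shrinks by the factor `α`
per round and is at most `1/(4fT)` when the second player arrives: with constant probability she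
persists through all collisions. The second player therefore never gets a collision-free sample of
`a₁` while the first is present, and its empirical mean keeps the default value `0`. Either linearly
many rounds of the overlap are already costly, or the second player has mostly sat on `a₂` and its
empirical mean is positive. In the latter case, as she does not explore from round `h` on, she
avoids `a₁` even after the first player has left, and each later round costs at least the gap `g`.
Blocking is harmless: the first player always persists, and the second can collide only on `a₁`, so
`a₂` stays available to her.

The circularity that few costly rounds are needed to keep the first player's estimates correct,
while her behaviour determines the costs, is broken by `plannedArm`: the plan depends on coins only,
so the reward table can be controlled on the planned rounds in advance. `mega_first_player` shows by
induction that the plan is followed, `mega_regret_ge` draws the consequence, and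
`coinBox_scenario_prob` and `typicalTable_prob` bound the probabilities. The coin bound is a product
over `8T` coins; all but boundedly many constraints have probability at least `1 - O(1/T)`.

DMC. In a learning phase the choices are functions of the arm coins alone. Given the coins,
Hoeffding's inequality controls the empirical means in terms of the number of solo rounds, whose
exponential moment is then averaged over the coins (`estimateBad_prob`). Hoeffding applied to the
collision count gives `C / T₀` within `1/(4K)` of `1/K`, which is precise enough for the rounding to
yield two players (`nStar_eq_two`). A union bound over epochs gives `dmcGood_prob`. On the good
event, in an epoch without arrivals or departures, a lone player plays `a₁`, and two players occupy
`a₁` and `a₂` as soon as their fair choices differ (`dmc_pair`), so the waiting cost is geometric.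
Conditioning multiplies probabilities by at most `4`. Each epoch thus costs `O(T₀)` and the at most
two epochs with a change cost `O(T₁)` each; with about `√T` epochs both contributions are of order
`√T` up to powers of `K/ε` and the logarithm. -/

lemma pick_univ_eq {K : ℕ} (u : ℝ) (k : Fin K) :
    pick Finset.univ u = some k ↔ ⌊u * (K : ℝ)⌋₊ = k.val := by
  unfold pick
  rw [show (Finset.univ : Finset (Fin K)).sort (· ≤ ·) = List.finRange K from Fin.sort_univ K]
  rw [List.getElem?_eq_some_iff]
  simp only [Finset.card_univ, Fintype.card_fin, List.length_finRange, List.getElem_finRange,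
    Fin.cast_mk]
  constructor
  · rintro ⟨h, h'⟩
    rw [← h']
  · intro h
    exact ⟨h ▸ k.2, Fin.ext h⟩

lemma pick_mem {K : ℕ} {S : Finset (Fin K)} {u : ℝ} {k : Fin K} (h : pick S u = some k) :
    k ∈ S := by
  unfold pick at h
  exact (Finset.mem_sort (· ≤ ·)).1 (List.mem_of_getElem? h)

lemma floor_mul_card_lt {n : ℕ} (hn : 0 < n) {u : ℝ} (hu : u ∈ Set.Ico (0 : ℝ) 1) :
    ⌊u * (n : ℝ)⌋₊ < n := by
  have hn' : (0 : ℝ) < n := by exact_mod_cast hn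
  rw [Nat.floor_lt (mul_nonneg hu.1 hn'.le)]
  nlinarith [hu.2]

lemma exists_pick {K : ℕ} {S : Finset (Fin K)} (hS : S.Nonempty) {u : ℝ}
    (hu : u ∈ Set.Ico (0 : ℝ) 1) : ∃ k ∈ S, pick S u = some k := by
  have h : ⌊u * (S.card : ℝ)⌋₊ < (S.sort (· ≤ ·)).length := by
    rw [Finset.length_sort]
    exact floor_mul_card_lt hS.card_pos hu
  have h' : pick S u = some ((S.sort (· ≤ ·))[⌊u * (S.card : ℝ)⌋₊]) :=
    List.getElem?_eq_getElem h
  exact ⟨_, pick_mem h', h'⟩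

lemma pick_singleton {K : ℕ} {a : Fin K} {u : ℝ} (hu : u ∈ Set.Ico (0 : ℝ) 1) :
    pick {a} u = some a := by
  obtain ⟨k, hk, h⟩ := exists_pick (S := {a}) ⟨a, by simp⟩ hu
  rw [h, Finset.mem_singleton.1 hk]

/-- With two candidates the coin acts as a fair bit. The two elements do not depend on `u`, so two
players with the same candidates choose alike exactly when their coins lie in the same half. -/
lemma exists_pick_pair {K : ℕ} {S : Finset (Fin K)} (hS : S.card = 2) :
    ∃ x ∈ S, ∃ y ∈ S, x ≠ y ∧ ∀ u ∈ Set.Ico (0 : ℝ) 1,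
      pick S u = some (if u < 1 / 2 then x else y) := by
  have hl : (S.sort (· ≤ ·)).length = 2 := by rw [Finset.length_sort, hS]
  obtain ⟨x, y, hxy⟩ := List.length_eq_two.1 hl
  have hnd := S.sort_nodup (· ≤ ·)
  rw [hxy] at hnd
  refine ⟨x, (Finset.mem_sort (· ≤ ·)).1 (by rw [hxy]; simp), y,
    (Finset.mem_sort (· ≤ ·)).1 (by rw [hxy]; simp), by simpa using hnd, fun u hu => ?_⟩
  unfold pick
  rw [hxy, hS]
  split_ifs with h
  · have : ⌊u * ((2 : ℕ) : ℝ)⌋₊ = 0 := by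
      rw [Nat.floor_eq_zero]; push_cast; linarith
    rw [this]; rfl
  · have : ⌊u * ((2 : ℕ) : ℝ)⌋₊ = 1 := by
      rw [Nat.floor_eq_iff (by have := hu.1; positivity)]
      push_cast
      have := hu.2
      constructor <;> linarith
    rw [this]; rfl

/-! ### Rankings -/

variable {K : ℕ}

lemma ranking_symm_lt {v : Fin K → ℝ} {i j : Fin K} (h : v j < v i) :
    (ranking v).symm i < (ranking v).symm j := by
  by_contra hc
  rw [not_lt] at hc
  have := Tuple.monotone_sort (fun k => -v k) hc
  simp only [Function.comp] at this
  change -v (ranking v ((ranking v).symm j)) ≤ -v (ranking v ((ranking v).symm i)) at this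
  rw [Equiv.apply_symm_apply, Equiv.apply_symm_apply] at this
  linarith

lemma perm_zero_of_lt {σ : Equiv.Perm (Fin K)} {a : Fin K}
    (h : ∀ k, k ≠ a → σ.symm a < σ.symm k) {i : Fin K} (hi : i.val = 0) : σ i = a := by
  by_contra hc
  have := h _ hc
  rw [Equiv.symm_apply_apply, Fin.lt_def, hi] at this
  omega

/-- If another arm were in position `1`, then `b` would precede it and be in position `0`, which
leaves no room for `a` in front of `b`. -/
lemma perm_one_of_lt {σ : Equiv.Perm (Fin K)} {a b : Fin K}
    (h : ∀ k, k ≠ a → σ.symm a < σ.symm k) (hab : a ≠ b)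
    (h' : ∀ k, k ≠ a → k ≠ b → σ.symm b < σ.symm k) {i : Fin K} (hi : i.val = 1) : σ i = b := by
  by_contra hc
  have h0 : (⟨0, by have := i.2; omega⟩ : Fin K) ≠ i := by
    intro h; rw [← h] at hi; simp at hi
  have ha : σ ⟨0, by have := i.2; omega⟩ = a := perm_zero_of_lt h rfl
  have hia : σ i ≠ a := by
    intro h; rw [← ha] at h; exact h0 (σ.injective h).symm
  have h1 := h' _ hia hc
  rw [Equiv.symm_apply_apply, Fin.lt_def, hi] at h1
  have h2 := h b hab.symm
  rw [Fin.lt_def] at h2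
  omega

/-- `v` takes values in `[0, 1]`, its largest value is at `a₁`, its second largest value is at `a₂`,
and all gaps and `v a₂` are at least `g`. -/
structure TopTwo (v : Fin K → ℝ) (a₁ a₂ : Fin K) (g : ℝ) : Prop where
  nonneg : ∀ k, 0 ≤ v k
  le_one : ∀ k, v k ≤ 1
  gap_one : g ≤ v a₁ - v a₂
  gap_two : ∀ k, k ≠ a₁ → k ≠ a₂ → g ≤ v a₂ - v k
  pos : g ≤ v a₂

lemma mean_mem {ν : Fin K → Measure ℝ} {a₁ a₂ : Fin K} {g : ℝ} (h : Instance ν a₁ a₂ g)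
    (k : Fin K) : mean ν k ∈ Set.Icc (0 : ℝ) 1 := by
  have := h.prob k
  constructor
  · exact integral_nonneg_of_ae ((h.supp k).mono fun x hx => hx.1)
  · have : ∫ x, x ∂(ν k) ≤ ∫ _, (1 : ℝ) ∂(ν k) := by
      refine integral_mono_ae ?_ (integrable_const _) ((h.supp k).mono fun x hx => hx.2)
      exact Integrable.of_mem_Icc 0 1 aemeasurable_id (h.supp k)
    simpa [mean] using this

/-- There are finitely many gaps, so one positive `g` serves for all of them. The value `1` assigned
to `a₁` and `a₂` is a placeholder that keeps the minimum positive. -/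
lemma Instance.exists_topTwo {ν : Fin K → Measure ℝ} {a₁ a₂ : Fin K}
    (h : Instance ν a₁ a₂ 0) : ∃ g, 0 < g ∧ TopTwo (mean ν) a₁ a₂ g := by
  classical
  let s : Fin K → ℝ := fun k => if k = a₁ ∨ k = a₂ then 1 else mean ν a₂ - mean ν k
  have hs : ∀ k, 0 < s k := by
    intro k
    simp only [s]
    split_ifs with hk
    · exact one_pos
    · push Not at hk
      exact h.gap_two k hk.1 hk.2
  have hne : (Finset.univ : Finset (Fin K)).Nonempty := ⟨a₁, Finset.mem_univ _⟩
  refine ⟨min (Finset.univ.inf' hne s) (min (mean ν a₁ - mean ν a₂) (mean ν a₂)), ?_,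
    fun k => (mean_mem h k).1, fun k => (mean_mem h k).2, ?_, ?_, ?_⟩
  · refine lt_min ?_ (lt_min h.gap_one h.pos)
    rw [Finset.lt_inf'_iff]
    exact fun k _ => hs k
  · exact (min_le_right _ _).trans (min_le_left _ _)
  · intro k h1 h2
    refine (min_le_left _ _).trans ((Finset.inf'_le s (Finset.mem_univ k)).trans ?_)
    simp [s, h1, h2]
  · exact (min_le_right _ _).trans (min_le_right _ _)

/-- The degenerate gap `0` already gives the order of the arms, which is all that the two-sided
bound on the regret of a round needs. -/
lemma Instance.topTwo {ν : Fin K → Measure ℝ} {a₁ a₂ : Fin K} {g : ℝ} (hg : 0 ≤ g)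
    (h : Instance ν a₁ a₂ g) : TopTwo (mean ν) a₁ a₂ 0 where
  nonneg k := (mean_mem h k).1
  le_one k := (mean_mem h k).2
  gap_one := hg.trans h.gap_one.le
  gap_two k h1 h2 := hg.trans (h.gap_two k h1 h2).le
  pos := h.pos.le

lemma EpsCorrect.zero {ν : Fin K → Measure ℝ} {a₁ a₂ : Fin K} {g : ℝ}
    (hg : 0 ≤ g) (h : Instance ν a₁ a₂ g) {est : Fin K → ℝ} (he : EpsCorrect (mean ν) g est)
    {i : Fin K} (hi : i.val = 0) : ranking est i = a₁ := by
  refine perm_zero_of_lt (fun k hk => he _ _ ?_) hi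
  by_cases hk2 : k = a₂
  · exact hk2 ▸ h.gap_one
  · linarith [h.gap_one, h.gap_two k hk hk2]

lemma EpsCorrect.one {ν : Fin K → Measure ℝ} {a₁ a₂ : Fin K} {g : ℝ}
    (hg : 0 ≤ g) (h : Instance ν a₁ a₂ g) {est : Fin K → ℝ} (he : EpsCorrect (mean ν) g est)
    {i : Fin K} (hi : i.val = 1) : ranking est i = a₂ := by
  have hne : a₁ ≠ a₂ := by
    rintro rfl
    have := h.gap_one
    simp only [sub_self] at this
    linarith
  refine perm_one_of_lt (a := a₁) (fun k hk => he _ _ ?_) hne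
    (fun k h1 h2 => he _ _ (h.gap_two k h1 h2)) hi
  by_cases hk2 : k = a₂
  · exact hk2 ▸ h.gap_one
  · linarith [h.gap_one, h.gap_two k hk hk2]

/-- Lets `topSum` be evaluated by the lemmas on correct empirical rankings, applied to the true
means. -/
lemma epsCorrect_self (v : Fin K → ℝ) {g : ℝ} (hg : 0 ≤ g) : EpsCorrect v g v :=
  fun _ _ h => ranking_symm_lt (by linarith)

lemma topSum_one {ν : Fin K → Measure ℝ} {a₁ a₂ : Fin K} {g : ℝ} (hg : 0 ≤ g) (hK : 2 ≤ K)
    (h : Instance ν a₁ a₂ g) : topSum (mean ν) 1 = mean ν a₁ := by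
  obtain ⟨K, rfl⟩ : ∃ n, K = n + 2 := ⟨K - 2, by omega⟩
  unfold topSum
  rw [Fin.sum_univ_succ, Finset.sum_eq_zero]
  · simp [EpsCorrect.zero hg h (epsCorrect_self _ hg) (i := 0) rfl]
  · simp

lemma topSum_two {ν : Fin K → Measure ℝ} {a₁ a₂ : Fin K} {g : ℝ} (hg : 0 ≤ g) (hK : 2 ≤ K)
    (h : Instance ν a₁ a₂ g) : topSum (mean ν) 2 = mean ν a₁ + mean ν a₂ := by
  obtain ⟨K, rfl⟩ : ∃ n, K = n + 2 := ⟨K - 2, by omega⟩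
  unfold topSum
  rw [Fin.sum_univ_succ, Fin.sum_univ_succ, Finset.sum_eq_zero]
  · simp [EpsCorrect.zero hg h (epsCorrect_self _ hg) (i := 0) rfl,
      EpsCorrect.one hg h (epsCorrect_self _ hg) (i := 1) rfl]
  · simp

/-! ### The regret of one round -/

lemma collides_zero {a : Fin 2 → Option (Fin K)} : Collides a 0 ↔ a 0 ≠ none ∧ a 1 = a 0 := by
  unfold Collides
  simp [Fin.exists_fin_two]

lemma collides_one {a : Fin 2 → Option (Fin K)} : Collides a 1 ↔ a 1 ≠ none ∧ a 0 = a 1 := by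
  unfold Collides
  simp [Fin.exists_fin_two]

lemma collides_comm {a : Fin 2 → Option (Fin K)} : Collides a 0 ↔ Collides a 1 := by
  rw [collides_zero, collides_one]
  constructor
  · rintro ⟨h, h'⟩; exact ⟨h' ▸ h, h'.symm⟩
  · rintro ⟨h, h'⟩; exact ⟨h' ▸ h, h'.symm⟩

lemma gain_none {v : Fin K → ℝ} {N : ℕ} {a : Fin N → Option (Fin K)} {j : Fin N}
    (h : a j = none) : gain v a j = 0 := by
  simp only [gain, h]

lemma gain_collides {v : Fin K → ℝ} {N : ℕ} {a : Fin N → Option (Fin K)} {j : Fin N}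
    (h : Collides a j) : gain v a j = 0 := by
  unfold gain
  split
  · rfl
  · rw [if_pos h]

lemma gain_some {v : Fin K → ℝ} {N : ℕ} {a : Fin N → Option (Fin K)} {j : Fin N} {k : Fin K}
    (h : a j = some k) (hc : ¬ Collides a j) : gain v a j = v k := by
  simp only [gain, h]
  rw [if_neg hc]

lemma gain_nonneg {v : Fin K → ℝ} (hv : ∀ k, 0 ≤ v k) {N : ℕ} (a : Fin N → Option (Fin K))
    (j : Fin N) : 0 ≤ gain v a j := by
  unfold gain
  split
  · rfl
  · split_ifs
    · rfl
    · exact hv _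

variable {v : Fin K → ℝ} {a₁ a₂ : Fin K} {g : ℝ}

lemma TopTwo.le_one_arm (h : TopTwo v a₁ a₂ g) (hg : 0 ≤ g) (k : Fin K) : v k ≤ v a₁ := by
  by_cases h1 : k = a₁
  · rw [h1]
  by_cases h2 : k = a₂
  · rw [h2]; linarith [h.gap_one]
  · linarith [h.gap_one, h.gap_two k h1 h2]

lemma TopTwo.le_two (h : TopTwo v a₁ a₂ g) (hg : 0 ≤ g) {k : Fin K} (hk : k ≠ a₁) :
    v k ≤ v a₂ := by
  by_cases h2 : k = a₂
  · rw [h2]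
  · linarith [h.gap_two k hk h2]

lemma gain_le_top (h : TopTwo v a₁ a₂ g) (hg : 0 ≤ g) {N : ℕ} (a : Fin N → Option (Fin K))
    (j : Fin N) : gain v a j ≤ v a₁ := by
  unfold gain
  split
  · exact h.nonneg _
  · split_ifs
    · exact h.nonneg _
    · exact h.le_one_arm hg _

lemma gain_le_of_ne (h : TopTwo v a₁ a₂ g) (hg : 0 ≤ g) {N : ℕ} {a : Fin N → Option (Fin K)}
    {j : Fin N} (hj : a j ≠ some a₁) : gain v a j ≤ v a₂ := by
  unfold gain
  split
  · exact h.nonneg _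
  · rename_i k hk
    split_ifs
    · exact h.nonneg _
    · exact h.le_two hg fun hc => hj (by rw [hk, hc])

lemma gain_le_of_ne_of_ne (h : TopTwo v a₁ a₂ g) {N : ℕ} {a : Fin N → Option (Fin K)}
    {j : Fin N} (hj : a j ≠ some a₁) (hj' : a j ≠ some a₂) : gain v a j ≤ v a₂ - g := by
  unfold gain
  split
  · linarith [h.pos]
  · rename_i k hk
    split_ifs
    · linarith [h.pos]
    · linarith [h.gap_two k (fun hc => hj (by rw [hk, hc])) (fun hc => hj' (by rw [hk, hc]))]

lemma sum_gain_le (h : TopTwo v a₁ a₂ g) (hg : 0 ≤ g) (a : Fin 2 → Option (Fin K)) :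
    ∑ j, gain v a j ≤ v a₁ + v a₂ := by
  rw [Fin.sum_univ_two]
  by_cases h0 : a 0 = some a₁
  · by_cases h1 : a 1 = some a₁
    · have hc : Collides a 0 := collides_zero.2 ⟨by simp [h0], by rw [h0, h1]⟩
      rw [gain_collides hc, gain_collides (collides_comm.1 hc)]
      linarith [h.nonneg a₁, h.nonneg a₂]
    · linarith [gain_le_top h hg a 0, gain_le_of_ne h hg h1]
  · linarith [gain_le_top h hg a 1, gain_le_of_ne h hg h0]

/-- While the first player holds `a₁`, anything but `a₂` costs `g`: a collision loses both rewards,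
a worse arm loses the second gap, and no arm loses `v a₂`. -/
lemma sum_gain_le_of_ne (h : TopTwo v a₁ a₂ g) (hg : 0 ≤ g) {a : Fin 2 → Option (Fin K)}
    (h0 : a 0 = some a₁) (h1 : a 1 ≠ some a₂) :
    ∑ j, gain v a j ≤ v a₁ + v a₂ - g := by
  rw [Fin.sum_univ_two]
  by_cases h1' : a 1 = some a₁
  · have hc : Collides a 0 := collides_zero.2 ⟨by simp [h0], by rw [h0, h1']⟩
    rw [gain_collides hc, gain_collides (collides_comm.1 hc)]
    linarith [h.nonneg a₁, h.pos]
  · linarith [gain_le_top h hg a 0, gain_le_of_ne_of_ne h h1' h1]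

lemma sum_gain_le_of_collides (h : TopTwo v a₁ a₂ g) {a : Fin 2 → Option (Fin K)}
    (hc : Collides a 0) : ∑ j, gain v a j ≤ v a₁ + v a₂ - g := by
  rw [Fin.sum_univ_two, gain_collides hc, gain_collides (collides_comm.1 hc)]
  linarith [h.nonneg a₁, h.pos]

/-- The regret of round `t`. -/
def roundRegret {N : ℕ} (alg : Algorithm K) (active : Fin N → ℕ → Prop) (ν : Fin K → Measure ℝ)
    (t : ℕ) (ω : Sample N K) : ℝ :=
  topSum (mean ν) (numActive active t) - ∑ j : Fin N, gain (mean ν) (played alg active ω t) j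

lemma regret_eq_sum {N : ℕ} (alg : Algorithm K) (active : Fin N → ℕ → Prop)
    (ν : Fin K → Measure ℝ) (T : ℕ) (ω : Sample N K) :
    regret alg active ν T ω = ∑ t ∈ Finset.Icc 1 T, roundRegret alg active ν t ω := by
  simp only [regret, roundRegret, Finset.sum_sub_distrib]

open scoped Classical in
lemma numActive_two (active : Fin 2 → ℕ → Prop) (t : ℕ) :
    numActive active t = (if active 0 t then 1 else 0) + (if active 1 t then 1 else 0) := by
  unfold numActive
  rw [Finset.card_filter, Fin.sum_univ_two]

lemma played_of_not_active {N : ℕ} {alg : Algorithm K} {active : Fin N → ℕ → Prop} {t : ℕ}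
    {ω : Sample N K} {j : Fin N} (h : ¬ active j t) : played alg active ω t j = none := by
  simp [played, actions, h]

section

variable {ν : Fin K → Measure ℝ} {alg : Algorithm K} {active : Fin 2 → ℕ → Prop} {t : ℕ}
  {ω : Sample 2 K}

lemma roundRegret_both (hK : 2 ≤ K) (hg : 0 ≤ g) (h : Instance ν a₁ a₂ g) (h0 : active 0 t)
    (h1 : active 1 t) : roundRegret alg active ν t ω =
      mean ν a₁ + mean ν a₂ - ∑ j, gain (mean ν) (played alg active ω t) j := by
  rw [roundRegret, numActive_two, if_pos h0, if_pos h1, topSum_two hg hK h]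

lemma roundRegret_zero (hK : 2 ≤ K) (hg : 0 ≤ g) (h : Instance ν a₁ a₂ g) (h0 : active 0 t)
    (h1 : ¬ active 1 t) : roundRegret alg active ν t ω =
      mean ν a₁ - gain (mean ν) (played alg active ω t) 0 := by
  rw [roundRegret, numActive_two, if_pos h0, if_neg h1, topSum_one hg hK h, Fin.sum_univ_two,
    gain_none (j := 1) (played_of_not_active h1), add_zero]

lemma roundRegret_one (hK : 2 ≤ K) (hg : 0 ≤ g) (h : Instance ν a₁ a₂ g) (h0 : ¬ active 0 t)
    (h1 : active 1 t) : roundRegret alg active ν t ω =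
      mean ν a₁ - gain (mean ν) (played alg active ω t) 1 := by
  rw [roundRegret, numActive_two, if_neg h0, if_pos h1, topSum_one hg hK h, Fin.sum_univ_two,
    gain_none (j := 0) (played_of_not_active h0), zero_add]

lemma roundRegret_none (h0 : ¬ active 0 t) (h1 : ¬ active 1 t) :
    roundRegret alg active ν t ω = 0 := by
  rw [roundRegret, numActive_two, if_neg h0, if_neg h1, Fin.sum_univ_two,
    gain_none (j := 0) (played_of_not_active h0), gain_none (j := 1) (played_of_not_active h1)]
  simp [topSum]

/-- Nonnegativity makes Markov's inequality and sums over selected rounds possible for MEGA. The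
bound `2` is the price of every uncontrolled round of DMC, and both together give integrability. -/
lemma roundRegret_mem (hK : 2 ≤ K) (hg : 0 ≤ g) (h : Instance ν a₁ a₂ g) :
    roundRegret alg active ν t ω ∈ Set.Icc (0 : ℝ) 2 := by
  have hT := h.topTwo hg
  have hn := gain_nonneg hT.nonneg (played alg active ω t)
  have h1 := hT.le_one a₁
  have h2 := hT.le_one a₂
  by_cases h0 : active 0 t <;> by_cases h1 : active 1 t
  · rw [roundRegret_both hK hg h h0 h1]
    have := sum_gain_le hT le_rfl (played alg active ω t)
    have h3 : 0 ≤ ∑ j, gain (mean ν) (played alg active ω t) j :=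
      Finset.sum_nonneg fun j _ => hn j
    constructor <;> linarith
  · rw [roundRegret_zero hK hg h h0 h1]
    have := gain_le_top hT le_rfl (played alg active ω t) 0
    constructor <;> linarith [hn 0]
  · rw [roundRegret_one hK hg h h0 h1]
    have := gain_le_top hT le_rfl (played alg active ω t) 1
    constructor <;> linarith [hn 1]
  · rw [roundRegret_none h0 h1]
    simp

lemma roundRegret_ge_of_collides (hK : 2 ≤ K) (h : Instance ν a₁ a₂ 0)
    (hT : TopTwo (mean ν) a₁ a₂ g) (h0 : active 0 t) (h1 : active 1 t)
    (hc : Collides (played alg active ω t) 0) : g ≤ roundRegret alg active ν t ω := by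
  rw [roundRegret_both hK le_rfl h h0 h1]
  linarith [sum_gain_le_of_collides hT hc]

lemma roundRegret_ge_of_ne (hK : 2 ≤ K) (h : Instance ν a₁ a₂ 0) (hg : 0 ≤ g)
    (hT : TopTwo (mean ν) a₁ a₂ g) (h0 : active 0 t) (h1 : active 1 t)
    (hp0 : played alg active ω t 0 = some a₁) (hp1 : played alg active ω t 1 ≠ some a₂) :
    g ≤ roundRegret alg active ν t ω := by
  rw [roundRegret_both hK le_rfl h h0 h1]
  linarith [sum_gain_le_of_ne hT hg hp0 hp1]

lemma roundRegret_ge_of_one_ne (hK : 2 ≤ K) (h : Instance ν a₁ a₂ 0) (hg : 0 ≤ g)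
    (hT : TopTwo (mean ν) a₁ a₂ g) (h0 : ¬ active 0 t) (h1 : active 1 t)
    (hp1 : played alg active ω t 1 ≠ some a₁) :
    g ≤ roundRegret alg active ν t ω := by
  rw [roundRegret_one hK le_rfl h h0 h1]
  linarith [gain_le_of_ne hT hg hp1, hT.gap_one]

lemma not_collides_of_not_active_one (h1 : ¬ active 1 t) (j : Fin 2) :
    ¬ Collides (played alg active ω t) j := by
  have : ¬ Collides (played alg active ω t) 1 := fun h => h.1 (played_of_not_active h1)
  fin_cases j
  · exact fun h => this (collides_comm.1 h)
  · exact this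

lemma not_collides_of_not_active_zero (h0 : ¬ active 0 t) (j : Fin 2) :
    ¬ Collides (played alg active ω t) j := by
  have : ¬ Collides (played alg active ω t) 0 := fun h => h.1 (played_of_not_active h0)
  fin_cases j
  · exact this
  · exact fun h => this (collides_comm.2 h)

end

end

end MultiBandit

namespace MultiBandit

noncomputable section

/-! ### Measurability of a game -/

/-- Finite types carry the discrete σ-algebra, so every function of choices, candidate sets and
rankings is measurable. -/
instance instMeasurableSpaceArm {K : ℕ} : MeasurableSpace (Option (Fin K)) := ⊤

instance instDiscreteArm {K : ℕ} : DiscreteMeasurableSpace (Option (Fin K)) := ⟨fun _ => trivial⟩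

instance instMeasurableSpaceArms {K : ℕ} : MeasurableSpace (Finset (Fin K)) := ⊤

instance instDiscreteArms {K : ℕ} : DiscreteMeasurableSpace (Finset (Fin K)) := ⟨fun _ => trivial⟩

instance instMeasurableSpacePerm {K : ℕ} : MeasurableSpace (Equiv.Perm (Fin K)) := ⊤

instance instDiscretePerm {K : ℕ} : DiscreteMeasurableSpace (Equiv.Perm (Fin K)) :=
  ⟨fun _ => trivial⟩

variable {Ω : Type*} [MeasurableSpace Ω] {K N : ℕ}

lemma measurable_pick {S : Ω → Finset (Fin K)} {u : Ω → ℝ} (hS : Measurable S)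
    (hu : Measurable u) : Measurable fun ω => pick (S ω) (u ω) := by
  have : Measurable fun p : Finset (Fin K) × ℝ => pick p.1 p.2 := by
    refine measurable_from_prod_countable_right fun S => ?_
    have hf : Measurable fun x : ℝ => ⌊x * (S.card : ℝ)⌋₊ :=
      Nat.measurable_floor.comp (measurable_id.mul_const _)
    exact (measurable_from_nat (f := fun n => (S.sort (· ≤ ·))[n]?)).comp hf
  exact this.comp (hS.prodMk hu)

lemma measurable_filter_univ {P : Ω → Fin K → Prop} [∀ ω, DecidablePred (P ω)]
    (h : ∀ k, Measurable fun ω => P ω k) :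
    Measurable fun ω => Finset.univ.filter (P ω) := by
  refine measurable_to_countable' fun S => ?_
  have : (fun ω => Finset.univ.filter (P ω)) ⁻¹' {S} = {ω | ∀ k, P ω k ↔ k ∈ S} := by
    ext ω
    simp [Finset.ext_iff]
  rw [this, measurableSet_setOfPred]
  exact Measurable.forall fun k => (h k).iff measurable_const

/-- A stable sort equals a given permutation iff finitely many order relations between the values
hold, ties being resolved by index. -/
lemma measurable_ranking {v : Ω → Fin K → ℝ} (hv : ∀ k, Measurable fun ω => v ω k) :
    Measurable fun ω => ranking (v ω) := by
  refine measurable_to_countable' fun σ => ?_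
  have : (fun ω => ranking (v ω)) ⁻¹' {σ} = {ω | (∀ i j, i ≤ j → v ω (σ j) ≤ v ω (σ i)) ∧
      ∀ i j, i < j → v ω (σ i) = v ω (σ j) → σ i < σ j} := by
    ext ω
    simp only [Set.mem_preimage, Set.mem_singleton_iff, Set.mem_ofPred_eq]
    rw [eq_comm, ranking, Tuple.eq_sort_iff]
    simp [Monotone]
  rw [this, measurableSet_setOfPred]
  refine Measurable.and ?_ ?_
  · refine Measurable.forall fun i => Measurable.forall fun j => Measurable.imp measurable_const ?_
    exact measurableSet_setOfPred.1 (measurableSet_le (hv _) (hv _))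
  · refine Measurable.forall fun i => Measurable.forall fun j => Measurable.imp measurable_const ?_
    exact (measurableSet_setOfPred.1 (measurableSet_eq_fun (hv _) (hv _))).imp measurable_const

lemma measurable_collides {a : Ω → Fin N → Option (Fin K)} (ha : ∀ j, Measurable fun ω => a ω j)
    (j : Fin N) : Measurable fun ω => Collides (a ω) j :=
  (Measurable.of_discrete (f := fun x : Fin N → Option (Fin K) => Collides x j)).comp
    (measurable_pi_lambda a ha)

lemma measurable_gain {a : Ω → Fin N → Option (Fin K)} (ha : ∀ j, Measurable fun ω => a ω j)
    (v : Fin K → ℝ) (j : Fin N) : Measurable fun ω => gain v (a ω) j :=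
  (Measurable.of_discrete (f := fun x : Fin N → Option (Fin K) => gain v x j)).comp
    (measurable_pi_lambda a ha)

open scoped Classical in
lemma reward_eq_sum (ω : Sample N K) (t : ℕ) (a : Fin N → Option (Fin K)) (j : Fin N) :
    reward ω t a j = ∑ k, if a j = some k ∧ ¬ Collides a j then ω.2 (t, k) else 0 := by
  unfold reward
  split
  · rename_i h; simp [h]
  · rename_i k h
    by_cases hc : Collides a j
    · simp [hc]
    · simp [hc, h]

lemma measurable_coin (j : Fin N) (t : ℕ) (i : Coin) :
    Measurable fun ω : Sample N K => ω.1 (j, t, i) :=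
  (measurable_pi_apply _).comp measurable_fst

lemma measurable_table (t : ℕ) (k : Fin K) :
    Measurable fun ω : Sample N K => ω.2 (t, k) :=
  (measurable_pi_apply _).comp measurable_snd

lemma measurable_reward {a : Sample N K → Fin N → Option (Fin K)}
    (ha : ∀ j, Measurable fun ω => a ω j) (t : ℕ) (j : Fin N) :
    Measurable fun ω => reward ω t (a ω) j := by
  classical
  simp only [reward_eq_sum]
  refine Finset.measurable_sum _ fun k _ => Measurable.ite ?_ (measurable_table t k)
    measurable_const
  rw [measurableSet_setOfPred]
  exact (measurableSet_setOfPred.1 (measurableSet_eq_fun (ha j) measurable_const)).and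
    (measurable_collides ha j).not

/-- A class of random states that is preserved by the algorithm, and for which the chosen arms are
measurable. -/
structure MeasurableStates (alg : Algorithm K) (N : ℕ) (Q : (Sample N K → alg.State) → Prop) :
    Prop where
  init : Q fun _ => alg.init
  choose : ∀ t (u : Sample N K → Coin → ℝ) S, (∀ i, Measurable fun ω => u ω i) → Q S →
    Measurable fun ω => alg.choose t (u ω) (S ω)
  update : ∀ t (u : Sample N K → Coin → ℝ) S (a : Sample N K → Option (Fin K))
    (c : Sample N K → Prop) (r : Sample N K → ℝ), (∀ i, Measurable fun ω => u ω i) → Q S →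
    Measurable a → Measurable c → Measurable r →
    Q fun ω => alg.update t (u ω) (S ω) (a ω) (c ω) (r ω)

lemma MeasurableStates.actions {alg : Algorithm K} {Q : (Sample N K → alg.State) → Prop}
    (h : MeasurableStates alg N Q) (active : Fin N → ℕ → Prop) (t : ℕ)
    {S : Sample N K → Fin N → alg.State} {j : Fin N} (hS : Q fun ω => S ω j) :
    Measurable fun ω => actions alg active ω t (S ω) j := by
  unfold MultiBandit.actions
  by_cases ha : active j t
  · simp only [ha, if_true]
    exact h.choose t _ _ (fun i => measurable_coin j t i) hS
  · simp only [ha, if_false]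
    exact measurable_const

/-- The state type has no σ-algebra, so measurability is carried along the recursion by the
predicate `Q`. -/
lemma MeasurableStates.states {alg : Algorithm K} {Q : (Sample N K → alg.State) → Prop}
    (h : MeasurableStates alg N Q) (active : Fin N → ℕ → Prop) (t : ℕ) :
    ∀ j, Q fun ω => states alg active ω t j := by
  induction t with
  | zero => exact fun j => h.init
  | succ t ih =>
    intro j
    unfold MultiBandit.states
    by_cases ha : active j (t + 1)
    · simp only [ha, if_true]
      have hact := fun i => h.actions active (t + 1) (ih i)
      exact h.update _ _ _ _ _ _ (fun i => measurable_coin j (t + 1) i) (ih j) (hact j)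
        (measurable_collides hact j) (measurable_reward hact (t + 1) j)
    · simp only [ha, if_false]
      exact ih j

lemma MeasurableStates.played {alg : Algorithm K} {Q : (Sample N K → alg.State) → Prop}
    (h : MeasurableStates alg N Q) (active : Fin N → ℕ → Prop) (t : ℕ) (j : Fin N) :
    Measurable fun ω => played alg active ω t j :=
  h.actions active t (h.states active (t - 1) j)

lemma MeasurableStates.roundRegret {alg : Algorithm K} {Q : (Sample N K → alg.State) → Prop}
    (h : MeasurableStates alg N Q) (active : Fin N → ℕ → Prop) (ν : Fin K → Measure ℝ) (t : ℕ) :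
    Measurable fun ω => roundRegret alg active ν t ω := by
  unfold MultiBandit.roundRegret
  exact measurable_const.sub
    (Finset.measurable_sum _ fun j _ => measurable_gain (h.played active t) _ j)

lemma MeasurableStates.regret {alg : Algorithm K} {Q : (Sample N K → alg.State) → Prop}
    (h : MeasurableStates alg N Q) (active : Fin N → ℕ → Prop) (ν : Fin K → Measure ℝ) (T : ℕ) :
    Measurable fun ω => regret alg active ν T ω := by
  simp only [regret_eq_sum]
  exact Finset.measurable_sum _ fun t _ => h.roundRegret active ν t

/-! ### Measurability of MEGA -/

/-- All components of a random state of a MEGA player are measurable. -/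
structure MegaMeasurable (S : Ω → MegaState K) : Prop where
  clock : Measurable fun ω => (S ω).clock
  last : Measurable fun ω => (S ω).last
  collided : Measurable fun ω => (S ω).collided
  p : Measurable fun ω => (S ω).p
  next : ∀ k, Measurable fun ω => (S ω).next k
  obs : ∀ k, Measurable fun ω => (S ω).obs k
  sum : ∀ k, Measurable fun ω => (S ω).sum k

lemma MegaMeasurable.est {S : Ω → MegaState K} (h : MegaMeasurable S) (k : Fin K) :
    Measurable fun ω => (S ω).est k :=
  (h.sum k).div (measurable_from_nat.comp (h.obs k))

lemma MegaMeasurable.persists {S : Ω → MegaState K} (h : MegaMeasurable S)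
    {u : Ω → Coin → ℝ} (hu : ∀ i, Measurable fun ω => u ω i) :
    Measurable fun ω => u ω .persist < (S ω).p :=
  measurableSet_setOfPred.1 (measurableSet_lt (hu _) h.p)

lemma MegaMeasurable.next' {S : Ω → MegaState K} (h : MegaMeasurable S)
    {u : Ω → Coin → ℝ} (hu : ∀ i, Measurable fun ω => u ω i) (β : ℝ) (k : Fin K) :
    Measurable fun ω => megaNext β (u ω) (S ω) k := by
  unfold megaNext
  refine Measurable.ite (measurableSet_setOfPred.2 ?_) ?_ (h.next k)
  · exact h.collided.and ((h.persists hu).not.and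
      (measurableSet_setOfPred.1 (measurableSet_eq_fun h.last measurable_const)))
  · refine h.clock.add (Nat.measurable_floor.comp ((hu _).mul (Measurable.add_const ?_ _)))
    have h1 : Measurable fun ω => ((S ω).clock : ℝ) := measurable_from_nat.comp h.clock
    exact measurable_from_nat.comp (Nat.measurable_floor.comp (h1.pow_const β))

lemma MegaMeasurable.avail {S : Ω → MegaState K} (h : MegaMeasurable S)
    {u : Ω → Coin → ℝ} (hu : ∀ i, Measurable fun ω => u ω i) (β : ℝ) :
    Measurable fun ω => megaAvail β (u ω) (S ω) := by
  unfold megaAvail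
  exact measurable_filter_univ fun k =>
    measurableSet_setOfPred.1 (measurableSet_le (h.next' hu β k) h.clock)

lemma MegaMeasurable.choose {S : Ω → MegaState K} (h : MegaMeasurable S)
    {u : Ω → Coin → ℝ} (hu : ∀ i, Measurable fun ω => u ω i) (c d β : ℝ) :
    Measurable fun ω => megaChoose c d β (u ω) (S ω) := by
  unfold megaChoose
  have hav := h.avail hu β
  have hmem : ∀ l, Measurable fun ω => l ∈ megaAvail β (u ω) (S ω) := fun l =>
    (Measurable.of_discrete (f := fun x : Finset (Fin K) => l ∈ x)).comp hav
  refine Measurable.ite (measurableSet_setOfPred.2 (h.collided.and (h.persists hu))) h.last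
    (Measurable.ite (measurableSet_lt (hu _) ?_) (measurable_pick hav (hu _))
      (measurable_pick ?_ (hu _)))
  · exact (measurable_from_nat (f := fun n => megaEps K c d n)).comp h.clock
  · have : (fun ω => (megaAvail β (u ω) (S ω)).filter
        fun k => ∀ l ∈ megaAvail β (u ω) (S ω), (S ω).est l ≤ (S ω).est k) = fun ω =>
        Finset.univ.filter fun k => k ∈ megaAvail β (u ω) (S ω) ∧
          ∀ l, l ∈ megaAvail β (u ω) (S ω) → (S ω).est l ≤ (S ω).est k := by
      ext ω k
      simp
    rw [this]
    exact measurable_filter_univ fun k => (hmem k).and (Measurable.forall fun l => (hmem l).imp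
      (measurableSet_setOfPred.1 (measurableSet_le (h.est l) (h.est k))))

lemma measurableStates_mega (K N : ℕ) (c d p₀ α β : ℝ) :
    MeasurableStates (mega K c d p₀ α β) N MegaMeasurable where
  init := ⟨measurable_const, measurable_const, measurable_const, measurable_const,
    fun _ => measurable_const, fun _ => measurable_const, fun _ => measurable_const⟩
  choose _ _ _ hu hS := hS.choose hu c d β
  update t u S a cl r hu hS ha hc hr := by
    have hak : ∀ k, Measurable fun ω => a ω = some k ∧ ¬ cl ω := fun k =>
      (measurableSet_setOfPred.1 (measurableSet_eq_fun ha measurable_const)).and hc.not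
    refine ⟨(measurable_from_nat (f := fun n => n + 1)).comp hS.clock, ha, hc, ?_,
      fun k => hS.next' hu β k, fun k => ?_, fun k => ?_⟩
    · refine Measurable.ite (measurableSet_setOfPred.2 (Measurable.and ?_ ?_))
        ((hS.p.mul_const _).add_const _) measurable_const
      · exact (measurableSet_setOfPred.1 (measurableSet_eq_fun ha measurable_const)).not
      · exact measurableSet_setOfPred.1 (measurableSet_eq_fun ha hS.last)
    · exact Measurable.ite (measurableSet_setOfPred.2 (hak k))
        ((measurable_from_nat (f := fun n => n + 1)).comp (hS.obs k)) (hS.obs k)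
    · exact Measurable.ite (measurableSet_setOfPred.2 (hak k)) ((hS.sum k).add hr) (hS.sum k)

/-! ### Measurability of DMC -/

/-- All components of a random state of a DMC player are measurable. -/
structure DMCMeasurable (S : Ω → DMCState K) : Prop where
  synced : Measurable fun ω => (S ω).synced
  colls : Measurable fun ω => (S ω).colls
  obs : ∀ k, Measurable fun ω => (S ω).obs k
  sum : ∀ k, Measurable fun ω => (S ω).sum k
  seat : Measurable fun ω => (S ω).seat

lemma DMCMeasurable.est {S : Ω → DMCState K} (h : DMCMeasurable S) (k : Fin K) :
    Measurable fun ω => (S ω).est k :=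
  (h.sum k).div (measurable_from_nat.comp (h.obs k))

lemma DMCMeasurable.nStar {S : Ω → DMCState K} (h : DMCMeasurable S) (T₀ : ℕ) :
    Measurable fun ω => (S ω).nStar T₀ := by
  unfold DMCState.nStar
  exact (measurable_from_nat (f := fun n => if n = T₀ then K else
    (round (Real.log (((T₀ : ℝ) - n) / T₀) / Real.log (1 - 1 / (K : ℝ)) + 1)).toNat)).comp h.colls

lemma DMCMeasurable.restart {S : Ω → DMCState K} (h : DMCMeasurable S) (T₁ t : ℕ) :
    DMCMeasurable fun ω => dmcRestart T₁ t (S ω) := by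
  unfold dmcRestart
  by_cases hp : epochPos T₁ t = 0
  · simp only [hp, if_true]
    exact ⟨measurable_const, measurable_const, fun _ => measurable_const,
      fun _ => measurable_const, measurable_const⟩
  · simp only [hp, if_false]
    exact h

lemma DMCMeasurable.choose {S : Ω → DMCState K} (h₀ : DMCMeasurable S)
    {u : Ω → Coin → ℝ} (hu : ∀ i, Measurable fun ω => u ω i) (T₀ T₁ t : ℕ) :
    Measurable fun ω => dmcChoose T₀ T₁ t (u ω) (S ω) := by
  have h := h₀.restart T₁ t
  unfold dmcChoose
  refine Measurable.ite (measurableSet_setOfPred.2 ?_) (measurable_pick measurable_const (hu _)) ?_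
  · exact h.synced.not.or measurable_const
  · have hp : Measurable fun ω => pick (Finset.univ.filter
        fun i : Fin K => i.val < (dmcRestart T₁ t (S ω)).nStar T₀) (u ω .arm) := by
      refine measurable_pick (measurable_filter_univ fun k => ?_) (hu _)
      exact measurableSet_setOfPred.1 (measurableSet_lt measurable_const (h.nStar T₀))
    have hr := measurable_ranking h.est
    exact (Measurable.of_discrete
      (f := fun x : (Option (Fin K) × Option (Fin K)) × Equiv.Perm (Fin K) =>
        match x.1.1 with
        | some k => some k
        | none => x.1.2.map x.2)).comp ((h.seat.prodMk hp).prodMk hr)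

lemma measurableStates_dmc (K N T₀ T₁ : ℕ) :
    MeasurableStates (dmc K T₀ T₁) N DMCMeasurable where
  init := ⟨measurable_const, measurable_const, fun _ => measurable_const,
    fun _ => measurable_const, measurable_const⟩
  choose t _ _ hu hS := hS.choose hu T₀ T₁ t
  update t u S a cl r hu hS₀ ha hc hr := by
    have hS := hS₀.restart T₁ t
    have hak : ∀ k, Measurable fun ω => a ω = some k ∧ ¬ cl ω := fun k =>
      (measurableSet_setOfPred.1 (measurableSet_eq_fun ha measurable_const)).and hc.not
    have hseat : Measurable fun ω => (dmcRestart T₁ t (S ω)).seat = none ∧ ¬ cl ω :=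
      (measurableSet_setOfPred.1 (measurableSet_eq_fun hS.seat measurable_const)).and hc.not
    have hsy := measurableSet_setOfPred.2 hS.synced.not
    unfold dmc
    by_cases hp : epochPos T₁ t < T₀
    · simp only [hp, if_true]
      refine ⟨?_, ?_, fun k => ?_, fun k => ?_, ?_⟩ <;> simp only [apply_ite DMCState.synced,
        apply_ite DMCState.colls, apply_ite DMCState.obs, apply_ite DMCState.sum,
        apply_ite DMCState.seat, ite_apply]
      · simpa using hS.synced
      · exact Measurable.ite hsy hS.colls (Measurable.ite (measurableSet_setOfPred.2 hc)
          ((measurable_from_nat (f := fun n => n + 1)).comp hS.colls) hS.colls)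
      · exact Measurable.ite hsy (hS.obs k) (Measurable.ite (measurableSet_setOfPred.2 (hak k))
          ((measurable_from_nat (f := fun n => n + 1)).comp (hS.obs k)) (hS.obs k))
      · exact Measurable.ite hsy (hS.sum k) (Measurable.ite (measurableSet_setOfPred.2 (hak k))
          ((hS.sum k).add hr) (hS.sum k))
      · simpa using hS.seat
    · simp only [hp, if_false]
      refine ⟨?_, ?_, fun k => ?_, fun k => ?_, ?_⟩ <;> simp only [apply_ite DMCState.synced,
        apply_ite DMCState.colls, apply_ite DMCState.obs, apply_ite DMCState.sum,
        apply_ite DMCState.seat]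
      · simpa using hS.synced
      · simpa using hS.colls
      · simpa using hS.obs k
      · simpa using hS.sum k
      · exact Measurable.ite hsy hS.seat (Measurable.ite (measurableSet_setOfPred.2 hseat) ha hS.seat)

end

end MultiBandit

namespace MultiBandit

noncomputable section

/-! ### The state of a MEGA player -/

section MegaStates

variable {K N : ℕ} {c d p₀ α β : ℝ} {active : Fin N → ℕ → Prop} {ω : Sample N K}

lemma states_eq_init {alg : Algorithm K} {j : Fin N} {t : ℕ} (h : ∀ s ≤ t, ¬ active j s) :
    states alg active ω t j = alg.init := by
  induction t with
  | zero => rfl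
  | succ t ih =>
    have h1 := h (t + 1) le_rfl
    simp only [states, h1, if_false]
    exact ih fun s hs => h s (by omega)

lemma played_succ (alg : Algorithm K) {j : Fin N} {t : ℕ} (h : active j (t + 1)) :
    played alg active ω (t + 1) j =
      alg.choose (t + 1) (fun i => ω.1 (j, t + 1, i)) (states alg active ω t j) := by
  simp [played, actions, h]

/-- The state of player `j` after `t` rounds of MEGA. -/
def megaState (c d p₀ α β : ℝ) (active : Fin N → ℕ → Prop) (ω : Sample N K) (t : ℕ) (j : Fin N) :
    MegaState K :=
  states (mega K c d p₀ α β) active ω t j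

open scoped Classical in
lemma mega_states_succ {j : Fin N} {t : ℕ} (h : active j (t + 1)) :
    megaState c d p₀ α β active ω (t + 1) j =
      let s := megaState c d p₀ α β active ω t j
      let a := played (mega K c d p₀ α β) active ω (t + 1)
      { clock := s.clock + 1
        last := a j
        collided := Collides a j
        p := if a j ≠ none ∧ a j = s.last then s.p * α + (1 - α) else p₀
        next := megaNext β (fun i => ω.1 (j, t + 1, i)) s
        obs := fun k => if a j = some k ∧ ¬ Collides a j then s.obs k + 1 else s.obs k
        sum := fun k => if a j = some k ∧ ¬ Collides a j then
          s.sum k + reward ω (t + 1) a j else s.sum k } := by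
  rw [megaState, states]
  simp only [h, if_true]
  rfl

lemma states_succ_of_not_active {alg : Algorithm K} {j : Fin N} {t : ℕ}
    (h : ¬ active j (t + 1)) :
    states alg active ω (t + 1) j = states alg active ω t j := by
  rw [states]
  simp only [h, if_false]

lemma mega_states_succ_of_not_active {j : Fin N} {t : ℕ} (h : ¬ active j (t + 1)) :
    megaState c d p₀ α β active ω (t + 1) j = megaState c d p₀ α β active ω t j :=
  states_succ_of_not_active h

open scoped Classical in
lemma mega_obs_eq (j : Fin N) (t : ℕ) (k : Fin K) :
    (megaState c d p₀ α β active ω t j).obs k = ∑ s ∈ Finset.Icc 1 t,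
      if played (mega K c d p₀ α β) active ω s j = some k ∧
        ¬ Collides (played (mega K c d p₀ α β) active ω s) j then 1 else 0 := by
  induction t with
  | zero => rfl
  | succ t ih =>
    rw [Finset.sum_Icc_succ_top (by omega), ← ih]
    by_cases h : active j (t + 1)
    · rw [mega_states_succ h]
      dsimp only
      split_ifs <;> rfl
    · rw [mega_states_succ_of_not_active h, if_neg, add_zero]
      rw [played_of_not_active h]
      simp

open scoped Classical in
lemma mega_sum_eq (j : Fin N) (t : ℕ) (k : Fin K) :
    (megaState c d p₀ α β active ω t j).sum k = ∑ s ∈ Finset.Icc 1 t,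
      if played (mega K c d p₀ α β) active ω s j = some k ∧
        ¬ Collides (played (mega K c d p₀ α β) active ω s) j then ω.2 (s, k) else 0 := by
  induction t with
  | zero => rfl
  | succ t ih =>
    rw [Finset.sum_Icc_succ_top (by omega), ← ih]
    by_cases h : active j (t + 1)
    · rw [mega_states_succ h]
      dsimp only
      split_ifs with hc
      · simp [reward, hc.1, hc.2]
      · rw [add_zero]
    · rw [mega_states_succ_of_not_active h, if_neg, add_zero]
      rw [played_of_not_active h]
      simp

lemma megaNext_of_not_collided {u : Coin → ℝ} {s : MegaState K} (h : ¬ s.collided) :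
    megaNext β u s = s.next := by
  ext k
  simp [megaNext, h]

lemma megaNext_of_persists {u : Coin → ℝ} {s : MegaState K} (h : u .persist < s.p) :
    megaNext β u s = s.next := by
  ext k
  simp [megaNext, h]

lemma megaNext_of_last_ne {u : Coin → ℝ} {s : MegaState K} {k : Fin K} (h : s.last ≠ some k) :
    megaNext β u s k = s.next k := by
  simp [megaNext, h]

lemma megaChoose_explore {u : Coin → ℝ} {s : MegaState K} (hc : ¬ s.collided)
    (hn : ∀ k, s.next k ≤ s.clock) (h : u .explore < megaEps K c d s.clock) :
    megaChoose c d β u s = pick Finset.univ (u .arm) := by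
  have : megaAvail β u s = Finset.univ := by
    ext k
    simp [megaAvail, megaNext_of_not_collided hc, hn]
  simp [megaChoose, megaPersists, hc, h, this]

/-- A strict maximizer makes the set of tied arms a singleton, so the tie-breaking coin is
irrelevant. -/
lemma megaChoose_greedy {u : Coin → ℝ} {s : MegaState K} {a : Fin K} (hc : ¬ s.collided)
    (hn : ∀ k, s.next k ≤ s.clock) (h : ¬ u .explore < megaEps K c d s.clock)
    (hu : u .arm ∈ Set.Ico (0 : ℝ) 1) (ha : ∀ k, k ≠ a → s.est k < s.est a) :
    megaChoose c d β u s = some a := by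
  have hA : megaAvail β u s = Finset.univ := by
    ext k
    simp [megaAvail, megaNext_of_not_collided hc, hn]
  simp only [megaChoose, megaPersists, hc, h, hA, if_false, false_and]
  rw [← pick_singleton (a := a) hu]
  congr 1
  ext k
  simp only [Finset.mem_filter, Finset.mem_univ, true_and, true_imp_iff, Finset.mem_singleton]
  constructor
  · intro h'
    by_contra hk
    exact absurd (h' a) (not_le.2 (ha k hk))
  · rintro rfl l
    by_cases hl : l = k
    · rw [hl]
    · exact (ha l hl).le

/-- Availability is needed for the better arm `b` only. This fits the second player, for whom `a₁`
may be blocked. -/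
lemma megaChoose_ne {u : Coin → ℝ} {s : MegaState K} {a b : Fin K} (hc : ¬ s.collided)
    (hn : s.next b ≤ s.clock) (h : ¬ u .explore < megaEps K c d s.clock)
    (hab : s.est a < s.est b) :
    megaChoose c d β u s ≠ some a := by
  intro hp
  simp only [megaChoose, megaPersists, hc, h, if_false, false_and] at hp
  have hm := (Finset.mem_filter.1 (pick_mem hp)).2 b
    (by simp [megaAvail, megaNext_of_not_collided hc, hn])
  exact absurd hm (not_le.2 hab)

end MegaStates

/-! ### A typical run of MEGA -/

section MegaRun

variable {K : ℕ}

open scoped Classical in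
/-- The arm chosen by the first player in round `t` according to her coins, if the arm `a` always
has the largest empirical mean. -/
def plannedArm (c d : ℝ) (a : Fin K) (x : Fin 2 × ℕ × Coin → ℝ) (t : ℕ) : Option (Fin K) :=
  if x (0, t, .explore) < megaEps K c d t then pick Finset.univ (x (0, t, .arm)) else some a

/-- The rounds up to `t` in which arm `k` is planned. -/
def plannedRounds (c d : ℝ) (a : Fin K) (x : Fin 2 × ℕ × Coin → ℝ) (t : ℕ) (k : Fin K) :
    Finset ℕ :=
  (Finset.Icc 1 t).filter fun s => plannedArm c d a x s = some k

/-- Conditions on the horizon `T`, the rounds `e` and `l` in which the second player enters and the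
first player leaves, and on the auxiliary times `n₀`, `n₁` and `h`. -/
structure RunTimes (T e l h n₀ n₁ : ℕ) (η Q : ℝ) : Prop where
  one_le : 1 ≤ n₀
  n₀_lt : n₀ < n₁
  n₁_lt : n₁ < e
  e_lt : e < h
  h_lt : h < l
  l_le : l ≤ T
  Q_pos : 0 < Q
  Q_le : Q ≤ η * ((e : ℝ) - n₁)
  Q_le' : Q ≤ (l : ℝ) - h

/-- The conditions on the coins of a typical run. -/
structure TypicalCoins (K T e l h n₀ n₁ : ℕ) (c d α : ℝ) (x : Fin 2 × ℕ × Coin → ℝ) : Prop where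
  mem : ∀ j t i, 1 ≤ t → t ≤ T → x (j, t, i) ∈ Set.Ico (0 : ℝ) 1
  explore_early : ∀ t, 1 ≤ t → t ≤ n₀ → x (0, t, .explore) < megaEps K c d t
  explore_late : ∀ t, n₁ ≤ t → t < l → megaEps K c d t ≤ x (0, t, .explore)
  persist : ∀ t, e ≤ t → t < l → x (0, t, .persist) < 1 - α ^ (e - n₁)
  explore_second : ∀ t, h ≤ t → t ≤ T → megaEps K c d (t - e + 1) ≤ x (1, t, .explore)

/-- The conditions on the rewards of a typical run. -/
structure TypicalTable (v : Fin K → ℝ) (a₁ a₂ : Fin K) (e l h n₀ : ℕ) (c d η Q : ℝ)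
    (x : Fin 2 × ℕ × Coin → ℝ) (r : ℕ × Fin K → ℝ) : Prop where
  mem : ∀ i, r i ∈ Set.Icc (0 : ℝ) 1
  dev : ∀ t, n₀ ≤ t → t < l → ∀ k, |∑ s ∈ plannedRounds c d a₁ x t k, (r (s, k) - v k)| ≤
    η * (plannedRounds c d a₁ x t k).card
  sum_second : Q ≤ ∑ s ∈ Finset.Ico e h, r (s, a₂)

variable {ν : Fin K → Measure ℝ} {a₁ a₂ : Fin K} {g c d p₀ α β Q : ℝ} {T e l h n₀ n₁ : ℕ}
  {active : Fin 2 → ℕ → Prop} {ω : Sample 2 K}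

lemma plannedArm_late (hc : TypicalCoins K T e l h n₀ n₁ c d α ω.1) {t : ℕ} (h1 : n₁ ≤ t)
    (h2 : t < l) : plannedArm c d a₁ ω.1 t = some a₁ := by
  rw [plannedArm, if_neg (not_lt.2 (hc.explore_late t h1 h2))]

open scoped Classical in
/-- The rounds in which both players are present and the regret is at least `g`. -/
def badRounds (alg : Algorithm K) (active : Fin 2 → ℕ → Prop) (ν : Fin K → Measure ℝ) (e l : ℕ)
    (g : ℝ) (ω : Sample 2 K) : Finset ℕ :=
  (Finset.Ico e l).filter fun t => g ≤ roundRegret alg active ν t ω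

/-- Collisions delete samples of `a₁` in a way that may depend on the rewards, so concentration
cannot be applied to the retained samples. Instead it is applied to all planned rounds, and the
deleted ones are shown to be a fraction of at most `g / 4`. The estimate of `a₁` then loses at most
`g / 2` and the others gain at most `g / 4`, less than the gap `g` in total. -/
lemma mega_est_lt (hK : 2 ≤ K) (hI : Instance ν a₁ a₂ 0) (hg : 0 < g)
    (hT : TopTwo (mean ν) a₁ a₂ g) (hR : RunTimes T e l h n₀ n₁ (g / 4) Q)
    (ha0 : ∀ t, active 0 t ↔ t < l) (ha1 : ∀ t, active 1 t ↔ e ≤ t)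
    (hc : TypicalCoins K T e l h n₀ n₁ c d α ω.1)
    (htab : TypicalTable (mean ν) a₁ a₂ e l h n₀ c d (g / 4) Q ω.1 ω.2)
    (hcount : ∀ k, (plannedRounds c d a₁ ω.1 n₀ k).Nonempty)
    (hbad : ((badRounds (mega K c d p₀ α β) active ν e l g ω).card : ℝ) < Q)
    {t : ℕ} (h1 : n₀ ≤ t) (h2 : t < l)
    (hp : ∀ s, 1 ≤ s → s ≤ t →
      played (mega K c d p₀ α β) active ω s 0 = plannedArm c d a₁ ω.1 s)
    {k : Fin K} (hk : k ≠ a₁) :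
    (megaState c d p₀ α β active ω t 0).est k <
      (megaState c d p₀ α β active ω t 0).est a₁ := by
  classical
  set alg := mega K c d p₀ α β with halg
  have hη : g ≤ 1 := hT.pos.trans (hT.le_one a₂)
  have hgap : mean ν k ≤ mean ν a₁ - g := by
    by_cases h2 : k = a₂
    · rw [h2]; linarith [hT.gap_one]
    · linarith [hT.gap_one, hT.gap_two k hk h2]
  have hμ1 : g ≤ mean ν a₁ := by linarith [hT.gap_one, hT.nonneg a₂]
  -- collisions happen only while both players are present
  have hcoll : ∀ s, Collides (played alg active ω s) 0 → e ≤ s := by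
    intro s hs
    by_contra hlt
    exact not_collides_of_not_active_one (by rw [ha1]; exact hlt) 0 hs
  have hcard : ∀ k, 0 < ((plannedRounds c d a₁ ω.1 t k).card : ℝ) := by
    intro k
    have : (plannedRounds c d a₁ ω.1 t k).Nonempty := by
      obtain ⟨s, hs⟩ := hcount k
      refine ⟨s, ?_⟩
      simp only [plannedRounds, Finset.mem_filter, Finset.mem_Icc] at hs ⊢
      exact ⟨⟨hs.1.1, hs.1.2.trans h1⟩, hs.2⟩
    exact_mod_cast this.card_pos
  have hdev := fun k => htab.dev t h1 h2 k
  simp only [Finset.sum_sub_distrib, Finset.sum_const, nsmul_eq_mul, abs_le] at hdev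
  -- the other arm
  have hok : ((megaState c d p₀ α β active ω t 0).obs k : ℝ) = (plannedRounds c d a₁ ω.1 t k).card := by
    rw [mega_obs_eq, plannedRounds, Finset.card_filter]
    congr 1
    refine Finset.sum_congr rfl fun s hs => if_congr ?_ rfl rfl
    rw [Finset.mem_Icc] at hs
    rw [← halg, hp s hs.1 hs.2, and_iff_left_iff_imp]
    intro hs1 hs2
    rw [plannedArm_late hc (hR.n₁_lt.le.trans (hcoll s hs2)) (by omega)] at hs1
    exact hk (Option.some.inj hs1).symm
  have hsk : (megaState c d p₀ α β active ω t 0).sum k =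
      ∑ s ∈ plannedRounds c d a₁ ω.1 t k, ω.2 (s, k) := by
    rw [mega_sum_eq, plannedRounds, Finset.sum_filter]
    refine Finset.sum_congr rfl fun s hs => if_congr ?_ rfl rfl
    rw [Finset.mem_Icc] at hs
    rw [← halg, hp s hs.1 hs.2, and_iff_left_iff_imp]
    intro hs1 hs2
    rw [plannedArm_late hc (hR.n₁_lt.le.trans (hcoll s hs2)) (by omega)] at hs1
    exact hk (Option.some.inj hs1).symm
  have hek : (megaState c d p₀ α β active ω t 0).est k ≤ mean ν k + g / 4 := by
    rw [MegaState.est, hok, hsk, div_le_iff₀ (hcard k)]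
    linarith [(hdev k).2]
  -- the best arm
  set I := plannedRounds c d a₁ ω.1 t a₁ with hIdef
  set D := I.filter fun s => Collides (played alg active ω s) 0 with hD
  have ho1 : ((megaState c d p₀ α β active ω t 0).obs a₁ : ℝ) = I.card - D.card := by
    have h3 : (megaState c d p₀ α β active ω t 0).obs a₁ =
        (I.filter fun s => ¬ Collides (played alg active ω s) 0).card := by
      rw [mega_obs_eq, hIdef, plannedRounds, Finset.filter_filter, Finset.card_filter]
      refine Finset.sum_congr rfl fun s hs => if_congr ?_ rfl rfl
      rw [Finset.mem_Icc] at hs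
      rw [← halg, hp s hs.1 hs.2]
    have h4 := Finset.card_filter_add_card_filter_not (s := I)
      (fun s => Collides (played alg active ω s) 0)
    rw [h3, ← h4]
    push_cast
    ring
  -- Each deleted reward is at most `1`.
  have hs1 : (∑ s ∈ I, ω.2 (s, a₁)) - D.card ≤ (megaState c d p₀ α β active ω t 0).sum a₁ := by
    have h3 : (megaState c d p₀ α β active ω t 0).sum a₁ =
        ∑ s ∈ I.filter fun s => ¬ Collides (played alg active ω s) 0, ω.2 (s, a₁) := by
      rw [mega_sum_eq, hIdef, plannedRounds, Finset.filter_filter, Finset.sum_filter]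
      refine Finset.sum_congr rfl fun s hs => if_congr ?_ rfl rfl
      rw [Finset.mem_Icc] at hs
      rw [← halg, hp s hs.1 hs.2]
    have h4 := Finset.sum_filter_add_sum_filter_not I
      (fun s => Collides (played alg active ω s) 0) (fun s => ω.2 (s, a₁))
    have h5 : ∑ s ∈ D, ω.2 (s, a₁) ≤ D.card := by
      have := Finset.sum_le_card_nsmul D (fun s => ω.2 (s, a₁)) 1
        (fun s _ => (htab.mem (s, a₁)).2)
      simpa using this
    linarith
  -- Every collision is a bad round, so there are fewer than `Q`. If there is one at all, then `t ≥
  -- e`, so `I` already contains the whole interval `[n₁, e)`, and `Q` was chosen below `g / 4` of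
  -- its length.
  have hDI : (D.card : ℝ) ≤ g / 4 * I.card := by
    rcases Finset.eq_empty_or_nonempty D with hD0 | ⟨s, hs⟩
    · rw [hD0]; simp; positivity
    · have hs' := Finset.mem_filter.1 hs
      have hsI := hs'.1
      simp only [hIdef, plannedRounds, Finset.mem_filter, Finset.mem_Icc] at hsI
      have hes := hcoll s hs'.2
      have hDb : (D.card : ℝ) ≤ (badRounds alg active ν e l g ω).card := by
        norm_cast
        refine Finset.card_le_card fun r hr => ?_
        have hr' := Finset.mem_filter.1 hr
        have hrI := hr'.1
        simp only [hIdef, plannedRounds, Finset.mem_filter, Finset.mem_Icc] at hrI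
        have her := hcoll r hr'.2
        rw [badRounds, Finset.mem_filter, Finset.mem_Ico]
        exact ⟨⟨her, by omega⟩, roundRegret_ge_of_collides hK hI hT ((ha0 r).2 (by omega))
          ((ha1 r).2 her) hr'.2⟩
      have hIc : (e : ℝ) - n₁ ≤ I.card := by
        have : Finset.Ico n₁ e ⊆ I := by
          intro r hr
          rw [Finset.mem_Ico] at hr
          simp only [hIdef, plannedRounds, Finset.mem_filter, Finset.mem_Icc]
          have := hR.n₀_lt
          exact ⟨⟨by omega, by omega⟩, plannedArm_late hc hr.1 (by omega)⟩
        have h6 := Finset.card_le_card this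
        rw [Nat.card_Ico] at h6
        have h7 : e ≤ I.card + n₁ := by omega
        have h8 : (e : ℝ) ≤ I.card + n₁ := by exact_mod_cast h7
        linarith
      have := hR.Q_le
      nlinarith
  have hobs : 0 < ((megaState c d p₀ α β active ω t 0).obs a₁ : ℝ) := by
    rw [ho1]
    nlinarith [hcard a₁]
  have he1 : mean ν a₁ - g / 2 ≤ (megaState c d p₀ α β active ω t 0).est a₁ := by
    rw [MegaState.est, le_div_iff₀ hobs, ho1]
    have h9 := (hdev a₁).1
    have hDn : (0 : ℝ) ≤ D.card := by positivity
    nlinarith [mul_nonneg hDn (by linarith : 0 ≤ mean ν a₁ - g / 2)]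
  linarith

/-- As long as there are few rounds of large regret, the first player follows her plan. -/
lemma mega_first_player (hK : 2 ≤ K) (hI : Instance ν a₁ a₂ 0) (hg : 0 < g)
    (hT : TopTwo (mean ν) a₁ a₂ g) (hR : RunTimes T e l h n₀ n₁ (g / 4) Q)
    (hα0 : 0 ≤ α) (hα1 : α ≤ 1) (hp0 : 0 ≤ p₀) (hp1 : p₀ ≤ 1)
    (ha0 : ∀ t, active 0 t ↔ t < l) (ha1 : ∀ t, active 1 t ↔ e ≤ t)
    (hc : TypicalCoins K T e l h n₀ n₁ c d α ω.1)
    (htab : TypicalTable (mean ν) a₁ a₂ e l h n₀ c d (g / 4) Q ω.1 ω.2)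
    (hcount : ∀ k, (plannedRounds c d a₁ ω.1 n₀ k).Nonempty)
    (hbad : ((badRounds (mega K c d p₀ α β) active ν e l g ω).card : ℝ) < Q)
    {t : ℕ} (ht : t < l) :
    let s := megaState c d p₀ α β active ω t 0
    s.clock = t + 1 ∧ (∀ k, s.next k = 1) ∧ s.p ∈ Set.Icc (0 : ℝ) 1 ∧
      (n₁ ≤ t → 1 - s.p ≤ α ^ (t - n₁)) ∧ (s.collided → e ≤ t) ∧
      (1 ≤ t → s.last = plannedArm c d a₁ ω.1 t) ∧
      ∀ r, 1 ≤ r → r ≤ t →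
        played (mega K c d p₀ α β) active ω r 0 = plannedArm c d a₁ ω.1 r := by
  classical
  induction t with
  | zero =>
    refine ⟨rfl, fun _ => rfl, ⟨hp0, hp1⟩, fun h => ?_, fun h => h.elim, fun h => by omega,
      fun r h1 h2 => by omega⟩
    have := hR.n₀_lt
    omega
  | succ t ih =>
    obtain ⟨hclock, hnext, hp, hpα, hcol, hlast, hplay⟩ := ih (by omega)
    have hact : active 0 (t + 1) := (ha0 _).2 ht
    set alg := mega K c d p₀ α β with halg
    set s := megaState c d p₀ α β active ω t 0 with hs
    have hR1 := hR.n₁_lt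
    have hR2 := hR.n₀_lt
    have hR3 := hR.one_le
    have hlT := hR.l_le
    -- After a collision `t ≥ e`, hence `1 - p ≤ α ^ (t - n₁) ≤ α ^ (e - n₁)`, and the typical
    -- persistence coins lie below `1 - α ^ (e - n₁)`.
    have hpers : s.collided → ω.1 (0, t + 1, .persist) < s.p := by
      intro hcc
      have het := hcol hcc
      have h1 := hc.persist (t + 1) (by omega) ht
      have h2 := hpα (by omega)
      have h3 : α ^ (t - n₁) ≤ α ^ (e - n₁) := pow_le_pow_of_le_one hα0 hα1 (by omega)
      linarith
    have hpl : played alg active ω (t + 1) 0 = plannedArm c d a₁ ω.1 (t + 1) := by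
      rw [played_succ alg hact]
      change megaChoose c d β (fun i => ω.1 (0, t + 1, i)) s = _
      by_cases hcc : s.collided
      · have het := hcol hcc
        rw [megaChoose, if_pos ⟨hcc, hpers hcc⟩, hlast (by omega),
          plannedArm_late hc (by omega) (by omega), plannedArm_late hc (by omega) (by omega)]
      · have hn : ∀ k, s.next k ≤ s.clock := fun k => by rw [hnext, hclock]; omega
        by_cases hx : ω.1 (0, t + 1, .explore) < megaEps K c d (t + 1)
        · rw [megaChoose_explore hcc hn (by rw [hclock]; exact hx), plannedArm, if_pos hx]
        · have hn0 : n₀ ≤ t := by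
            by_contra hlt
            exact hx (hc.explore_early (t + 1) (by omega) (by omega))
          rw [megaChoose_greedy (a := a₁) hcc hn (by rw [hclock]; exact hx)
            (hc.mem 0 (t + 1) .arm (by omega) (by omega)), plannedArm, if_neg hx]
          exact fun k hk => mega_est_lt hK hI hg hT hR ha0 ha1 hc htab hcount hbad hn0 (by omega)
            hplay hk
    have hnx : megaNext β (fun i => ω.1 (0, t + 1, i)) s = s.next := by
      by_cases hcc : s.collided
      · exact megaNext_of_persists (hpers hcc)
      · exact megaNext_of_not_collided hcc
    rw [mega_states_succ hact]
    refine ⟨by change s.clock + 1 = _; rw [hclock], ?_, ?_, ?_, ?_, fun _ => hpl, ?_⟩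
    · intro k
      change megaNext β (fun i => ω.1 (0, t + 1, i)) s k = 1
      rw [hnx, hnext]
    · dsimp only
      split_ifs
      · have hpα0 := mul_nonneg hp.1 hα0
        constructor
        · change 0 ≤ s.p * α + (1 - α); linarith
        · change s.p * α + (1 - α) ≤ 1; nlinarith [hp.2]
      · exact ⟨hp0, hp1⟩
    -- Repeating an arm replaces `1 - p` by `α (1 - p)`. At `n₁` itself the repetition may fail and
    -- only the trivial bound `1 - p ≤ 1` is claimed.
    · intro hn1
      by_cases hn : n₁ ≤ t
      · have h3 : played alg active ω (t + 1) 0 = some a₁ := by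
          rw [hpl, plannedArm_late hc hn1 ht]
        have h4 : s.last = some a₁ := by
          rw [hlast (by omega), plannedArm_late hc hn (by omega)]
        dsimp only
        rw [if_pos ⟨by rw [← halg, h3]; simp, by rw [← halg, h3]; exact h4.symm⟩]
        change 1 - (s.p * α + (1 - α)) ≤ _
        rw [show t + 1 - n₁ = (t - n₁) + 1 by omega, pow_succ]
        nlinarith [hpα hn]
      · have : t + 1 - n₁ = 0 := by omega
        rw [this, pow_zero]
        dsimp only
        split_ifs
        · change 1 - (s.p * α + (1 - α)) ≤ 1
          nlinarith [mul_nonneg hp.1 hα0]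
        · linarith
    · intro hcc
      change Collides (played alg active ω (t + 1)) 0 at hcc
      by_contra hlt
      exact not_collides_of_not_active_one (by rw [ha1]; exact hlt) 0 hcc
    · intro r h1 h2
      rcases Nat.lt_or_ge t r with h3 | h3
      · rw [show r = t + 1 by omega]; exact hpl
      · exact hplay r h1 h3

/-- In a typical run of MEGA the regret is large. -/
lemma mega_regret_ge (hK : 2 ≤ K) (hI : Instance ν a₁ a₂ 0) (hg : 0 < g)
    (hT : TopTwo (mean ν) a₁ a₂ g) (hR : RunTimes T e l h n₀ n₁ (g / 4) Q)
    (hα0 : 0 ≤ α) (hα1 : α ≤ 1) (hp0 : 0 ≤ p₀) (hp1 : p₀ ≤ 1)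
    (ha0 : ∀ t, active 0 t ↔ t < l) (ha1 : ∀ t, active 1 t ↔ e ≤ t)
    (hc : TypicalCoins K T e l h n₀ n₁ c d α ω.1)
    (htab : TypicalTable (mean ν) a₁ a₂ e l h n₀ c d (g / 4) Q ω.1 ω.2)
    (hcount : ∀ k, (plannedRounds c d a₁ ω.1 n₀ k).Nonempty) :
    g * min Q ((T : ℝ) - l) ≤ regret (mega K c d p₀ α β) active ν T ω := by
  classical
  set alg := mega K c d p₀ α β with halg
  have hnn : ∀ t, 0 ≤ roundRegret alg active ν t ω :=
    fun t => (roundRegret_mem hK le_rfl hI).1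
  have hRe := hR.e_lt
  have hRh := hR.h_lt
  have hRl := hR.l_le
  have hR1 := hR.n₁_lt
  have hR0 := hR.n₀_lt
  have hsub : ∀ S : Finset ℕ, S ⊆ Finset.Icc 1 T → (∀ t ∈ S, g ≤ roundRegret alg active ν t ω) →
      g * S.card ≤ regret alg active ν T ω := by
    intro S hS hSg
    rw [regret_eq_sum]
    refine le_trans ?_ (Finset.sum_le_sum_of_subset_of_nonneg hS fun t _ _ => hnn t)
    have := Finset.card_nsmul_le_sum S _ g hSg
    rwa [nsmul_eq_mul, mul_comm] at this
  -- If there are many bad rounds, they give the bound directly. Otherwise their scarcity is the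
  -- hypothesis that keeps the first player on her plan.
  by_cases hbad : Q ≤ (badRounds alg active ν e l g ω).card
  · refine le_trans (mul_le_mul_of_nonneg_left ((min_le_left _ _).trans hbad) hg.le)
      (hsub _ ?_ ?_)
    · intro t ht
      have := Finset.mem_Ico.1 (Finset.mem_filter.1 ht).1
      rw [Finset.mem_Icc]; omega
    · exact fun t ht => (Finset.mem_filter.1 ht).2
  rw [not_le] at hbad
  have hne : a₁ ≠ a₂ := by
    rintro rfl
    have := hI.gap_one
    simp at this
  have hfirst : ∀ s, e ≤ s → s < l → played alg active ω s 0 = some a₁ := by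
    intro s h1 h2
    have := (mega_first_player hK hI hg hT hR hα0 hα1 hp0 hp1 ha0 ha1 hc htab hcount hbad h2).2.2.2.2.2.2
    rw [this s (by omega) le_rfl, plannedArm_late hc (by omega) h2]
  -- while the first player is present, the second player collides exactly on the best arm
  have hcol1 : ∀ s, s < l → (Collides (played alg active ω s) 1 ↔
      played alg active ω s 1 = some a₁) := by
    intro s hs
    by_cases hes : e ≤ s
    · rw [collides_one, hfirst s hes hs]
      constructor
      · rintro ⟨_, h⟩; exact h.symm
      · intro h; rw [h]; simp
    · have hna : ¬ active 1 s := by rw [ha1]; exact hes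
      have := not_collides_of_not_active_one (alg := alg) (ω := ω) hna 1
      simp [this, played_of_not_active hna]
  have hobs : ∀ t, (∀ s, 1 ≤ s → s ≤ t → played alg active ω s 1 = some a₁ →
      Collides (played alg active ω s) 1) → (megaState c d p₀ α β active ω t 1).obs a₁ = 0 := by
    intro t ht
    rw [mega_obs_eq]
    refine Finset.sum_eq_zero fun s hs => if_neg fun hs' => hs'.2 ?_
    rw [Finset.mem_Icc] at hs
    exact ht s hs.1 hs.2 hs'.1
  have hmem : ∀ i, ω.2 i ∈ Set.Icc (0 : ℝ) 1 := htab.mem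
  -- During `[e, h)` the arm `a₂` pays at least `Q` in total. Each round in which the second player
  -- is elsewhere is bad and loses at most `1`; with fewer than `Q` such rounds something remains.
  have hsum : ∀ t, h ≤ t + 1 → 0 < (megaState c d p₀ α β active ω t 1).est a₂ := by
    intro t ht
    have hpos : 0 < (megaState c d p₀ α β active ω t 1).sum a₂ := by
      rw [mega_sum_eq]
      have h1 : ∑ s ∈ Finset.Ico e h, (ω.2 (s, a₂) -
          if played alg active ω s 1 = some a₂ then 0 else 1) ≤
          ∑ s ∈ Finset.Icc 1 t, if played alg active ω s 1 = some a₂ ∧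
            ¬ Collides (played alg active ω s) 1 then ω.2 (s, a₂) else 0 := by
        have hss : Finset.Ico e h ⊆ Finset.Icc 1 t := by
          intro s hs
          rw [Finset.mem_Ico] at hs
          rw [Finset.mem_Icc]; omega
        refine le_trans (Finset.sum_le_sum fun s hs => ?_)
          (Finset.sum_le_sum_of_subset_of_nonneg hss fun s _ _ => ?_)
        · rw [Finset.mem_Ico] at hs
          by_cases hs1 : played alg active ω s 1 = some a₂
          · have : ¬ Collides (played alg active ω s) 1 := by
              rw [hcol1 s (by omega), hs1]
              simpa using hne.symm
            simp [hs1, this]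
          · simp [hs1, (hmem (s, a₂)).2]
        · split_ifs
          · exact (hmem _).1
          · exact le_rfl
      refine lt_of_lt_of_le ?_ h1
      rw [Finset.sum_sub_distrib]
      have h2 : ∑ s ∈ Finset.Ico e h, (if played alg active ω s 1 = some a₂ then (0 : ℝ) else 1) ≤
          (badRounds alg active ν e l g ω).card := by
        have : ∀ s, (if played alg active ω s 1 = some a₂ then (0 : ℝ) else 1) =
            if ¬ played alg active ω s 1 = some a₂ then 1 else 0 := by
          intro s; split_ifs <;> rfl
        simp only [this]
        rw [Finset.sum_boole]
        norm_cast
        refine Finset.card_le_card fun s hs => ?_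
        rw [Finset.mem_filter, Finset.mem_Ico] at hs
        rw [badRounds, Finset.mem_filter, Finset.mem_Ico]
        have hsl : s < l := by omega
        exact ⟨⟨hs.1.1, hsl⟩, roundRegret_ge_of_ne hK hI hg.le hT ((ha0 s).2 hsl)
          ((ha1 s).2 hs.1.1) (hfirst s hs.1.1 hsl) hs.2⟩
      linarith [htab.sum_second]
    -- This excludes an empty sample, for which the quotient would be the default `0`.
    have hle : (megaState c d p₀ α β active ω t 1).sum a₂ ≤ (megaState c d p₀ α β active ω t 1).obs a₂ := by
      rw [mega_sum_eq, mega_obs_eq]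
      push_cast
      refine Finset.sum_le_sum fun s _ => ?_
      split_ifs
      · exact (hmem _).2
      · exact le_rfl
    exact div_pos hpos (hpos.trans_le hle)
  have hest0 : ∀ t, (megaState c d p₀ α β active ω t 1).obs a₁ = 0 → (megaState c d p₀ α β active ω t 1).est a₁ = 0 := by
    intro t ht
    rw [MegaState.est, ht]
    simp
  -- the second player up to the departure of the first one
  have hsecond : ∀ t, e ≤ t + 1 → t < l →
      (megaState c d p₀ α β active ω t 1).clock + e = t + 2 ∧
      (∀ k, k ≠ a₁ → (megaState c d p₀ α β active ω t 1).next k = 1) ∧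
      ((megaState c d p₀ α β active ω t 1).collided → (megaState c d p₀ α β active ω t 1).last = some a₁) := by
    intro t
    induction t with
    | zero => omega
    | succ t ih =>
      intro h1 h2
      rcases Nat.lt_or_ge (t + 1) e with h3 | h3
      · have : megaState c d p₀ α β active ω (t + 1) 1 = (mega K c d p₀ α β).init :=
          states_eq_init fun s hs => by rw [ha1]; omega
        rw [this]
        refine ⟨?_, fun _ _ => rfl, fun h => h.elim⟩
        change 1 + e = _
        omega
      · obtain ⟨hcl, hnx, hla⟩ := ih (by omega) (by omega)
        have hact : active 1 (t + 1) := (ha1 _).2 h3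
        rw [mega_states_succ hact]
        refine ⟨?_, ?_, ?_⟩
        · change (megaState c d p₀ α β active ω t 1).clock + 1 + e = _
          omega
        · intro k hk
          refine Eq.trans ?_ (hnx k hk)
          change megaNext β (fun i => ω.1 (1, t + 1, i)) (megaState c d p₀ α β active ω t 1) k = _
          by_cases hcc : (megaState c d p₀ α β active ω t 1).collided
          · refine megaNext_of_last_ne ?_
            rw [hla hcc]
            simpa using hk.symm
          · exact congrFun (megaNext_of_not_collided hcc) k
        · intro hcc
          exact (hcol1 (t + 1) h2).1 hcc
  -- a round without collision
  obtain ⟨s₀, hs₀h, hs₀l, hs₀⟩ : ∃ s₀, h ≤ s₀ ∧ s₀ < l ∧ ¬ Collides (played alg active ω s₀) 0 := by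
    -- Otherwise all `l - h ≥ Q` rounds of `[h, l)` would be bad.
    by_contra! hall
    have : Finset.Ico h l ⊆ badRounds alg active ν e l g ω := by
      intro s hs
      rw [Finset.mem_Ico] at hs
      rw [badRounds, Finset.mem_filter, Finset.mem_Ico]
      exact ⟨⟨by omega, hs.2⟩, roundRegret_ge_of_collides hK hI hT ((ha0 s).2 hs.2)
        ((ha1 s).2 (by omega)) (hall s hs.1 hs.2)⟩
    have h1 := Finset.card_le_card this
    rw [Nat.card_Ico] at h1
    have h2 : (l : ℝ) ≤ (badRounds alg active ν e l g ω).card + h := by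
      exact_mod_cast (by omega : l ≤ (badRounds alg active ν e l g ω).card + h)
    linarith [hR.Q_le']
  -- Avoiding `a₁` perpetuates itself. Without a collision the second player cannot persist, so she
  -- plays greedily with `a₂` available and better than the default estimate of `a₁`. Before `l`
  -- avoiding `a₁` means no collision; from `l` on she is alone.
  have hafter : ∀ t, s₀ ≤ t → t ≤ T →
      (megaState c d p₀ α β active ω t 1).clock + e = t + 2 ∧
      (megaState c d p₀ α β active ω t 1).next a₂ = 1 ∧ ¬ (megaState c d p₀ α β active ω t 1).collided ∧
      ∀ s, s₀ < s → s ≤ t → played alg active ω s 1 ≠ some a₁ := by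
    intro t ht
    induction t, ht using Nat.le_induction with
    | base =>
      intro hT'
      obtain ⟨hcl, hnx, hla⟩ := hsecond s₀ (by omega) hs₀l
      refine ⟨hcl, hnx a₂ hne.symm, ?_, fun s h1 h2 => by omega⟩
      obtain ⟨r, rfl⟩ : ∃ r, s₀ = r + 1 := ⟨s₀ - 1, by omega⟩
      have hact : active 1 (r + 1) := (ha1 _).2 (by omega)
      rw [mega_states_succ hact]
      exact fun hcc => hs₀ (collides_comm.2 hcc)
    | succ t ht ih =>
      intro hT'
      obtain ⟨hcl, hnx, hco, hpl⟩ := ih (by omega)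
      have hact : active 1 (t + 1) := (ha1 _).2 (by omega)
      have hob : (megaState c d p₀ α β active ω t 1).obs a₁ = 0 := by
        refine hobs t fun s h1 h2 h3 => ?_
        rcases Nat.lt_or_ge s₀ s with h4 | h4
        · exact absurd h3 (hpl s h4 h2)
        · exact (hcol1 s (by omega)).2 h3
      have hnew : played alg active ω (t + 1) 1 ≠ some a₁ := by
        rw [played_succ alg hact]
        change megaChoose c d β (fun i => ω.1 (1, t + 1, i))
          (megaState c d p₀ α β active ω t 1) ≠ some a₁
        refine megaChoose_ne (b := a₂) hco (by rw [hnx]; omega) ?_ ?_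
        -- Her local clock shows `1` in the round `e` of her entrance, hence `t + 1 - e + 1` in
        -- round `t + 1`.
        · have h1 := hc.explore_second (t + 1) (by omega) hT'
          rw [show (megaState c d p₀ α β active ω t 1).clock = t + 1 - e + 1 by omega]
          exact not_lt.2 h1
        · rw [hest0 t hob]
          exact hsum t (by omega)
      have hnc : ¬ Collides (played alg active ω (t + 1)) 1 := by
        rcases Nat.lt_or_ge (t + 1) l with h1 | h1
        · rw [hcol1 _ h1]; exact hnew
        · exact not_collides_of_not_active_zero (by rw [ha0]; omega) 1
      refine ⟨?_, ?_, ?_, ?_⟩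
      · rw [mega_states_succ hact]
        change (megaState c d p₀ α β active ω t 1).clock + 1 + e = _
        omega
      · rw [mega_states_succ hact]
        refine Eq.trans ?_ hnx
        change megaNext β (fun i => ω.1 (1, t + 1, i)) (megaState c d p₀ α β active ω t 1) a₂ = _
        exact congrFun (megaNext_of_not_collided hco) a₂
      · rw [mega_states_succ hact]
        exact hnc
      · intro s h1 h2
        rcases Nat.lt_or_ge t s with h3 | h3
        · rw [show s = t + 1 by omega]; exact hnew
        · exact hpl s h1 h3
  refine le_trans (mul_le_mul_of_nonneg_left (min_le_right _ _) hg.le)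
    (le_trans ?_ (hsub (Finset.Icc l T) ?_ ?_))
  · refine mul_le_mul_of_nonneg_left ?_ hg.le
    rw [Nat.card_Icc, Nat.cast_sub (by omega)]
    push_cast
    linarith
  · exact Finset.Icc_subset_Icc (by omega) le_rfl
  · intro t ht
    rw [Finset.mem_Icc] at ht
    exact roundRegret_ge_of_one_ne hK hI hg.le hT (by rw [ha0]; omega) ((ha1 t).2 (by omega))
      ((hafter T (by omega) le_rfl).2.2.2 t (by omega) ht.2)

end MegaRun

end

end MultiBandit

namespace MultiBandit

noncomputable section

/-! ### Coins -/

instance instDecidableEqCoin : DecidableEq Coin := fun a b => by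
  cases a <;> cases b <;> first | exact isTrue rfl | exact isFalse (by simp)

instance instFintypeCoin : Fintype Coin where
  elems := {Coin.persist, Coin.block, Coin.explore, Coin.arm}
  complete i := by cases i <;> simp

lemma card_coin : Fintype.card Coin = 4 := rfl

lemma unif_Ico {a b : ℝ} (ha : 0 ≤ a) (hb : b ≤ 1) :
    unif (Set.Ico a b) = ENNReal.ofReal (b - a) := by
  rw [unif, Measure.restrict_apply measurableSet_Ico, Set.inter_eq_left.2, Real.volume_Ico]
  exact Set.Ico_subset_Ico ha hb

instance instIsProbabilityMeasureUnif : IsProbabilityMeasure unif where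
  measure_univ := by simp [unif]

lemma ae_unif : ∀ᵐ u ∂unif, u ∈ Set.Ico (0 : ℝ) 1 := ae_restrict_mem measurableSet_Ico

lemma pick_univ_of_mem {K : ℕ} (k : Fin K) {u : ℝ}
    (hu : u ∈ Set.Ico ((k : ℝ) / K) (((k : ℝ) + 1) / K)) : pick Finset.univ u = some k := by
  have hK : (0 : ℝ) < K := by exact_mod_cast k.pos
  rw [pick_univ_eq]
  have h1 := hu.1
  have h2 := hu.2
  rw [div_le_iff₀ hK] at h1
  rw [lt_div_iff₀ hK] at h2
  rw [Nat.floor_eq_iff (le_trans (by positivity) h1)]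
  exact ⟨h1, h2⟩

lemma law_isProbabilityMeasure {N K : ℕ} {ν : Fin K → Measure ℝ}
    (h : ∀ k, IsProbabilityMeasure (ν k)) : IsProbabilityMeasure (law N ν) := by
  have : ∀ i : ℕ × Fin K, IsProbabilityMeasure (ν i.2) := fun i => h i.2
  unfold law
  infer_instance

/-! ### Deviations of the rewards -/

section Deviation

variable {K : ℕ} {ν : Fin K → Measure ℝ}

lemma ae_table_mem [∀ k, IsProbabilityMeasure (ν k)]
    (hs : ∀ k, ∀ᵐ x ∂(ν k), x ∈ Set.Icc (0 : ℝ) 1) :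
    ∀ᵐ r ∂(Measure.infinitePi fun i : ℕ × Fin K => ν i.2), ∀ i, r i ∈ Set.Icc (0 : ℝ) 1 := by
  rw [ae_all_iff]
  intro i
  exact (measurePreserving_eval_infinitePi (fun i : ℕ × Fin K => ν i.2) i).quasiMeasurePreserving.ae
    (hs i.2)

lemma exp_hoeffding_aux (n : ℕ) (η : ℝ) :
    Real.exp (-(η * n) ^ 2 / (2 * ((n : NNReal) * ((‖(1 : ℝ) - 0‖₊ / 2) ^ 2) : NNReal))) =
      Real.exp (-2 * η ^ 2 * n) := by
  congr 1
  rcases Nat.eq_zero_or_pos n with rfl | hn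
  · simp
  · have : (0 : ℝ) < n := by exact_mod_cast hn
    push_cast
    simp only [sub_zero, norm_one]
    field_simp

/-- Two-sided Hoeffding inequality for independent variables with values in `[0, 1]`. -/
lemma hoeffding_two_sided {Ω : Type*} [MeasurableSpace Ω] {P : Measure Ω} [IsProbabilityMeasure P]
    {ι : Type*} {X : ι → Ω → ℝ} (hX : iIndepFun X P) (hm : ∀ i, Measurable (X i))
    (hb : ∀ i, ∀ᵐ ω ∂P, X i ω ∈ Set.Icc (0 : ℝ) 1) {m : ℝ} (s : Finset ι)
    (hmean : ∀ i ∈ s, ∫ ω, X i ω ∂P = m)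
    {η : ℝ} (hη : 0 ≤ η) :
    P {ω | η * s.card ≤ |∑ i ∈ s, (X i ω - m)|} ≤
      ENNReal.ofReal (2 * Real.exp (-2 * η ^ 2 * s.card)) := by
  have hsub : ∀ i ∈ s, HasSubgaussianMGF (fun ω => X i ω - m) ((‖(1 : ℝ) - 0‖₊ / 2) ^ 2) P := by
    intro i hi
    have := hasSubgaussianMGF_of_mem_Icc (hm i).aemeasurable (hb i)
    rwa [hmean i hi] at this
  have hind : iIndepFun (fun i ω => X i ω - m) P :=
    hX.comp (fun _ x => x - m) (fun _ => measurable_id.sub_const m)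
  have hnn : 0 ≤ η * s.card := by positivity
  have h1 := HasSubgaussianMGF.measure_sum_ge_le_of_iIndepFun hind hsub hnn
  have hind' : iIndepFun (fun i ω => -(X i ω - m)) P :=
    hX.comp (fun _ x => -(x - m)) (fun _ => (measurable_id.sub_const m).neg)
  have h2 := HasSubgaussianMGF.measure_sum_ge_le_of_iIndepFun hind' (s := s)
    (fun i hi => (hsub i hi).neg) hnn
  simp only [Finset.sum_const, nsmul_eq_mul] at h1 h2
  rw [exp_hoeffding_aux] at h1 h2
  have hsubset : {ω | η * s.card ≤ |∑ i ∈ s, (X i ω - m)|} ⊆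
      {ω | η * s.card ≤ ∑ i ∈ s, (X i ω - m)} ∪ {ω | η * s.card ≤ ∑ i ∈ s, -(X i ω - m)} := by
    intro ω hω
    rcases le_abs.1 (show η * s.card ≤ |∑ i ∈ s, (X i ω - m)| from hω) with h | h
    · exact Or.inl h
    · right
      change η * s.card ≤ ∑ i ∈ s, -(X i ω - m)
      rwa [Finset.sum_neg_distrib]
  calc P _ ≤ P {ω | η * s.card ≤ ∑ i ∈ s, (X i ω - m)} +
        P {ω | η * s.card ≤ ∑ i ∈ s, -(X i ω - m)} :=
        (measure_mono hsubset).trans (measure_union_le _ _)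
    _ ≤ ENNReal.ofReal (Real.exp (-2 * η ^ 2 * s.card)) +
        ENNReal.ofReal (Real.exp (-2 * η ^ 2 * s.card)) := by
        refine add_le_add ?_ ?_
        · rw [← ofReal_measureReal]; exact ENNReal.ofReal_le_ofReal h1
        · rw [← ofReal_measureReal]; exact ENNReal.ofReal_le_ofReal h2
    _ = _ := by
        rw [← ENNReal.ofReal_add (Real.exp_pos _).le (Real.exp_pos _).le, two_mul]

/-- Hoeffding on a deterministic set of rounds. It is applied after the coins have been fixed, so
`I` may be any set determined by them. -/
lemma table_deviation [∀ k, IsProbabilityMeasure (ν k)]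
    (hs : ∀ k, ∀ᵐ x ∂(ν k), x ∈ Set.Icc (0 : ℝ) 1) (k : Fin K) (I : Finset ℕ)
    {η : ℝ} (hη : 0 ≤ η) :
    (Measure.infinitePi fun i : ℕ × Fin K => ν i.2)
      {r | η * I.card ≤ |∑ s ∈ I, (r (s, k) - mean ν k)|} ≤
      ENNReal.ofReal (2 * Real.exp (-2 * η ^ 2 * I.card)) := by
  have hind : iIndepFun (fun (s : ℕ) (r : ℕ × Fin K → ℝ) => r (s, k))
      (Measure.infinitePi fun i : ℕ × Fin K => ν i.2) :=
    (iIndepFun_infinitePi (P := fun i : ℕ × Fin K => ν i.2) (X := fun _ x => x)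
      (fun _ => measurable_id)).precomp (g := fun s : ℕ => (s, k))
      (fun a b hab => (Prod.mk.inj hab).1)
  refine hoeffding_two_sided hind (fun s => measurable_pi_apply _) (fun s => ?_) I
    (fun s _ => ?_) hη
  · exact (ae_table_mem hs).mono fun r hr => hr _
  · have := (measurePreserving_eval_infinitePi (fun i : ℕ × Fin K => ν i.2) (s, k)).map_eq
    have h2 := integral_map (μ := Measure.infinitePi fun i : ℕ × Fin K => ν i.2)
      (φ := Function.eval (s, k)) (measurable_pi_apply _).aemeasurable
      (f := fun x : ℝ => x) (by fun_prop)
    rw [this] at h2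
    exact h2.symm

/-- A union bound over times would diverge when `J` grows slowly. Since `J` is increasing, `J t` is
determined by its cardinality among its values, so it suffices to sum over the cardinalities from
`M` on. This gives a geometric series, independent of the horizon. -/
lemma table_deviation_uniform [∀ k, IsProbabilityMeasure (ν k)]
    (hs : ∀ k, ∀ᵐ x ∂(ν k), x ∈ Set.Icc (0 : ℝ) 1) (k : Fin K) {J : ℕ → Finset ℕ}
    (hJ : Monotone J) {n₀ M : ℕ} (hM : M ≤ (J n₀).card) {η : ℝ} (hη : 0 < η) :
    (Measure.infinitePi fun i : ℕ × Fin K => ν i.2)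
      {r | ∃ t, n₀ ≤ t ∧ η * (J t).card ≤ |∑ s ∈ J t, (r (s, k) - mean ν k)|} ≤
      ENNReal.ofReal (2 * Real.exp (-2 * η ^ 2) ^ M * (1 - Real.exp (-2 * η ^ 2))⁻¹) := by
  set q := Real.exp (-2 * η ^ 2) with hq
  have hq0 : 0 < q := Real.exp_pos _
  have hq1 : q < 1 := by rw [hq, Real.exp_lt_one_iff]; nlinarith [sq_pos_of_pos hη]
  set R := Measure.infinitePi fun i : ℕ × Fin K => ν i.2 with hR
  set S : ℕ → Set (ℕ × Fin K → ℝ) := fun n => {r | ∃ t, n₀ ≤ t ∧ (J t).card = M + n ∧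
    η * (J t).card ≤ |∑ s ∈ J t, (r (s, k) - mean ν k)|} with hS
  have hpow : ∀ n : ℕ, Real.exp (-2 * η ^ 2 * n) = q ^ n := by
    intro n; rw [hq, ← Real.exp_nat_mul]; ring_nf
  have hSn : ∀ n, R (S n) ≤ ENNReal.ofReal (2 * q ^ M * q ^ n) := by
    intro n
    by_cases hn : ∃ t, n₀ ≤ t ∧ (J t).card = M + n
    · obtain ⟨t, ht, htc⟩ := hn
      have hsub : S n ⊆ {r | η * (J t).card ≤ |∑ s ∈ J t, (r (s, k) - mean ν k)|} := by
        rintro r ⟨t', ht', htc', hr⟩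
        have : J t' = J t := by
          rcases le_total t t' with h | h
          · exact (Finset.eq_of_subset_of_card_le (hJ h) (by omega)).symm
          · exact Finset.eq_of_subset_of_card_le (hJ h) (by omega)
        rw [this] at hr
        exact hr
      refine (measure_mono hsub).trans ((table_deviation hs k (J t) hη.le).trans (le_of_eq ?_))
      rw [hpow, htc, pow_add, mul_assoc]
    · have : S n = ∅ := by
        ext r
        simp only [Set.mem_empty_iff_false, iff_false]
        rintro ⟨t, h1, h2, _⟩
        exact hn ⟨t, h1, h2⟩
      rw [this, measure_empty]
      exact zero_le
  have hcov : {r : ℕ × Fin K → ℝ | ∃ t, n₀ ≤ t ∧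
      η * (J t).card ≤ |∑ s ∈ J t, (r (s, k) - mean ν k)|} ⊆ ⋃ n, S n := by
    rintro r ⟨t, ht, hr⟩
    have h1 := Finset.card_le_card (hJ ht)
    exact Set.mem_iUnion.2 ⟨(J t).card - M, t, ht, by omega, hr⟩
  have hsum : Summable fun n => 2 * q ^ M * q ^ n :=
    (summable_geometric_of_lt_one hq0.le hq1).mul_left _
  calc R _ ≤ ∑' n, R (S n) := (measure_mono hcov).trans (measure_iUnion_le _)
    _ ≤ ∑' n, ENNReal.ofReal (2 * q ^ M * q ^ n) := ENNReal.tsum_le_tsum hSn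
    _ = ENNReal.ofReal (∑' n, 2 * q ^ M * q ^ n) :=
        (ENNReal.ofReal_tsum_of_nonneg (fun n => by positivity) hsum).symm
    _ = _ := by rw [tsum_mul_left, tsum_geometric_of_lt_one hq0.le hq1]

lemma exists_small_geometric {η : ℝ} (hη : 0 < η) {b : ℝ} (hb : 0 < b) :
    ∃ M : ℕ, 1 ≤ M ∧ 2 * Real.exp (-2 * η ^ 2) ^ M * (1 - Real.exp (-2 * η ^ 2))⁻¹ ≤ b := by
  set q := Real.exp (-2 * η ^ 2) with hq
  have hq0 : 0 < q := Real.exp_pos _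
  have hq1 : q < 1 := by rw [hq, Real.exp_lt_one_iff]; nlinarith [sq_pos_of_pos hη]
  have h1 : Filter.Tendsto (fun M : ℕ => 2 * q ^ M * (1 - q)⁻¹) Filter.atTop (nhds 0) := by
    have := ((tendsto_pow_atTop_nhds_zero_of_lt_one hq0.le hq1).const_mul 2).mul_const (1 - q)⁻¹
    simpa using this
  obtain ⟨M, hM1, hM2⟩ := ((Filter.eventually_ge_atTop 1).and
    (h1.eventually (ge_mem_nhds hb))).exists
  exact ⟨M, hM1, hM2⟩

end Deviation

end

end MultiBandit

namespace MultiBandit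

noncomputable section

/-! ### The probability of a typical run of MEGA -/

section Box

variable {K : ℕ}

/-- Constraints on the single coins that make a run typical; those on the coins `arm` fix the
arms that the first player explores in the first rounds. -/
def coinBox (K : ℕ) (c d ρ : ℝ) (e h n₀ n₁ : ℕ) (i : Fin 2 × ℕ × Coin) : Set ℝ :=
  if i.1 = 0 then
    match i.2.2 with
    | .explore => if i.2.1 ≤ n₀ then Set.Ico 0 (megaEps K c d i.2.1) else
        if n₁ ≤ i.2.1 then Set.Ico (megaEps K c d i.2.1) 1 else Set.Ico 0 1
    | .arm => if i.2.1 ≤ n₀ then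
        Set.Ico ((((i.2.1 - 1) % K : ℕ) : ℝ) / K) (((((i.2.1 - 1) % K : ℕ) : ℝ) + 1) / K)
        else Set.Ico 0 1
    | .persist => if e ≤ i.2.1 then Set.Ico 0 ρ else Set.Ico 0 1
    | .block => Set.Ico 0 1
  else
    match i.2.2 with
    | .explore => if h ≤ i.2.1 then Set.Ico (megaEps K c d (i.2.1 - e + 1)) 1 else Set.Ico 0 1
    | _ => Set.Ico 0 1

/-- The coins of the first `T` rounds. -/
def coinIndices (T : ℕ) : Finset (Fin 2 × ℕ × Coin) :=
  Finset.univ ×ˢ (Finset.Icc 1 T ×ˢ Finset.univ)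

lemma mem_coinIndices {T : ℕ} {j : Fin 2} {t : ℕ} {i : Coin} :
    (j, t, i) ∈ coinIndices T ↔ 1 ≤ t ∧ t ≤ T := by
  simp [coinIndices]

lemma megaEps_eq (K : ℕ) (c d : ℝ) (t : ℕ) :
    megaEps K c d t = min 1 (c * (K : ℝ) ^ 2 / (d ^ 2 * ((K : ℝ) - 1)) / t) := by
  rw [megaEps, div_div]

lemma megaEps_mem (hK : 2 ≤ K) {c : ℝ} (hc : 0 < c) (d : ℝ) (t : ℕ) :
    megaEps K c d t ∈ Set.Icc (0 : ℝ) 1 := by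
  have hK' : (2 : ℝ) ≤ K := by exact_mod_cast hK
  have : 0 ≤ (K : ℝ) - 1 := by linarith
  exact ⟨le_min zero_le_one (by positivity), min_le_left _ _⟩

variable {c d ρ : ℝ} {T e l h n₀ n₁ : ℕ} {x : Fin 2 × ℕ × Coin → ℝ}

lemma coinBox_subset (hK : 2 ≤ K) (hc : 0 < c) (hρ : ρ ≤ 1) (i : Fin 2 × ℕ × Coin) :
    coinBox K c d ρ e h n₀ n₁ i ⊆ Set.Ico 0 1 := by
  obtain ⟨j, t, i⟩ := i
  have hE := fun s => megaEps_mem hK hc d s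
  have hK0 : (0 : ℝ) < K := by
    have : 0 < K := by omega
    exact_mod_cast this
  have hmod : ((((t - 1) % K : ℕ) : ℝ) + 1) / K ≤ 1 := by
    rw [div_le_one hK0]
    exact_mod_cast Nat.mod_lt _ (by omega)
  by_cases hj : j = 0 <;> cases i <;> simp only [coinBox, hj, if_true, if_false] <;>
    (try split_ifs) <;> first
    | exact subset_rfl
    | exact Set.Ico_subset_Ico le_rfl (hE _).2
    | exact Set.Ico_subset_Ico (hE _).1 le_rfl
    | exact Set.Ico_subset_Ico (by positivity) hmod
    | exact Set.Ico_subset_Ico le_rfl hρ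

lemma measurableSet_coinBox (i : Fin 2 × ℕ × Coin) :
    MeasurableSet (coinBox K c d ρ e h n₀ n₁ i) := by
  obtain ⟨j, t, i⟩ := i
  by_cases hj : j = 0 <;> cases i <;> simp only [coinBox, hj, if_true, if_false] <;>
    (try split_ifs) <;> exact measurableSet_Ico

/-- A box of separate constraints suffices for a typical run, so its probability is a product. -/
lemma typicalCoins_of_mem {α : ℝ} (hK : 2 ≤ K) (hc : 0 < c) (hρ : ρ ≤ 1)
    (hα : ρ = 1 - α ^ (e - n₁)) (h1 : n₀ < n₁) (h2 : n₁ < e) (h3 : e < h) (h4 : h < l)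
    (h5 : l ≤ T)
    (hx : x ∈ Set.pi (coinIndices T : Set _) (coinBox K c d ρ e h n₀ n₁)) :
    TypicalCoins K T e l h n₀ n₁ c d α x := by
  have hmem : ∀ j t i, 1 ≤ t → t ≤ T → x (j, t, i) ∈ coinBox K c d ρ e h n₀ n₁ (j, t, i) :=
    fun j t i ht ht' => hx _ (mem_coinIndices.2 ⟨ht, ht'⟩)
  refine ⟨fun j t i ht ht' => coinBox_subset hK hc hρ _ (hmem j t i ht ht'), ?_, ?_, ?_, ?_⟩
  · intro t ht ht'
    have := hmem 0 t .explore ht (by omega)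
    simp only [coinBox, if_true, ht'] at this
    exact this.2
  · intro t ht ht'
    have := hmem 0 t .explore (by omega) (by omega)
    simp only [coinBox, if_true, show ¬ t ≤ n₀ by omega, if_false, ht] at this
    exact this.1
  · intro t ht ht'
    have := hmem 0 t .persist (by omega) (by omega)
    simp only [coinBox, if_true, ht] at this
    exact hα ▸ this.2
  · intro t ht ht'
    have := hmem 1 t .explore (by omega) (by omega)
    simp only [coinBox, if_true, ht, one_ne_zero, if_false] at this
    exact this.1

/-- The box forces round-robin exploration: arm `k` is planned in the rounds `K * m + k + 1` with `m
< M`. -/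
lemma le_card_plannedRounds (hK : 2 ≤ K) {M : ℕ} (hn : n₀ = K * M) (hT : n₀ ≤ T) (a : Fin K)
    (hx : x ∈ Set.pi (coinIndices T : Set _) (coinBox K c d ρ e h n₀ n₁)) (k : Fin K) :
    M ≤ (plannedRounds c d a x n₀ k).card := by
  have hsub : (Finset.range M).image (fun m => K * m + k.val + 1) ⊆
      plannedRounds c d a x n₀ k := by
    intro t ht
    obtain ⟨m, hm, rfl⟩ := Finset.mem_image.1 ht
    rw [Finset.mem_range] at hm
    have hk := k.2
    have hle : K * m + k.val + 1 ≤ n₀ := by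
      rw [hn]
      calc K * m + k.val + 1 ≤ K * m + K := by omega
        _ = K * (m + 1) := by ring
        _ ≤ K * M := Nat.mul_le_mul_left _ hm
    have h1 := hx (0, K * m + k.val + 1, .explore) (mem_coinIndices.2 ⟨by omega, by omega⟩)
    have h2 := hx (0, K * m + k.val + 1, .arm) (mem_coinIndices.2 ⟨by omega, by omega⟩)
    simp only [coinBox, if_true, hle] at h1 h2
    rw [show K * m + k.val + 1 - 1 = k.val + K * m by omega, Nat.add_mul_mod_self_left,
      Nat.mod_eq_of_lt hk] at h2
    rw [plannedRounds, Finset.mem_filter, Finset.mem_Icc, plannedArm, if_pos h1.2]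
    exact ⟨⟨by omega, hle⟩, pick_univ_of_mem k h2⟩
  have hcard : ((Finset.range M).image (fun m => K * m + k.val + 1)).card = M := by
    rw [Finset.card_image_of_injective, Finset.card_range]
    intro m m' hmm
    simp only at hmm
    exact Nat.eq_of_mul_eq_mul_left (by omega : 0 < K) (by omega)
  exact hcard ▸ Finset.card_le_card hsub

lemma exp_neg_two_mul_le {y : ℝ} (h0 : 0 ≤ y) (h1 : y ≤ 1 / 2) : Real.exp (-(2 * y)) ≤ 1 - y := by
  rw [Real.exp_neg]
  refine inv_le_of_inv_le₀ (by linarith) ?_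
  refine le_trans ?_ (Real.add_one_le_exp (2 * y))
  rw [inv_le_iff_one_le_mul₀ (by linarith)]
  nlinarith

/-- One bound for all coins keeps the product simple. Each constraint either removes at most mass
`y`, leaving `1 - y ≥ exp (-2y)`, or is one of the exploration constraints of the first `n₀` rounds,
of probability at least `ε₀`. -/
lemma unif_coinBox_ge (hK : 2 ≤ K) (hc : 0 < c)
    (h1 : n₀ < n₁) (h2 : n₁ < e) (h3 : e < h) {ε₀ y : ℝ} (hy0 : 0 ≤ y)
    (hy1 : y ≤ 1 / 2) (hε : ε₀ ≤ 1 / K)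
    (hearly : ∀ t, 1 ≤ t → t ≤ n₀ → ε₀ ≤ megaEps K c d t)
    (hlate : ∀ t, n₁ ≤ t → megaEps K c d t ≤ y)
    (hsecond : ∀ t, h ≤ t → megaEps K c d (t - e + 1) ≤ y) (hρ : 1 - y ≤ ρ) (hρ1 : ρ ≤ 1)
    (j : Fin 2) {t : ℕ} (ht : 1 ≤ t) (i : Coin) :
    ENNReal.ofReal ((if t ≤ n₀ then ε₀ else 1) * Real.exp (-(2 * y))) ≤
      unif (coinBox K c d ρ e h n₀ n₁ (j, t, i)) := by
  have hK' : (2 : ℝ) ≤ K := by exact_mod_cast hK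
  have hε1 : ε₀ ≤ 1 := hε.trans (by rw [div_le_one (by linarith)]; linarith)
  have hexp := exp_neg_two_mul_le hy0 hy1
  have hexp0 := (Real.exp_pos (-(2 * y))).le
  have hE := fun s => megaEps_mem hK hc d s
  set D := Real.exp (-(2 * y)) with hD
  have hD1 : D ≤ 1 := by linarith
  have hmulle : ∀ z : ℝ, 0 ≤ z → ε₀ ≤ z → ε₀ * D ≤ z := by
    intro z hz0 hz
    calc ε₀ * D ≤ z * D := mul_le_mul_of_nonneg_right hz hexp0
      _ ≤ z := mul_le_of_le_one_right hz0 hD1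
  have hone : ENNReal.ofReal ((if t ≤ n₀ then ε₀ else 1) * D) ≤ unif (Set.Ico 0 1) := by
    rw [unif_Ico le_rfl le_rfl]
    refine ENNReal.ofReal_le_ofReal ?_
    split_ifs
    · simpa using hmulle 1 zero_le_one hε1
    · linarith
  by_cases hj : j = 0 <;> cases i <;> simp only [coinBox, hj, if_true, if_false] <;>
    (try exact hone)
  · split_ifs with he hn
    · omega
    · simpa [*] using hone
    · rw [unif_Ico le_rfl hρ1]
      exact ENNReal.ofReal_le_ofReal (by linarith)
    · simpa [*] using hone
  · split_ifs with hn hn1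
    · rw [unif_Ico le_rfl (hE _).2, sub_zero]
      exact ENNReal.ofReal_le_ofReal (hmulle _ (hE _).1 (hearly t ht hn))
    · rw [unif_Ico (hE _).1 le_rfl]
      exact ENNReal.ofReal_le_ofReal (by linarith [hlate t hn1])
    · simpa [*] using hone
  · split_ifs with hn
    · rw [unif_Ico (by positivity)]
      · refine ENNReal.ofReal_le_ofReal ?_
        rw [← sub_div, add_sub_cancel_left]
        exact hmulle _ (by positivity) hε
      · rw [div_le_one (by linarith)]
        exact_mod_cast Nat.mod_lt _ (by omega)
    · simpa [*] using hone
  · split_ifs with hn hh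
    · omega
    · simpa [*] using hone
    · rw [unif_Ico (hE _).1 le_rfl]
      exact ENNReal.ofReal_le_ofReal (by linarith [hsecond t (by assumption)])
    · simpa [*] using hone

/-- The exponent `8` counts two players with four coins each per round. -/
lemma prod_coinIndices (w : ℕ → ℝ) :
    ∏ i ∈ coinIndices T, w i.2.1 = (∏ t ∈ Finset.Icc 1 T, w t) ^ 8 := by
  rw [coinIndices, Finset.prod_product]
  simp only [Finset.prod_product, Finset.prod_const, Finset.card_univ, Fintype.card_fin,
    card_coin, Finset.prod_pow]
  rw [← pow_mul]

lemma coinBox_prob_ge {ε₀ y : ℝ} (hε0 : 0 ≤ ε₀) (hn : n₀ ≤ T)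
    (hB : ∀ j t i, 1 ≤ t →
      ENNReal.ofReal ((if t ≤ n₀ then ε₀ else 1) * Real.exp (-(2 * y))) ≤
        unif (coinBox K c d ρ e h n₀ n₁ (j, t, i))) :
    ENNReal.ofReal (ε₀ ^ (8 * n₀) * Real.exp (-(16 * (T * y)))) ≤
      (Measure.infinitePi fun _ : Fin 2 × ℕ × Coin => unif)
        (Set.pi (coinIndices T : Set _) (coinBox K c d ρ e h n₀ n₁)) := by
  rw [Measure.infinitePi_pi (fun _ : Fin 2 × ℕ × Coin => unif)
    (fun i _ => measurableSet_coinBox i)]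
  have hnn : ∀ t : ℕ, 0 ≤ (if t ≤ n₀ then ε₀ else 1) := fun t => by split_ifs <;> simp [hε0]
  calc ENNReal.ofReal (ε₀ ^ (8 * n₀) * Real.exp (-(16 * (T * y))))
      = ENNReal.ofReal (∏ i ∈ coinIndices T,
          ((if i.2.1 ≤ n₀ then ε₀ else 1) * Real.exp (-(2 * y)))) := by
        congr 1
        have h1 : ∏ t ∈ Finset.Icc 1 T, (if t ≤ n₀ then ε₀ else 1) = ε₀ ^ n₀ := by
          rw [Finset.prod_ite, Finset.prod_const_one, mul_one, Finset.prod_const]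
          congr 1
          have : (Finset.Icc 1 T).filter (fun t => t ≤ n₀) = Finset.Icc 1 n₀ := by
            ext t
            simp only [Finset.mem_filter, Finset.mem_Icc]
            omega
          rw [this, Nat.card_Icc]
          omega
        rw [prod_coinIndices (fun t => (if t ≤ n₀ then ε₀ else 1) * Real.exp (-(2 * y))),
          Finset.prod_mul_distrib, Finset.prod_const, h1, mul_pow, ← pow_mul, ← pow_mul,
          ← Real.exp_nat_mul, Nat.card_Icc]
        congr 2
        · ring
        · push_cast [Nat.add_sub_cancel]
          ring
    _ = ∏ i ∈ coinIndices T, ENNReal.ofReal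
          ((if i.2.1 ≤ n₀ then ε₀ else 1) * Real.exp (-(2 * y))) :=
        ENNReal.ofReal_prod_of_nonneg fun i _ => mul_nonneg (hnn _) (Real.exp_pos _).le
    _ ≤ _ := Finset.prod_le_prod' fun i hi => by
        obtain ⟨j, t, i⟩ := i
        exact hB j t i (mem_coinIndices.1 hi).1

end Box

/-! ### Probability of a typical reward table, and combination with the coins -/

section Assembly

variable {K : ℕ} {ν : Fin K → Measure ℝ} {a₁ a₂ : Fin K}

lemma plannedRounds_mono (c d : ℝ) (a : Fin K) (x : Fin 2 × ℕ × Coin → ℝ) (k : Fin K) :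
    Monotone fun t => plannedRounds c d a x t k := by
  intro t t' h
  exact Finset.filter_subset_filter _ (Finset.Icc_subset_Icc le_rfl h)

/-- The coins `x` are fixed, hence so are the planned rounds. The deviations of the `K` arms fail
with probability at most `1/(4K)` each and the rewards of `a₂` on `[e, h)` with at most `1/4`, which
sums to `1/2`. Only an inclusion into a measurable `S` is asked for, which avoids proving that
typical tables form a measurable set. -/
lemma typicalTable_prob [∀ k, IsProbabilityMeasure (ν k)]
    (hs : ∀ k, ∀ᵐ x ∂(ν k), x ∈ Set.Icc (0 : ℝ) 1) {e l h n₀ M : ℕ} {c d η η' Q : ℝ}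
    (hη : 0 < η) (hη' : 0 < η') {x : Fin 2 × ℕ × Coin → ℝ}
    (hM : ∀ k, M ≤ (plannedRounds c d a₁ x n₀ k).card)
    (hb1 : 2 * Real.exp (-2 * η ^ 2) ^ M * (1 - Real.exp (-2 * η ^ 2))⁻¹ ≤ 1 / (4 * K))
    (hb2 : 2 * Real.exp (-2 * η' ^ 2 * ((h - e : ℕ) : ℝ)) ≤ 1 / 4)
    (hQ : Q ≤ (mean ν a₂ - η') * ((h - e : ℕ) : ℝ)) {S : Set (ℕ × Fin K → ℝ)}
    (hS : MeasurableSet S)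
    (hsub : ∀ r, TypicalTable (mean ν) a₁ a₂ e l h n₀ c d η Q x r → r ∈ S) :
    ENNReal.ofReal (1 / 2) ≤ (Measure.infinitePi fun i : ℕ × Fin K => ν i.2) S := by
  set R := Measure.infinitePi fun i : ℕ × Fin K => ν i.2 with hR
  have hK : (0 : ℝ) < K := by exact_mod_cast a₁.pos
  let B : Fin K → Set (ℕ × Fin K → ℝ) := fun k => {r | ∃ t, n₀ ≤ t ∧
    η * (plannedRounds c d a₁ x t k).card ≤
      |∑ s ∈ plannedRounds c d a₁ x t k, (r (s, k) - mean ν k)|}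
  let D : Set (ℕ × Fin K → ℝ) := {r | η' * (Finset.Ico e h).card ≤
      |∑ s ∈ Finset.Ico e h, (r (s, a₂) - mean ν a₂)|}
  let Z : Set (ℕ × Fin K → ℝ) := {r | ¬ ∀ i, r i ∈ Set.Icc (0 : ℝ) 1}
  have hcompl : Sᶜ ⊆ (⋃ k, B k) ∪ D ∪ Z := by
    intro r hr
    by_contra hc
    simp only [Set.mem_union, not_or, Set.mem_iUnion, not_exists] at hc
    refine hr (hsub r ⟨not_not.1 hc.2, fun t h1 h2 k => ?_, ?_⟩)
    · by_contra hlt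
      exact hc.1.1 k ⟨t, h1, (not_le.1 hlt).le⟩
    · have h3 : |∑ s ∈ Finset.Ico e h, (r (s, a₂) - mean ν a₂)| < η' * (Finset.Ico e h).card :=
        not_le.1 fun h => hc.1.2 h
      have h4 := (abs_lt.1 h3).1
      rw [Finset.sum_sub_distrib, Finset.sum_const, nsmul_eq_mul, Nat.card_Ico] at h4
      linarith
  have hBk : ∀ k, R (B k) ≤ ENNReal.ofReal (1 / (4 * K)) := fun k =>
    (table_deviation_uniform hs k (plannedRounds_mono c d a₁ x k) (hM k) hη).trans
      (ENNReal.ofReal_le_ofReal hb1)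
  have hD : R D ≤ ENNReal.ofReal (1 / 4) := by
    refine (table_deviation hs a₂ (Finset.Ico e h) hη'.le).trans (ENNReal.ofReal_le_ofReal ?_)
    rwa [Nat.card_Ico]
  have hZ : R Z = 0 := ae_table_mem hs
  have h1 : R Sᶜ ≤ ENNReal.ofReal (1 / 2) := by
    calc R Sᶜ ≤ R (⋃ k, B k) + R D + R Z :=
          (measure_mono hcompl).trans ((measure_union_le _ _).trans
            (add_le_add (measure_union_le _ _) le_rfl))
      _ ≤ ∑ k : Fin K, ENNReal.ofReal (1 / (4 * K)) + ENNReal.ofReal (1 / 4) + 0 := by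
          refine add_le_add (add_le_add ?_ hD) hZ.le
          exact (measure_iUnion_fintype_le _ _).trans (Finset.sum_le_sum fun k _ => hBk k)
      _ = ENNReal.ofReal (1 / 2) := by
          rw [← ENNReal.ofReal_sum_of_nonneg (fun _ _ => by positivity), add_zero,
            ← ENNReal.ofReal_add (by positivity) (by positivity)]
          congr 1
          simp only [Finset.sum_const, Finset.card_univ, Fintype.card_fin, nsmul_eq_mul]
          field_simp
          norm_num
  have h2 := prob_add_prob_compl (μ := R) hS
  have h3 : R S = 1 - R Sᶜ := by
    rw [← h2, ENNReal.add_sub_cancel_right (measure_ne_top _ _)]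
  rw [h3, ← ENNReal.ofReal_one]
  refine le_trans (le_of_eq ?_) (tsub_le_tsub_left h1 _)
  rw [← ENNReal.ofReal_sub _ (by norm_num)]
  norm_num

/-- A lower bound for the probability of an event that is likely given coins in a box. -/
lemma law_ge_of_sections [∀ k, IsProbabilityMeasure (ν k)] {N : ℕ} {A : Set (Sample N K)}
    (hA : MeasurableSet A) {B : Set (Fin N × ℕ × Coin → ℝ)} (hB : MeasurableSet B) {p q : ENNReal}
    (hp : p ≤ (Measure.infinitePi fun _ : Fin N × ℕ × Coin => unif) B)
    (hq : ∀ x ∈ B, q ≤ (Measure.infinitePi fun i : ℕ × Fin K => ν i.2) (Prod.mk x ⁻¹' A)) :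
    q * p ≤ law N ν A := by
  rw [law, Measure.prod_apply hA]
  calc q * p ≤ q * (Measure.infinitePi fun _ : Fin N × ℕ × Coin => unif) B :=
        mul_le_mul_right hp q
    _ = ∫⁻ _ in B, q ∂(Measure.infinitePi fun _ : Fin N × ℕ × Coin => unif) := by
        rw [setLIntegral_const]
    _ ≤ ∫⁻ x in B, (Measure.infinitePi fun i : ℕ × Fin K => ν i.2) (Prod.mk x ⁻¹' A)
          ∂(Measure.infinitePi fun _ : Fin N × ℕ × Coin => unif) :=
        setLIntegral_mono' hB hq
    _ ≤ _ := setLIntegral_le_lintegral _ _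

lemma integrable_regret {alg : Algorithm K} {Q : (Sample 2 K → alg.State) → Prop}
    (hM : MeasurableStates alg 2 Q) (active : Fin 2 → ℕ → Prop) (hK : 2 ≤ K)
    {g : ℝ} (hg : 0 ≤ g) (hI : Instance ν a₁ a₂ g) (T : ℕ) (P : Measure (Sample 2 K))
    [IsFiniteMeasure P] : Integrable (regret alg active ν T) P := by
  refine Integrable.of_mem_Icc 0 (T * 2) (hM.regret active ν T).aemeasurable
    (Filter.Eventually.of_forall fun ω => ?_)
  rw [regret_eq_sum]
  have h := fun t => roundRegret_mem (alg := alg) (active := active) (t := t) (ω := ω) hK hg hI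
  constructor
  · exact Finset.sum_nonneg fun t _ => (h t).1
  · have := Finset.sum_le_card_nsmul (Finset.Icc 1 T) _ 2 (fun t _ => (h t).2)
    simpa using this

end Assembly

end

end MultiBandit

/-! ### Choice of the parameters and the linear lower bound for MEGA -/

namespace MultiBandit

noncomputable section

/-- By `1 - z ≤ exp (-z)`, a quarter of the horizon is enough to compensate the factor `4` in the
assumption on `α`. -/
lemma pow_le_inv_of_le {α L T : ℝ} {n : ℕ} (hα : 0 ≤ α) (hT : 0 < T) (hL : 0 ≤ L)
    (hn : T / 4 ≤ n) (h : α ≤ 1 - 4 * L / T) : α ^ n ≤ Real.exp (-L) := by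
  have h1 : α ≤ Real.exp (-(4 * L / T)) := by
    have := Real.add_one_le_exp (-(4 * L / T))
    linarith
  calc α ^ n ≤ Real.exp (-(4 * L / T)) ^ n := pow_le_pow_left₀ hα h1 n
    _ = Real.exp (-(4 * L / T * n)) := by rw [← Real.exp_nat_mul]; ring_nf
    _ ≤ Real.exp (-L) := by
        rw [Real.exp_le_exp, neg_le_neg_iff]
        have : 4 * L / T * (T / 4) = L := by field_simp
        calc L = 4 * L / T * (T / 4) := this.symm
          _ ≤ 4 * L / T * n := mul_le_mul_of_nonneg_left hn (by positivity)

lemma scenario_zero (T : ℕ) (f : ℝ) (t : ℕ) :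
    scenario T f 0 t ↔ t < ⌈(T : ℝ) / 2 + f * T⌉₊ := by
  simp [scenario]

lemma scenario_one (T : ℕ) (f : ℝ) (t : ℕ) :
    scenario T f 1 t ↔ ⌈(T : ℝ) / 2⌉₊ ≤ t := by
  simp [scenario]

/-- All the intervals involved have length proportional to `T` or `f * T`; the thresholds `16`
absorb the rounding of the four ceilings. The first player has at least `T / 4` rounds on the best
arm before the second enters. -/
lemma runTimes_scenario {T n₀ : ℕ} {f g : ℝ} (hf0 : 0 < f) (hf1 : f < 1 / 2) (hg : 0 < g)
    (hg1 : g ≤ 1) (hn : 1 ≤ n₀) (hT1 : 8 * (n₀ : ℝ) < T) (hT2 : (16 : ℝ) ≤ T)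
    (hT3 : 16 ≤ f * T) :
    RunTimes T ⌈(T : ℝ) / 2⌉₊ ⌈(T : ℝ) / 2 + f * T⌉₊ (⌈(T : ℝ) / 2⌉₊ + ⌈f * T / 4⌉₊) n₀
      ⌈(T : ℝ) / 8⌉₊ (g / 4) (g * f / 16 * T) ∧
    (T : ℝ) / 4 ≤ (⌈(T : ℝ) / 2⌉₊ - ⌈(T : ℝ) / 8⌉₊ : ℕ) := by
  have he1 : (T : ℝ) / 2 ≤ ⌈(T : ℝ) / 2⌉₊ := Nat.le_ceil _
  have he2 : (⌈(T : ℝ) / 2⌉₊ : ℝ) < T / 2 + 1 := Nat.ceil_lt_add_one (by positivity)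
  have hl1 : (T : ℝ) / 2 + f * T ≤ ⌈(T : ℝ) / 2 + f * T⌉₊ := Nat.le_ceil _
  have hw2 : (⌈f * T / 4⌉₊ : ℝ) < f * T / 4 + 1 := Nat.ceil_lt_add_one (by positivity)
  have hn1 : (T : ℝ) / 8 ≤ ⌈(T : ℝ) / 8⌉₊ := Nat.le_ceil _
  have hn2 : (⌈(T : ℝ) / 8⌉₊ : ℝ) < T / 8 + 1 := Nat.ceil_lt_add_one (by positivity)
  have hlT : ⌈(T : ℝ) / 2 + f * T⌉₊ ≤ T := Nat.ceil_le.2 (by nlinarith)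
  have hw0 : 0 < ⌈f * T / 4⌉₊ := Nat.ceil_pos.2 (by linarith)
  generalize ⌈(T : ℝ) / 2⌉₊ = e at *
  generalize ⌈(T : ℝ) / 2 + f * T⌉₊ = l at *
  generalize ⌈f * T / 4⌉₊ = w at *
  generalize ⌈(T : ℝ) / 8⌉₊ = n₁ at *
  have hn01 : n₀ < n₁ := by
    have : (n₀ : ℝ) < n₁ := by linarith
    exact_mod_cast this
  have hn1e : n₁ < e := by
    have : (n₁ : ℝ) < e := by linarith
    exact_mod_cast this
  have hhl : e + w < l := by
    have : ((e + w : ℕ) : ℝ) < l := by push_cast; linarith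
    exact_mod_cast this
  have hfT : 0 ≤ f * T := by linarith
  have hgT : 0 ≤ g * T := by positivity
  have h1 : (T : ℝ) / 4 ≤ e - n₁ := by linarith
  refine ⟨⟨hn, hn01, hn1e, by omega, hhl, hlT, by positivity, ?_, ?_⟩, ?_⟩
  · have h2 : g / 4 * (T / 4) ≤ g / 4 * ((e : ℝ) - n₁) :=
      mul_le_mul_of_nonneg_left h1 (by positivity)
    have h3 : g * T * f ≤ g * T * 1 := mul_le_mul_of_nonneg_left (by linarith) hgT
    linarith
  · push_cast
    have h3 : f * T * g ≤ f * T * 1 := mul_le_mul_of_nonneg_left hg1 hfT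
    linarith
  · rw [Nat.cast_sub hn1e.le]
    exact h1

/-- The probability that the coins are in the box is bounded below. -/
lemma coinBox_scenario_prob {K : ℕ} (hK : 2 ≤ K) {c d : ℝ} (hc : 0 < c) {κ f b ε₀ ρ : ℝ}
    (hf0 : 0 < f) (hκ0 : 0 < κ) (hκ : ∀ t, megaEps K c d t = min 1 (κ / t)) {n₀ T e n₁ w : ℕ}
    (h8 : 8 * κ ≤ b) (h4 : 4 * κ / f ≤ b) (hT0 : (0 : ℝ) < T) (hT : 2 * b ≤ T)
    (hn₀ : 1 ≤ n₀) (hε₀ : ε₀ = min 1 (κ / n₀) / K) (hn01 : n₀ < n₁) (hn1e : n₁ < e)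
    (hn0T : n₀ ≤ T) (hn1 : (T : ℝ) / 8 ≤ n₁) (hw1 : f * T / 4 ≤ w) (hρ : 1 - b / T ≤ ρ)
    (hρ1 : ρ ≤ 1) :
    ENNReal.ofReal (ε₀ ^ (8 * n₀) * Real.exp (-(16 * b))) ≤
      (Measure.infinitePi fun _ : Fin 2 × ℕ × Coin => unif)
        (Set.pi (coinIndices T : Set _) (coinBox K c d ρ e (e + w) n₀ n₁)) := by
  have hK' : (2 : ℝ) ≤ K := by exact_mod_cast hK
  have hn₀R : (0 : ℝ) < n₀ := by exact_mod_cast hn₀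
  have hb0 : 0 < b := by linarith
  have hTy : (T : ℝ) * (b / T) = b := by field_simp
  have hw0 : 0 < w := by
    have : (0 : ℝ) < w := lt_of_lt_of_le (by positivity) hw1
    exact_mod_cast this
  have hbound : ∀ s : ℝ, 0 < s → κ * T ≤ b * s → κ / s ≤ b / T := by
    intro s hs h
    rw [div_le_div_iff₀ hs hT0]
    exact h
  have hε₀0 : 0 ≤ ε₀ := by rw [hε₀]; positivity
  have hy0 : 0 ≤ b / T := by positivity
  have hy1 : b / T ≤ 1 / 2 := by rw [div_le_iff₀ hT0]; linarith
  have key := coinBox_prob_ge (K := K) (c := c) (d := d) (ρ := ρ) (T := T)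
    (e := e) (h := e + w) (n₀ := n₀) (n₁ := n₁) (y := b / T) hε₀0 hn0T fun j t i ht => by
      refine unif_coinBox_ge hK hc hn01 hn1e (by omega) hy0 hy1 ?_ ?_ ?_ ?_ hρ hρ1 j ht i
      · rw [hε₀]
        exact div_le_div_of_nonneg_right (min_le_left _ _) (by positivity)
      · intro t ht1 ht2
        have ht1' : (0 : ℝ) < t := by exact_mod_cast ht1
        have ht2' : (t : ℝ) ≤ n₀ := by exact_mod_cast ht2
        rw [hκ, hε₀]
        calc min 1 (κ / n₀) / K ≤ min 1 (κ / n₀) :=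
              div_le_self (by positivity) (by linarith)
          _ ≤ min 1 (κ / t) := min_le_min_left _ (by gcongr)
      · intro t ht1
        have ht1' : (n₁ : ℝ) ≤ t := by exact_mod_cast ht1
        rw [hκ]
        refine (min_le_right _ _).trans (hbound _ (by linarith) ?_)
        have h1 : 8 * κ * (T / 8) ≤ 8 * κ * t :=
          mul_le_mul_of_nonneg_left (by linarith) (by positivity)
        have h2 : 8 * κ * t ≤ b * t := mul_le_mul_of_nonneg_right h8 (by linarith)
        linarith
      · intro t ht1
        have h0 : w ≤ t - e + 1 := by omega
        have h1 : (w : ℝ) ≤ (t - e + 1 : ℕ) := by exact_mod_cast h0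
        have h1' : f * T / 4 ≤ (t - e + 1 : ℕ) := hw1.trans h1
        have h3 : 0 < f * T / 4 := by positivity
        rw [hκ]
        refine (min_le_right _ _).trans (hbound _ (by linarith) ?_)
        have h2 : 4 * κ / f * (f * T / 4) ≤ 4 * κ / f * (t - e + 1 : ℕ) :=
          mul_le_mul_of_nonneg_left h1' (by positivity)
        have h5 : 4 * κ / f * (t - e + 1 : ℕ) ≤ b * (t - e + 1 : ℕ) :=
          mul_le_mul_of_nonneg_right h4 (by linarith)
        have h6 : 4 * κ / f * (f * T / 4) = κ * T := by field_simp
        linarith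
  rwa [hTy] at key

/-- MEGA has linear expected regret in the two-player scenario. -/
theorem mega_linear_regret {K : ℕ} (hK : 2 ≤ K) {ν : Fin K → Measure ℝ} {a₁ a₂ : Fin K}
    (hI : Instance ν a₁ a₂ 0) {f : ℝ} (hf0 : 0 < f) (hf1 : f < 1 / 2) {c d : ℝ} (hc : 0 < c)
    (hd : 0 < d) :
    ∃ C : ℝ, 0 < C ∧ ∃ T' : ℕ, ∀ T : ℕ, T' ≤ T → ∀ β p₀ α : ℝ, 0 ≤ p₀ → p₀ ≤ 1 → 0 ≤ α →
      α ≤ 1 - 4 * Real.log (4 * f * T) / T →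
      C * T ≤ ∫ ω, regret (mega K c d p₀ α β) (scenario T f) ν T ω ∂(law 2 ν) := by
  have hprob := hI.prob
  have hlawp : IsProbabilityMeasure (law 2 ν) := law_isProbabilityMeasure hprob
  obtain ⟨g, hg, hT⟩ := hI.exists_topTwo
  have hK' : (2 : ℝ) ≤ K := by exact_mod_cast hK
  have hμ2 : g ≤ mean ν a₂ := hT.pos
  have hμ2' : mean ν a₂ ≤ 1 := hT.le_one a₂
  have hg1 : g ≤ 1 := hμ2.trans hμ2'
  set κ := c * (K : ℝ) ^ 2 / (d ^ 2 * ((K : ℝ) - 1)) with hκ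
  have hκ0 : 0 < κ := by
    have : 0 < (K : ℝ) - 1 := by linarith
    positivity
  have heps : ∀ t, megaEps K c d t = min 1 (κ / t) := megaEps_eq K c d
  obtain ⟨M, hM1, hM⟩ := exists_small_geometric (show 0 < g / 4 by linarith)
    (show (0 : ℝ) < 1 / (4 * K) by positivity)
  set n₀ := K * M with hn₀
  have hn₀1 : 1 ≤ n₀ := Nat.one_le_iff_ne_zero.2 (by positivity)
  have hn₀R : (1 : ℝ) ≤ n₀ := by exact_mod_cast hn₀1
  -- Small enough both for an early exploration coin, of probability at least `min 1 (κ / n₀)`, and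
  -- for an arm coin, of probability `1 / K`.
  set ε₀ := min 1 (κ / n₀) / K with hε₀
  have hε₀0 : 0 < ε₀ := by positivity
  -- Each late constraint fails with probability at most `b / T`. The summands come from the first
  -- player's exploration after time `T / 8`, the second player's exploration after local time `f *
  -- T / 4`, and the failure `1 / (4 * f * T)` of persistence.
  set b := 8 * κ + 4 * κ / f + 1 / (4 * f) with hb
  have hb1 : 0 < 4 * κ / f := by positivity
  have hb2 : 0 < 1 / (4 * f) := by positivity
  have hb0 : 0 < b := by positivity
  set η' := mean ν a₂ / 2 with hη'
  have hη'0 : 0 < η' := by linarith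
  have hf2 : 0 < 1 / 2 - f := by linarith
  set p₁ := ε₀ ^ (8 * n₀) * Real.exp (-(16 * b)) with hp₁
  have hp₁0 : 0 < p₁ := by positivity
  set θ := g * f / 16 with hθ
  have hθ0 : 0 < θ := by positivity
  have hlog8 : 0 ≤ Real.log 8 := Real.log_nonneg (by norm_num)
  -- `p₁ / 2` bounds the probability of the event. `θ * T` is the threshold `Q` of bad rounds and
  -- `(1 / 2 - f) * T / 2` bounds the time left after the departure. In the threshold for `T`, the
  -- term `2 * b` gives `b / T ≤ 1 / 2` and the one with `log 8` makes Hoeffding on `a₂` fail with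
  -- probability at most `1 / 4`.
  refine ⟨g * min θ ((1 / 2 - f) / 2) * (p₁ / 2), by positivity,
    ⌈8 * (n₀ : ℝ) + 16 + 16 / f + 2 * b + 2 / (1 / 2 - f) + 2 * Real.log 8 / (η' ^ 2 * f)⌉₊,
    fun T hTT β p₀ α hp0 hp1 hα0 hα => ?_⟩
  have hTR := Nat.ceil_le.1 hTT
  set t₁ := 16 / f with ht₁
  set t₂ := 2 / (1 / 2 - f) with ht₂
  set t₃ := 2 * Real.log 8 / (η' ^ 2 * f) with ht₃
  have ht₁0 : 0 < t₁ := by positivity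
  have ht₂0 : 0 < t₂ := by positivity
  have ht₃0 : 0 ≤ t₃ := by positivity
  have hT0 : (0 : ℝ) < T := by linarith
  have hT1 : 8 * (n₀ : ℝ) < T := by linarith
  have hT2 : (16 : ℝ) ≤ T := by linarith
  have hT3 : 16 ≤ f * T := by
    have : t₁ ≤ T := by linarith
    rw [ht₁, div_le_iff₀ hf0] at this
    linarith
  have hT4 : 2 * b ≤ T := by linarith
  have hT5 : 2 ≤ (1 / 2 - f) * T := by
    have : t₂ ≤ T := by linarith
    rw [ht₂, div_le_iff₀ hf2] at this
    linarith
  have hT6 : 2 * Real.log 8 ≤ η' ^ 2 * f * T := by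
    have : t₃ ≤ T := by linarith
    rw [ht₃, div_le_iff₀ (by positivity)] at this
    linarith
  clear_value t₁ t₂ t₃
  clear hTT hTR
  obtain ⟨hR, hen⟩ := runTimes_scenario hf0 hf1 hg hg1 hn₀1 hT1 hT2 hT3
  have hl2 : (⌈(T : ℝ) / 2 + f * T⌉₊ : ℝ) < T / 2 + f * T + 1 :=
    Nat.ceil_lt_add_one (by positivity)
  have hw1 : f * T / 4 ≤ ⌈f * T / 4⌉₊ := Nat.le_ceil _
  have hn1 : (T : ℝ) / 8 ≤ ⌈(T : ℝ) / 8⌉₊ := Nat.le_ceil _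
  set e := ⌈(T : ℝ) / 2⌉₊ with he
  set l := ⌈(T : ℝ) / 2 + f * T⌉₊ with hl
  set w := ⌈f * T / 4⌉₊ with hw
  set n₁ := ⌈(T : ℝ) / 8⌉₊ with hn₁
  have hn01 := hR.n₀_lt
  have hn1e := hR.n₁_lt
  have hew := hR.e_lt
  have hhl := hR.h_lt
  have hlT := hR.l_le
  have hsubw : ((e + w - e : ℕ) : ℝ) = w := by rw [Nat.add_sub_cancel_left]
  have hL0 : 0 ≤ Real.log (4 * f * T) := Real.log_nonneg (by linarith)
  have hα1 : α ≤ 1 := by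
    have : 0 ≤ 4 * Real.log (4 * f * T) / T := by positivity
    linarith
  -- Here the hypothesis on `α` enters: the exponent is at least `T / 4`, so the power is at most
  -- `exp (-log (4fT)) = 1 / (4fT)`.
  have hαn : α ^ (e - n₁) ≤ b / T := by
    refine (pow_le_inv_of_le hα0 hT0 hL0 hen hα).trans ?_
    rw [Real.exp_neg, Real.exp_log (by positivity), le_div_iff₀ hT0]
    have : (4 * f * T)⁻¹ * T = 1 / (4 * f) := by field_simp
    rw [this]
    linarith
  have hαn0 : 0 ≤ α ^ (e - n₁) := by positivity
  have hbox := coinBox_scenario_prob (K := K) hK hc (ρ := 1 - α ^ (e - n₁)) hf0 hκ0 heps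
    (by linarith : 8 * κ ≤ b) (by linarith) hT0 hT4 hn₀1 hε₀ hn01 hn1e (by omega) hn1 hw1
    (by linarith) (by linarith)
  set A : Set (Sample 2 K) := {ω | g * min (θ * T) ((T : ℝ) - l) ≤
    regret (mega K c d p₀ α β) (scenario T f) ν T ω} with hA
  have hAm : MeasurableSet A := measurableSet_le measurable_const
    ((measurableStates_mega K 2 c d p₀ α β).regret (scenario T f) ν T)
  have hlaw : ENNReal.ofReal (1 / 2) * ENNReal.ofReal p₁ ≤ law 2 ν A := by
    refine law_ge_of_sections hAm (MeasurableSet.pi (Finset.countable_toSet _)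
      fun i _ => measurableSet_coinBox i) hbox fun x hx => ?_
    have hcoins := typicalCoins_of_mem hK hc (by linarith) rfl hn01 hn1e (by omega) hhl hlT hx
    have hcard := le_card_plannedRounds hK hn₀ (by omega) a₁ hx
    refine typicalTable_prob (a₁ := a₁) (a₂ := a₂) hI.supp (show 0 < g / 4 by linarith) hη'0
      hcard hM ?_ ?_ (measurable_prodMk_left hAm) (Q := θ * T) (e := e) (h := e + w) (l := l) ?_
    · rw [hsubw]
      have h1 : Real.exp (-2 * η' ^ 2 * w) ≤ Real.exp (-Real.log 8) := by
        rw [Real.exp_le_exp]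
        have : η' ^ 2 * (f * T / 4) ≤ η' ^ 2 * w :=
          mul_le_mul_of_nonneg_left hw1 (by positivity)
        linarith
      rw [Real.exp_neg, Real.exp_log (by norm_num)] at h1
      linarith
    · rw [hsubw]
      have h1 : η' * (f * T / 4) ≤ η' * w := mul_le_mul_of_nonneg_left hw1 hη'0.le
      have h2 : g / 2 * (f * T / 4) ≤ η' * (f * T / 4) :=
        mul_le_mul_of_nonneg_right (by linarith) (by positivity)
      have h3 : mean ν a₂ - η' = η' := by rw [hη']; ring
      have h4 : 0 ≤ g * f * T := by positivity
      rw [h3, hθ]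
      linarith
    · intro r hr
      exact mega_regret_ge (ω := (x, r)) hK hI hg hT hR hα0 hα1 hp0 hp1 (scenario_zero T f)
        (scenario_one T f) hcoins hr fun k => Finset.card_pos.1 (lt_of_lt_of_le hM1 (hcard k))
  have hint := integrable_regret (measurableStates_mega K 2 c d p₀ α β) (scenario T f) hK le_rfl
    hI T (law 2 ν)
  have hnn : ∀ ω, 0 ≤ regret (mega K c d p₀ α β) (scenario T f) ν T ω := fun ω => by
    rw [regret_eq_sum]
    exact Finset.sum_nonneg fun t _ => (roundRegret_mem hK le_rfl hI).1
  have hmk := mul_meas_ge_le_integral_of_nonneg (Filter.Eventually.of_forall hnn) hint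
    (g * min (θ * T) ((T : ℝ) - l))
  refine le_trans ?_ hmk
  have hreal : p₁ / 2 ≤ (law 2 ν).real A := by
    rw [measureReal_def, ← ENNReal.ofReal_le_iff_le_toReal (measure_ne_top _ _)]
    refine le_trans (le_of_eq ?_) hlaw
    rw [← ENNReal.ofReal_mul (by norm_num)]
    congr 1
    ring
  have hmin : min θ ((1 / 2 - f) / 2) * T ≤ min (θ * T) ((T : ℝ) - l) := by
    rw [min_mul_of_nonneg _ _ hT0.le]
    refine min_le_min_left _ ?_
    linarith
  calc g * min θ ((1 / 2 - f) / 2) * (p₁ / 2) * T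
      = (g * (min θ ((1 / 2 - f) / 2) * T)) * (p₁ / 2) := by ring
    _ ≤ (g * min (θ * T) ((T : ℝ) - l)) * (law 2 ν).real A := by
        refine mul_le_mul (mul_le_mul_of_nonneg_left hmin hg.le) hreal (by positivity) ?_
        have : 0 ≤ min θ ((1 / 2 - f) / 2) * T := by positivity
        exact mul_nonneg hg.le (this.trans hmin)

end

end MultiBandit

namespace MultiBandit

noncomputable section

/-! ### The state of a DMC player -/

section DMCStates

variable {K N : ℕ} {T₀ T₁ : ℕ} {active : Fin N → ℕ → Prop} {ω : Sample N K}

/-- The state of player `j` after `t` rounds of DMC. -/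
def dmcState (T₀ T₁ : ℕ) (active : Fin N → ℕ → Prop) (ω : Sample N K) (t : ℕ) (j : Fin N) :
    DMCState K :=
  states (dmc K T₀ T₁) active ω t j

open scoped Classical in
lemma dmcState_succ {j : Fin N} {t : ℕ} (h : active j (t + 1)) :
    dmcState T₀ T₁ active ω (t + 1) j =
      let s := dmcRestart T₁ (t + 1) (dmcState T₀ T₁ active ω t j)
      let a := played (dmc K T₀ T₁) active ω (t + 1)
      if ¬ s.synced then s
      else if epochPos T₁ (t + 1) < T₀ then
        { s with
          colls := if Collides a j then s.colls + 1 else s.colls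
          obs := fun k => if a j = some k ∧ ¬ Collides a j then s.obs k + 1 else s.obs k
          sum := fun k => if a j = some k ∧ ¬ Collides a j then
            s.sum k + reward ω (t + 1) a j else s.sum k }
      else { s with seat := if s.seat = none ∧ ¬ Collides a j then a j else s.seat } := by
  rw [dmcState, states]
  simp only [h, if_true]
  rfl

lemma played_dmc {j : Fin N} {t : ℕ} (h : active j (t + 1)) :
    played (dmc K T₀ T₁) active ω (t + 1) j =
      dmcChoose T₀ T₁ (t + 1) (fun i => ω.1 (j, t + 1, i)) (dmcState T₀ T₁ active ω t j) := by
  simp only [played, actions, h, if_true]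
  rfl

lemma epochPos_eq {m i : ℕ} (h : i < T₁) : epochPos T₁ (m * T₁ + i + 1) = i := by
  rw [epochPos, Nat.add_sub_cancel, Nat.mul_comm, Nat.mul_add_mod, Nat.mod_eq_of_lt h]

lemma played_dmc_learning {j : Fin N} {t : ℕ} (h : active j t) (ht : 1 ≤ t)
    (hp : epochPos T₁ t < T₀) :
    played (dmc K T₀ T₁) active ω t j = pick Finset.univ (ω.1 (j, t, .arm)) := by
  obtain ⟨t, rfl⟩ : ∃ s, t = s + 1 := ⟨t - 1, by omega⟩
  rw [played_dmc h, dmcChoose]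
  exact if_pos (Or.inr hp)

lemma dmcRestart_of_pos {t : ℕ} (h : epochPos T₁ t ≠ 0) (s : DMCState K) :
    dmcRestart T₁ t s = s := if_neg h

lemma dmcRestart_of_zero {t : ℕ} (h : epochPos T₁ t = 0) (s : DMCState K) :
    dmcRestart T₁ t s = ⟨True, 0, fun _ => 0, fun _ => 0, none⟩ := if_pos h

open scoped Classical in
-- The state is viewed after the restart of the next round, because at `i = 0` the stored state
-- still holds data of the previous epoch. For `i > 0` the restart does nothing.
lemma dmc_learning_aux (hT : T₀ < T₁) {m : ℕ} {j : Fin N} {i : ℕ} (hi : i ≤ T₀)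
    (hact : ∀ s ∈ Finset.Icc (m * T₁ + 1) (m * T₁ + i), active j s) :
    let s := dmcRestart T₁ (m * T₁ + i + 1) (dmcState T₀ T₁ active ω (m * T₁ + i) j)
    let a := played (dmc K T₀ T₁) active ω
    s.synced ∧ s.seat = none ∧
      s.colls = (∑ r ∈ Finset.Icc (m * T₁ + 1) (m * T₁ + i), if Collides (a r) j then 1 else 0) ∧
      (∀ k, s.obs k = ∑ r ∈ Finset.Icc (m * T₁ + 1) (m * T₁ + i),
        if a r j = some k ∧ ¬ Collides (a r) j then 1 else 0) ∧
      (∀ k, s.sum k = ∑ r ∈ Finset.Icc (m * T₁ + 1) (m * T₁ + i),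
        if a r j = some k ∧ ¬ Collides (a r) j then ω.2 (r, k) else 0) := by
  induction i with
  | zero =>
    rw [dmcRestart_of_zero (epochPos_eq (by omega))]
    simp
  | succ i ih =>
    obtain ⟨h1, h2, h3, h4, h5⟩ := ih (by omega) fun s hs => hact s (by
      rw [Finset.mem_Icc] at hs ⊢; omega)
    have hactive : active j (m * T₁ + i + 1) := hact _ (by rw [Finset.mem_Icc]; omega)
    rw [show m * T₁ + (i + 1) = m * T₁ + i + 1 by ring]
    rw [dmcRestart_of_pos (t := m * T₁ + i + 1 + 1)
      (by rw [show m * T₁ + i + 1 + 1 = m * T₁ + (i + 1) + 1 by ring,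
        epochPos_eq (by omega)]; omega), dmcState_succ hactive, epochPos_eq (by omega)]
    dsimp only
    rw [if_neg (not_not.2 h1), if_pos (by omega)]
    simp only [Finset.sum_Icc_succ_top (show m * T₁ + 1 ≤ m * T₁ + i + 1 by omega), ← h3, ← h4,
      ← h5]
    refine ⟨h1, h2, ?_, fun k => ?_, fun k => ?_⟩
    · split_ifs <;> rfl
    · split_ifs <;> rfl
    · split_ifs with hc
      · simp [reward, hc.1, hc.2]
      · rw [add_zero]

open scoped Classical in
/-- The state of a player at the end of a learning phase in which she was always present. -/
lemma dmc_learning (h₀ : 1 ≤ T₀) (hT : T₀ < T₁) {m : ℕ} {j : Fin N}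
    (hact : ∀ s ∈ Finset.Icc (m * T₁ + 1) (m * T₁ + T₀), active j s) :
    let s := dmcState T₀ T₁ active ω (m * T₁ + T₀) j
    let a := played (dmc K T₀ T₁) active ω
    s.synced ∧ s.seat = none ∧
      s.colls = (∑ r ∈ Finset.Icc (m * T₁ + 1) (m * T₁ + T₀), if Collides (a r) j then 1 else 0) ∧
      (∀ k, s.obs k = ∑ r ∈ Finset.Icc (m * T₁ + 1) (m * T₁ + T₀),
        if a r j = some k ∧ ¬ Collides (a r) j then 1 else 0) ∧
      (∀ k, s.sum k = ∑ r ∈ Finset.Icc (m * T₁ + 1) (m * T₁ + T₀),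
        if a r j = some k ∧ ¬ Collides (a r) j then ω.2 (r, k) else 0) := by
  have := dmc_learning_aux (ω := ω) hT le_rfl hact
  rwa [dmcRestart_of_pos (by rw [epochPos_eq hT]; omega)] at this

lemma dmcState_succ_late (h₀ : 1 ≤ T₀) {m i : ℕ} (hi : T₀ ≤ i) (hi' : i < T₁) {j : Fin N}
    (h : active j (m * T₁ + i + 1))
    (hs : (dmcState T₀ T₁ active ω (m * T₁ + i) j).synced) :
    dmcState T₀ T₁ active ω (m * T₁ + i + 1) j =
      { dmcState T₀ T₁ active ω (m * T₁ + i) j with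
        seat := open scoped Classical in
          if (dmcState T₀ T₁ active ω (m * T₁ + i) j).seat = none ∧
            ¬ Collides (played (dmc K T₀ T₁) active ω (m * T₁ + i + 1)) j then
          played (dmc K T₀ T₁) active ω (m * T₁ + i + 1) j
          else (dmcState T₀ T₁ active ω (m * T₁ + i) j).seat } := by
  rw [dmcState_succ h, epochPos_eq hi', dmcRestart_of_pos (by rw [epochPos_eq hi']; omega)]
  dsimp only
  rw [if_neg (not_not.2 hs), if_neg (by omega)]

lemma played_dmc_late (h₀ : 1 ≤ T₀) {m i : ℕ} (hi : T₀ ≤ i) (hi' : i < T₁) {j : Fin N}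
    (h : active j (m * T₁ + i + 1))
    (hs : (dmcState T₀ T₁ active ω (m * T₁ + i) j).synced) :
    played (dmc K T₀ T₁) active ω (m * T₁ + i + 1) j =
      match (dmcState T₀ T₁ active ω (m * T₁ + i) j).seat with
      | some k => some k
      | none => (pick (Finset.univ.filter fun k : Fin K =>
          k.val < (dmcState T₀ T₁ active ω (m * T₁ + i) j).nStar T₀)
            (ω.1 (j, m * T₁ + i + 1, .arm))).map
          (ranking (dmcState T₀ T₁ active ω (m * T₁ + i) j).est) := by
  rw [played_dmc h, dmcChoose, epochPos_eq hi', dmcRestart_of_pos (by rw [epochPos_eq hi']; omega)]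
  refine (if_neg (by push Not; exact ⟨hs, hi⟩)).trans ?_
  cases (dmcState T₀ T₁ active ω (m * T₁ + i) j).seat <;> rfl

end DMCStates

/-! ### Musical chairs after a successful learning phase -/

section Chairs

variable {K : ℕ} {T₀ T₁ : ℕ} {active : Fin 2 → ℕ → Prop} {ω : Sample 2 K}
  {ν : Fin K → Measure ℝ} {a₁ a₂ : Fin K} {ε : ℝ}

lemma pick_first (hK : 2 ≤ K) {u : ℝ} (hu : u ∈ Set.Ico (0 : ℝ) 1) (hε : 0 ≤ ε)
    (hI : Instance ν a₁ a₂ ε) {est : Fin K → ℝ} (he : EpsCorrect (mean ν) ε est) :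
    (pick (Finset.univ.filter fun k : Fin K => k.val < 1) u).map (ranking est) = some a₁ := by
  have hne : (Finset.univ.filter fun k : Fin K => k.val < 1).Nonempty :=
    ⟨⟨0, by omega⟩, by simp⟩
  obtain ⟨k, hk, hp⟩ := exists_pick hne hu
  rw [hp, Option.map_some, he.zero hε hI (by simpa using hk)]

/-- All gaps around `a₁` and `a₂` exceed `ε`, so every correct ranking has them in the first two
positions in this order. Hence `X` and `Y` are the same for both players although their estimates
differ. -/
lemma pick_first_two (hK : 2 ≤ K) (hε : 0 ≤ ε) (hI : Instance ν a₁ a₂ ε) :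
    ∃ X Y, (X = a₁ ∧ Y = a₂ ∨ X = a₂ ∧ Y = a₁) ∧ ∀ est : Fin K → ℝ, EpsCorrect (mean ν) ε est →
      ∀ u ∈ Set.Ico (0 : ℝ) 1,
        (pick (Finset.univ.filter fun k : Fin K => k.val < 2) u).map (ranking est) =
          some (if u < 1 / 2 then X else Y) := by
  have hcard : (Finset.univ.filter fun k : Fin K => k.val < 2).card = 2 := by
    have : (Finset.univ.filter fun k : Fin K => k.val < 2) = {⟨0, by omega⟩, ⟨1, by omega⟩} := by
      ext k
      simp only [Finset.mem_filter, Finset.mem_univ, true_and, Finset.mem_insert,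
        Finset.mem_singleton, Fin.ext_iff]
      omega
    rw [this, Finset.card_pair (by simp)]
  obtain ⟨x, hx, y, hy, hxy, hp⟩ := exists_pick_pair hcard
  rw [Finset.mem_filter] at hx hy
  have hne : x.val ≠ y.val := fun h => hxy (Fin.ext h)
  rcases Nat.eq_zero_or_pos x.val with h0 | h0
  · refine ⟨a₁, a₂, Or.inl ⟨rfl, rfl⟩, fun est he u hu => ?_⟩
    rw [hp u hu, Option.map_some]
    split_ifs
    · rw [he.zero hε hI h0]
    · rw [he.one hε hI (by omega)]
  · refine ⟨a₂, a₁, Or.inr ⟨rfl, rfl⟩, fun est he u hu => ?_⟩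
    rw [hp u hu, Option.map_some]
    split_ifs
    · rw [he.one hε hI (by omega)]
    · rw [he.zero hε hI (by omega)]

lemma nStar_congr {s s' : DMCState K} (h : s.colls = s'.colls) (T₀ : ℕ) :
    s.nStar T₀ = s'.nStar T₀ := by
  rw [DMCState.nStar, DMCState.nStar, h]

/-- A player who is alone plays the best arm. -/
lemma dmc_alone (hK : 2 ≤ K) (h₀ : 1 ≤ T₀) (hT : T₀ < T₁) (hε : 0 ≤ ε) (hI : Instance ν a₁ a₂ ε)
    {m : ℕ} {j : Fin 2} {i : ℕ} (hi : T₀ ≤ i) (hi' : i < T₁)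
    (hact : ∀ s ∈ Finset.Icc (m * T₁ + 1) (m * T₁ + i + 1), active j s)
    (hcoin : ∀ s ∈ Finset.Icc (m * T₁ + 1) (m * T₁ + i + 1),
      ω.1 (j, s, .arm) ∈ Set.Ico (0 : ℝ) 1)
    (hest : EpsCorrect (mean ν) ε (dmcState T₀ T₁ active ω (m * T₁ + T₀) j).est)
    (hn : (dmcState T₀ T₁ active ω (m * T₁ + T₀) j).nStar T₀ = 1) :
    played (dmc K T₀ T₁) active ω (m * T₁ + i + 1) j = some a₁ := by
  -- The collision count and the estimates are frozen after the learning phase, so `N* = 1` and the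
  -- ranking persist, and only `a₁` can become the seat.
  have key : ∀ i, T₀ ≤ i → i < T₁ →
      (∀ s ∈ Finset.Icc (m * T₁ + 1) (m * T₁ + i + 1), active j s) →
      (∀ s ∈ Finset.Icc (m * T₁ + 1) (m * T₁ + i + 1),
        ω.1 (j, s, .arm) ∈ Set.Ico (0 : ℝ) 1) →
      (dmcState T₀ T₁ active ω (m * T₁ + i) j).synced ∧
      (dmcState T₀ T₁ active ω (m * T₁ + i) j).colls =
        (dmcState T₀ T₁ active ω (m * T₁ + T₀) j).colls ∧
      (dmcState T₀ T₁ active ω (m * T₁ + i) j).est =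
        (dmcState T₀ T₁ active ω (m * T₁ + T₀) j).est ∧
      ((dmcState T₀ T₁ active ω (m * T₁ + i) j).seat = none ∨
        (dmcState T₀ T₁ active ω (m * T₁ + i) j).seat = some a₁) ∧
      played (dmc K T₀ T₁) active ω (m * T₁ + i + 1) j = some a₁ := by
    intro i hi
    have hplay : ∀ i, T₀ ≤ i → i < T₁ → active j (m * T₁ + i + 1) →
      ω.1 (j, m * T₁ + i + 1, .arm) ∈ Set.Ico (0 : ℝ) 1 →
      (dmcState T₀ T₁ active ω (m * T₁ + i) j).synced →
      (dmcState T₀ T₁ active ω (m * T₁ + i) j).colls =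
        (dmcState T₀ T₁ active ω (m * T₁ + T₀) j).colls →
      (dmcState T₀ T₁ active ω (m * T₁ + i) j).est =
        (dmcState T₀ T₁ active ω (m * T₁ + T₀) j).est →
      ((dmcState T₀ T₁ active ω (m * T₁ + i) j).seat = none ∨
        (dmcState T₀ T₁ active ω (m * T₁ + i) j).seat = some a₁) →
      played (dmc K T₀ T₁) active ω (m * T₁ + i + 1) j = some a₁ := by
      intro i hi hi' ha hu h1 h2 h3 h4
      rw [played_dmc_late h₀ hi hi' ha h1]
      rcases h4 with h4 | h4
      · rw [h4, nStar_congr h2, hn, h3]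
        exact pick_first hK hu hε hI hest
      · rw [h4]
    induction i, hi using Nat.le_induction with
    | base =>
      intro hi' ha hu
      obtain ⟨h1, h2, _⟩ := dmc_learning (ω := ω) (K := K) h₀ hT (m := m) (j := j)
        fun s hs => ha s (by rw [Finset.mem_Icc] at hs ⊢; omega)
      refine ⟨h1, rfl, rfl, Or.inl h2, hplay _ le_rfl hi' (ha _ (by rw [Finset.mem_Icc]; omega))
        (hu _ (by rw [Finset.mem_Icc]; omega)) h1 rfl rfl (Or.inl h2)⟩
    | succ i hi ih =>
      intro hi' ha hu
      obtain ⟨h1, h2, h3, h4, h5⟩ := ih (by omega)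
        (fun s hs => ha s (by rw [Finset.mem_Icc] at hs ⊢; omega))
        (fun s hs => hu s (by rw [Finset.mem_Icc] at hs ⊢; omega))
      have hstep := dmcState_succ_late (ω := ω) h₀ hi (by omega)
        (ha (m * T₁ + i + 1) (by rw [Finset.mem_Icc]; omega)) h1
      have e1 : (dmcState T₀ T₁ active ω (m * T₁ + (i + 1)) j).synced := by
        rw [← add_assoc, hstep]; exact h1
      have e2 : (dmcState T₀ T₁ active ω (m * T₁ + (i + 1)) j).colls =
          (dmcState T₀ T₁ active ω (m * T₁ + T₀) j).colls := by
        rw [← add_assoc, hstep]; exact h2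
      have e3 : (dmcState T₀ T₁ active ω (m * T₁ + (i + 1)) j).est =
          (dmcState T₀ T₁ active ω (m * T₁ + T₀) j).est := by
        rw [← add_assoc, hstep, ← h3]; rfl
      have e4 : (dmcState T₀ T₁ active ω (m * T₁ + (i + 1)) j).seat = none ∨
          (dmcState T₀ T₁ active ω (m * T₁ + (i + 1)) j).seat = some a₁ := by
        rw [← add_assoc, hstep]
        dsimp only
        split_ifs
        · exact Or.inr h5
        · exact h4
      exact ⟨e1, e2, e3, e4, hplay _ (by omega) hi' (ha _ (by rw [Finset.mem_Icc]; omega))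
        (hu _ (by rw [Finset.mem_Icc]; omega)) e1 e2 e3 e4⟩
  exact (key i hi hi' hact hcoin).2.2.2.2

/-- In round `s` both players would choose the same one of two arms. -/
def SameHalf (ω : Sample 2 K) (s : ℕ) : Prop :=
  ω.1 (0, s, .arm) < 1 / 2 ↔ ω.1 (1, s, .arm) < 1 / 2

/-- Two players play the two best arms, unless they have chosen the same arm in all rounds since
the end of the learning phase. -/
lemma dmc_pair (hK : 2 ≤ K) (h₀ : 1 ≤ T₀) (hT : T₀ < T₁) (hε : 0 ≤ ε) (hI : Instance ν a₁ a₂ ε)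
    {m : ℕ} {i : ℕ} (hi : T₀ ≤ i) (hi' : i < T₁)
    (hact : ∀ j, ∀ s ∈ Finset.Icc (m * T₁ + 1) (m * T₁ + i + 1), active j s)
    (hcoin : ∀ j, ∀ s ∈ Finset.Icc (m * T₁ + 1) (m * T₁ + i + 1),
      ω.1 (j, s, .arm) ∈ Set.Ico (0 : ℝ) 1)
    (hest : ∀ j, EpsCorrect (mean ν) ε (dmcState T₀ T₁ active ω (m * T₁ + T₀) j).est)
    (hn : ∀ j, (dmcState T₀ T₁ active ω (m * T₁ + T₀) j).nStar T₀ = 2) :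
    (∀ s ∈ Finset.Icc (m * T₁ + T₀ + 1) (m * T₁ + i + 1), SameHalf ω s) ∨
      ∃ x y, (x = a₁ ∧ y = a₂ ∨ x = a₂ ∧ y = a₁) ∧
        played (dmc K T₀ T₁) active ω (m * T₁ + i + 1) 0 = some x ∧
        played (dmc K T₀ T₁) active ω (m * T₁ + i + 1) 1 = some y := by
  have hne : a₁ ≠ a₂ := by
    rintro rfl
    have := hI.gap_one
    simp only [sub_self] at this
    linarith
  obtain ⟨X, Y, hXY, hpick⟩ := pick_first_two hK hε hI
  have hXYne : X ≠ Y := by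
    rcases hXY with ⟨rfl, rfl⟩ | ⟨rfl, rfl⟩
    · exact hne
    · exact hne.symm
  let S : ℕ → Fin 2 → DMCState K := fun i j => dmcState T₀ T₁ active ω (m * T₁ + i) j
  let A : ℕ → Fin 2 → Option (Fin K) := fun i => played (dmc K T₀ T₁) active ω (m * T₁ + i + 1)
  let u : ℕ → Fin 2 → ℝ := fun i j => ω.1 (j, m * T₁ + i + 1, .arm)
  have hunseated : ∀ i, T₀ ≤ i → i < T₁ → ∀ j, active j (m * T₁ + i + 1) →
      u i j ∈ Set.Ico (0 : ℝ) 1 → (S i j).synced → (S i j).colls = (S T₀ j).colls →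
      (S i j).est = (S T₀ j).est → (S i j).seat = none →
      A i j = some (if u i j < 1 / 2 then X else Y) := by
    intro i hi hi' j ha hu h1 h2 h3 h4
    change played (dmc K T₀ T₁) active ω (m * T₁ + i + 1) j = _
    rw [played_dmc_late h₀ hi hi' ha h1]
    change (dmcState T₀ T₁ active ω (m * T₁ + i) j).seat = none at h4
    rw [h4, nStar_congr h2, hn, h3]
    exact hpick _ (hest j) _ hu
  -- Both players are seated in the same round: equal halves make both collide and stay unseated,
  -- while different halves give each a seat on a different one of the two arms.
  have key : ∀ i, T₀ ≤ i → i < T₁ →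
      (∀ j, ∀ s ∈ Finset.Icc (m * T₁ + 1) (m * T₁ + i + 1), active j s) →
      (∀ j, ∀ s ∈ Finset.Icc (m * T₁ + 1) (m * T₁ + i + 1),
        ω.1 (j, s, .arm) ∈ Set.Ico (0 : ℝ) 1) →
      (∀ j, (S i j).synced ∧ (S i j).colls = (S T₀ j).colls ∧ (S i j).est = (S T₀ j).est) ∧
      (((∀ j, (S i j).seat = none) ∧
          ∀ s ∈ Finset.Icc (m * T₁ + T₀ + 1) (m * T₁ + i), SameHalf ω s) ∨
        ∃ x y, (x = a₁ ∧ y = a₂ ∨ x = a₂ ∧ y = a₁) ∧ (S i 0).seat = some x ∧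
          (S i 1).seat = some y) := by
    intro i hi
    induction i, hi using Nat.le_induction with
    | base =>
      intro hi' ha hu
      have h := fun j => dmc_learning (ω := ω) (K := K) h₀ hT (m := m) (j := j)
        fun s hs => ha j s (by rw [Finset.mem_Icc] at hs ⊢; omega)
      refine ⟨fun j => ⟨(h j).1, rfl, rfl⟩, Or.inl ⟨fun j => (h j).2.1, fun s hs => ?_⟩⟩
      rw [Finset.mem_Icc] at hs
      omega
    | succ i hi ih =>
      intro hi' ha hu
      obtain ⟨h1, h2⟩ := ih (by omega)
        (fun j s hs => ha j s (by rw [Finset.mem_Icc] at hs ⊢; omega))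
        (fun j s hs => hu j s (by rw [Finset.mem_Icc] at hs ⊢; omega))
      have ha' : ∀ j, active j (m * T₁ + i + 1) := fun j => ha j _ (by rw [Finset.mem_Icc]; omega)
      have hu' : ∀ j, u i j ∈ Set.Ico (0 : ℝ) 1 := fun j => hu j _ (by rw [Finset.mem_Icc]; omega)
      have hstep : ∀ j, S (i + 1) j = { S i j with
          seat := open scoped Classical in
            if (S i j).seat = none ∧ ¬ Collides (A i) j then A i j else (S i j).seat } :=
        fun j => dmcState_succ_late (ω := ω) h₀ hi (by omega) (ha' j) (h1 j).1
      refine ⟨fun j => ?_, ?_⟩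
      · rw [hstep j]
        exact ⟨(h1 j).1, (h1 j).2.1, (h1 j).2.2⟩
      · rcases h2 with ⟨hnone, hhalf⟩ | ⟨x, y, hxy, hx, hy⟩
        · have hA := fun j => hunseated i hi (by omega) j (ha' j) (hu' j) (h1 j).1 (h1 j).2.1
            (h1 j).2.2 (hnone j)
          by_cases hsame : SameHalf ω (m * T₁ + i + 1)
          · left
            have hs0 : u i 0 < 1 / 2 ↔ u i 1 < 1 / 2 := hsame
            have hc : Collides (A i) 0 := by
              rw [collides_zero, hA 0, hA 1]
              exact ⟨by simp, by simp only [hs0]⟩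
            have hcj : ∀ j, Collides (A i) j := by
              intro j
              fin_cases j
              · exact hc
              · exact collides_comm.1 hc
            refine ⟨fun j => ?_, fun s hs => ?_⟩
            · rw [hstep j]
              simp [hcj j, hnone j]
            · rw [Finset.mem_Icc] at hs
              rcases Nat.lt_or_ge s (m * T₁ + i + 1) with h3 | h3
              · exact hhalf s (by rw [Finset.mem_Icc]; omega)
              · rw [show s = m * T₁ + i + 1 by omega]
                exact hsame
          · right
            have hs0 : ¬ (u i 0 < 1 / 2 ↔ u i 1 < 1 / 2) := hsame
            have hAne : A i 0 ≠ A i 1 := by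
              rw [hA 0, hA 1]
              intro h
              have h' := Option.some.inj h
              apply hs0
              by_cases g0 : u i 0 < 1 / 2 <;> by_cases g1 : u i 1 < 1 / 2 <;>
                simp only [g0, g1, if_true, if_false] at h' ⊢
              · exact absurd h' hXYne
              · exact absurd h' hXYne.symm
            have hc0 : ¬ Collides (A i) 0 := fun h => hAne (collides_zero.1 h).2.symm
            have hc1 : ¬ Collides (A i) 1 := fun h => hc0 (collides_comm.2 h)
            refine ⟨if u i 0 < 1 / 2 then X else Y, if u i 1 < 1 / 2 then X else Y, ?_, ?_, ?_⟩
            · by_cases g0 : u i 0 < 1 / 2 <;> by_cases g1 : u i 1 < 1 / 2 <;>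
                simp only [g0, g1, if_true, if_false, iff_self, not_true] at hs0 ⊢
              · exact hXY
              · rcases hXY with ⟨h, h'⟩ | ⟨h, h'⟩
                · exact Or.inr ⟨h', h⟩
                · exact Or.inl ⟨h', h⟩
            · rw [hstep 0, ← hA 0]
              simp [hc0, hnone 0]
            · rw [hstep 1, ← hA 1]
              simp [hc1, hnone 1]
        · right
          refine ⟨x, y, hxy, ?_, ?_⟩
          · rw [hstep 0]; simp [hx]
          · rw [hstep 1]; simp [hy]
  obtain ⟨h1, h2⟩ := key i hi hi' hact hcoin
  have ha' : ∀ j, active j (m * T₁ + i + 1) := fun j => hact j _ (by rw [Finset.mem_Icc]; omega)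
  have hu' : ∀ j, u i j ∈ Set.Ico (0 : ℝ) 1 := fun j => hcoin j _ (by rw [Finset.mem_Icc]; omega)
  rcases h2 with ⟨hnone, hhalf⟩ | ⟨x, y, hxy, hx, hy⟩
  · have hA := fun j => hunseated i hi hi' j (ha' j) (hu' j) (h1 j).1 (h1 j).2.1
      (h1 j).2.2 (hnone j)
    by_cases hsame : SameHalf ω (m * T₁ + i + 1)
    · left
      intro s hs
      rw [Finset.mem_Icc] at hs
      rcases Nat.lt_or_ge s (m * T₁ + i + 1) with h3 | h3
      · exact hhalf s (by rw [Finset.mem_Icc]; omega)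
      · rw [show s = m * T₁ + i + 1 by omega]
        exact hsame
    · right
      have hs0 : ¬ (u i 0 < 1 / 2 ↔ u i 1 < 1 / 2) := hsame
      refine ⟨if u i 0 < 1 / 2 then X else Y, if u i 1 < 1 / 2 then X else Y, ?_, hA 0, hA 1⟩
      by_cases g0 : u i 0 < 1 / 2 <;> by_cases g1 : u i 1 < 1 / 2 <;>
        simp only [g0, g1, if_true, if_false, iff_self, not_true] at hs0 ⊢
      · exact hXY
      · rcases hXY with ⟨h, h'⟩ | ⟨h, h'⟩
        · exact Or.inr ⟨h', h⟩
        · exact Or.inl ⟨h', h⟩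
  · right
    refine ⟨x, y, hxy, ?_, ?_⟩
    · rw [played_dmc_late h₀ hi hi' (ha' 0) (h1 0).1]
      change (dmcState T₀ T₁ active ω (m * T₁ + i) 0).seat = some x at hx
      rw [hx]
    · rw [played_dmc_late h₀ hi hi' (ha' 1) (h1 1).1]
      change (dmcState T₀ T₁ active ω (m * T₁ + i) 1).seat = some y at hy
      rw [hy]

open scoped Classical in
/-- The regret in a round after the learning phase, in an epoch without changes. -/
lemma dmc_roundRegret_le (hK : 2 ≤ K) (h₀ : 1 ≤ T₀) (hT : T₀ < T₁) (hε : 0 ≤ ε)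
    (hI : Instance ν a₁ a₂ ε) {T m i : ℕ} (hi : T₀ ≤ i) (hi' : i < T₁) (hiT : m * T₁ + i + 1 ≤ T)
    (hconst : ∀ j, ∀ s ∈ Finset.Icc (m * T₁ + 1) (m * T₁ + i + 1),
      (active j s ↔ active j (m * T₁ + 1)))
    (hcoin : ∀ j s, ω.1 (j, s, .arm) ∈ Set.Ico (0 : ℝ) 1)
    (hgood : ω ∈ dmcGood T₀ T₁ T ε active ν) :
    roundRegret (dmc K T₀ T₁) active ν (m * T₁ + i + 1) ω ≤
      if ∀ s ∈ Finset.Icc (m * T₁ + T₀ + 1) (m * T₁ + i + 1), SameHalf ω s then 2 else 0 := by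
  have hend : m * T₁ + i + 1 ∈ Finset.Icc (m * T₁ + 1) (m * T₁ + i + 1) := by
    rw [Finset.mem_Icc]; omega
  have hle : ∀ s, s ∈ Finset.Icc (m * T₁ + 1) (m * T₁ + T₀) →
      s ∈ Finset.Icc (m * T₁ + 1) (m * T₁ + i + 1) := by
    intro s hs
    rw [Finset.mem_Icc] at hs ⊢; omega
  have hg : ∀ j, active j (m * T₁ + 1) →
      EpsCorrect (mean ν) ε (dmcState T₀ T₁ active ω (m * T₁ + T₀) j).est ∧
        (dmcState T₀ T₁ active ω (m * T₁ + T₀) j).nStar T₀ = numActive active (m * T₁ + 1) := by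
    intro j hj
    have := hgood m (by omega) j fun t ht => (hconst j t (hle t ht)).2 hj
    exact ⟨this.1, this.2 fun i t ht => hconst i t (hle t ht)⟩
  have hif : (0 : ℝ) ≤ if ∀ s ∈ Finset.Icc (m * T₁ + T₀ + 1) (m * T₁ + i + 1), SameHalf ω s
      then 2 else 0 := by split_ifs <;> norm_num
  by_cases b0 : active 0 (m * T₁ + 1) <;> by_cases b1 : active 1 (m * T₁ + 1)
  · have hboth : ∀ j, active j (m * T₁ + 1) := by
      intro j; fin_cases j
      · exact b0
      · exact b1
    have hnum : numActive active (m * T₁ + 1) = 2 := by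
      rw [numActive_two, if_pos b0, if_pos b1]
    rcases dmc_pair hK h₀ hT hε hI hi hi' (fun j s hs => (hconst j s hs).2 (hboth j))
      (fun j s _ => hcoin j s) (fun j => (hg j (hboth j)).1)
      (fun j => (hg j (hboth j)).2.trans hnum) with h | ⟨x, y, hxy, hx, hy⟩
    · rw [if_pos h]
      exact (roundRegret_mem hK hε hI).2
    · refine le_trans (le_of_eq ?_) hif
      have hne : a₁ ≠ a₂ := by
        rintro rfl
        have := hI.gap_one
        simp only [sub_self] at this
        linarith
      rw [roundRegret_both hK hε hI ((hconst 0 _ hend).2 b0) ((hconst 1 _ hend).2 b1),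
        Fin.sum_univ_two]
      have hxyne : x ≠ y := by
        rcases hxy with ⟨rfl, rfl⟩ | ⟨rfl, rfl⟩
        · exact hne
        · exact hne.symm
      have hc : ¬ Collides (played (dmc K T₀ T₁) active ω (m * T₁ + i + 1)) 0 := by
        rw [collides_zero, hx, hy]
        rintro ⟨_, h⟩
        exact hxyne (Option.some.inj h).symm
      rw [gain_some hx hc, gain_some hy fun h => hc (collides_comm.2 h)]
      rcases hxy with ⟨rfl, rfl⟩ | ⟨rfl, rfl⟩ <;> ring
  · have hnum : numActive active (m * T₁ + 1) = 1 := by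
      rw [numActive_two, if_pos b0, if_neg b1]
    have hna : ¬ active 1 (m * T₁ + i + 1) := fun h => b1 ((hconst 1 _ hend).1 h)
    refine le_trans (le_of_eq ?_) hif
    rw [roundRegret_zero hK hε hI ((hconst 0 _ hend).2 b0) hna,
      gain_some (dmc_alone hK h₀ hT hε hI hi hi' (fun s hs => (hconst 0 s hs).2 b0)
        (fun s _ => hcoin 0 s) (hg 0 b0).1 ((hg 0 b0).2.trans hnum))
        (not_collides_of_not_active_one hna 0), sub_self]
  · have hnum : numActive active (m * T₁ + 1) = 1 := by
      rw [numActive_two, if_neg b0, if_pos b1]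
    have hna : ¬ active 0 (m * T₁ + i + 1) := fun h => b0 ((hconst 0 _ hend).1 h)
    refine le_trans (le_of_eq ?_) hif
    rw [roundRegret_one hK hε hI hna ((hconst 1 _ hend).2 b1),
      gain_some (dmc_alone hK h₀ hT hε hI hi hi' (fun s hs => (hconst 1 s hs).2 b1)
        (fun s _ => hcoin 1 s) (hg 1 b1).1 ((hg 1 b1).2.trans hnum))
        (not_collides_of_not_active_zero hna 1), sub_self]
  · rw [roundRegret_none (fun h => b0 ((hconst 0 _ hend).1 h))
      (fun h => b1 ((hconst 1 _ hend).1 h))]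
    exact hif

end Chairs

end

end MultiBandit

namespace MultiBandit

noncomputable section

/-! ### Independence of the arm coins of different rounds -/

section ArmCoins

variable {K : ℕ}

/-- The law of the coins of `N` players. -/
abbrev coinLaw (N : ℕ) : Measure (Fin N × ℕ × Coin → ℝ) :=
  Measure.infinitePi fun _ : Fin N × ℕ × Coin => unif

/-- The coins of all players in one round are grouped into a vector, as collisions depend on all of
them. Independence over rounds is the product structure, read off by reindexing along an injection
and currying. -/
lemma iIndepFun_armCoins (N : ℕ) :
    iIndepFun (fun (t : ℕ) (x : Fin N × ℕ × Coin → ℝ) (j : Fin N) => x (j, t, .arm))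
      (coinLaw N) := by
  rw [iIndepFun_iff_map_fun_eq_infinitePi_map (by fun_prop)]
  have h1 : ∀ t, (coinLaw N).map (fun x (j : Fin N) => x (j, t, Coin.arm)) =
      Measure.infinitePi fun _ : Fin N => unif := fun t =>
    Measure.map_infinitePi_infinitePi_of_inj (P := fun _ : Fin N × ℕ × Coin => unif)
      (f := fun j : Fin N => (j, t, Coin.arm)) fun a b h => (Prod.mk.inj h).1
  have h2 : (coinLaw N).map (fun x (p : ℕ × Fin N) => x (p.2, p.1, Coin.arm)) =
      Measure.infinitePi fun _ : ℕ × Fin N => unif :=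
    Measure.map_infinitePi_infinitePi_of_inj (P := fun _ : Fin N × ℕ × Coin => unif)
      (f := fun p : ℕ × Fin N => (p.2, p.1, Coin.arm)) fun a b h => by
        simp only [Prod.mk.injEq, and_true] at h
        exact Prod.ext h.2 h.1
  simp only [h1]
  rw [← Measure.infinitePi_map_curry (fun (_ : ℕ) (_ : Fin N) => unif), ← h2,
    Measure.map_map (by fun_prop) (by fun_prop)]
  rfl

lemma armCoins_pair {A B : Set ℝ} (hA : MeasurableSet A) (hB : MeasurableSet B) (t : ℕ) :
    coinLaw 2 {x | x (0, t, .arm) ∈ A ∧ x (1, t, .arm) ∈ B} = unif A * unif B := by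
  have h := Measure.infinitePi_pi (fun _ : Fin 2 × ℕ × Coin => unif)
    (s := {(0, t, .arm), (1, t, .arm)}) (t := fun i => if i.1 = 0 then A else B)
    (fun i _ => by split_ifs <;> assumption)
  rw [Finset.prod_pair (by simp)] at h
  simp only [if_true, one_ne_zero, if_false] at h
  rw [← h]
  congr 1
  ext x
  simp

lemma measurableSet_pick (k : Fin K) :
    MeasurableSet {u : ℝ | pick (Finset.univ : Finset (Fin K)) u = some k} :=
  measurableSet_eq_fun (measurable_pick measurable_const measurable_id) measurable_const

lemma unif_pick (k : Fin K) :
    unif {u : ℝ | pick (Finset.univ : Finset (Fin K)) u = some k} =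
      ENNReal.ofReal (1 / K) := by
  have hK : (0 : ℝ) < K := by exact_mod_cast k.pos
  have h : (1 : ℝ) / K = ((k : ℝ) + 1) / K - k / K := by ring
  have hk : ((k : ℝ) + 1) / K ≤ 1 := by
    rw [div_le_one hK]; exact_mod_cast k.2
  rw [h, ← unif_Ico (by positivity) hk]
  refine measure_congr ?_
  filter_upwards [ae_unif] with u hu
  refine propext ⟨fun h => ?_, fun h => pick_univ_of_mem k h⟩
  have h' := (pick_univ_eq u k).1 h
  rw [Nat.floor_eq_iff (mul_nonneg hu.1 hK.le)] at h'
  exact ⟨(div_le_iff₀ hK).2 h'.1, (lt_div_iff₀ hK).2 h'.2⟩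

/-- Exponential moments of the number of rounds in which an event depending on the arm coins of the
round occurs. -/
lemma lintegral_exp_count {N : ℕ} {E : ℕ → Set (Fin N → ℝ)} (hE : ∀ t, MeasurableSet (E t))
    {p s : ℝ} (hs : 0 ≤ s) (hs1 : s ≤ 1) (I : Finset ℕ)
    (hp : ∀ t ∈ I, p ≤ (coinLaw N).real {x | (fun j => x (j, t, .arm)) ∈ E t}) :
    ∫⁻ x, ENNReal.ofReal (Real.exp (-(s * ∑ t ∈ I,
        (E t).indicator (fun _ => (1 : ℝ)) fun j => x (j, t, .arm)))) ∂(coinLaw N) ≤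
      ENNReal.ofReal (Real.exp (-(p * (s / 2) * I.card))) := by
  let g : ℕ → (Fin N → ℝ) → ℝ := fun t y =>
    Real.exp (-(s * (E t).indicator (fun _ => (1 : ℝ)) y))
  have hg : ∀ t, Measurable (g t) := fun t =>
    Real.measurable_exp.comp ((measurable_const.indicator (hE t)).const_mul s).neg
  have hind : iIndepFun (fun t (x : Fin N × ℕ × Coin → ℝ) =>
      ENNReal.ofReal (g t fun j => x (j, t, .arm))) (coinLaw N) :=
    (iIndepFun_armCoins N).comp (fun t y => ENNReal.ofReal (g t y)) fun t => (hg t).ennreal_ofReal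
  have hmeas : ∀ t, Measurable fun x : Fin N × ℕ × Coin → ℝ => fun j => x (j, t, Coin.arm) := by
    intro t; fun_prop
  have h1 : ∀ x : Fin N × ℕ × Coin → ℝ, ENNReal.ofReal (Real.exp (-(s * ∑ t ∈ I,
        (E t).indicator (fun _ => (1 : ℝ)) fun j => x (j, t, .arm)))) =
      ∏ t ∈ I, ENNReal.ofReal (g t fun j => x (j, t, .arm)) := by
    intro x
    rw [← ENNReal.ofReal_prod_of_nonneg fun _ _ => (Real.exp_pos _).le, ← Real.exp_sum,
      Finset.mul_sum, Finset.sum_neg_distrib]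
  have h2 : ∀ t ∈ I, ∫⁻ x, ENNReal.ofReal (g t fun j => x (j, t, .arm)) ∂(coinLaw N) ≤
      ENNReal.ofReal (Real.exp (-(p * (s / 2)))) := by
    intro t ht
    set A : Set (Fin N × ℕ × Coin → ℝ) := {x | (fun j => x (j, t, .arm)) ∈ E t} with hA
    have hAm : MeasurableSet A := hmeas t (hE t)
    -- For `s ≤ 1`, `exp (-s) ≤ 1 - s / 2` bounds each factor by an affine function of the
    -- indicator, with integral at most `1 - p * s / 2 ≤ exp (-(p * s / 2))`.
    have hexp := exp_neg_two_mul_le (y := s / 2) (by linarith) (by linarith)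
    rw [show 2 * (s / 2) = s by ring] at hexp
    have hpt : ∀ x : Fin N × ℕ × Coin → ℝ,
        g t (fun j => x (j, t, .arm)) ≤ 1 - s / 2 * A.indicator (fun _ => (1 : ℝ)) x := by
      intro x
      by_cases hx : x ∈ A
      · have hx' : (fun j => x (j, t, Coin.arm)) ∈ E t := hx
        simp only [g, Set.indicator_of_mem hx, Set.indicator_of_mem hx', mul_one]
        exact hexp
      · have hx' : (fun j => x (j, t, Coin.arm)) ∉ E t := hx
        simp [g, Set.indicator_of_notMem hx, Set.indicator_of_notMem hx']
    have hint : Integrable (fun x => 1 - s / 2 * A.indicator (fun _ => (1 : ℝ)) x) (coinLaw N) :=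
      (integrable_const _).sub (((integrable_const _).indicator hAm).const_mul _)
    have hnn : ∀ x, 0 ≤ 1 - s / 2 * A.indicator (fun _ => (1 : ℝ)) x := fun x =>
      (Real.exp_pos _).le.trans (hpt x)
    calc _ ≤ ∫⁻ x, ENNReal.ofReal (1 - s / 2 * A.indicator (fun _ => (1 : ℝ)) x) ∂(coinLaw N) :=
          lintegral_mono fun x => ENNReal.ofReal_le_ofReal (hpt x)
      _ = ENNReal.ofReal (1 - s / 2 * (coinLaw N).real A) := by
          rw [← ofReal_integral_eq_lintegral_ofReal hint (Filter.Eventually.of_forall hnn),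
            integral_sub (integrable_const _) (((integrable_const _).indicator hAm).const_mul _),
            integral_const_mul, integral_indicator hAm]
          simp
      _ ≤ _ := by
          refine ENNReal.ofReal_le_ofReal ?_
          have := Real.add_one_le_exp (-(p * (s / 2)))
          nlinarith [hp t ht]
  simp only [h1]
  rw [lintegral_prod_eq_prod_lintegral_of_indepFun I _ hind
    fun t => ((hg t).comp (hmeas t)).ennreal_ofReal]
  refine (Finset.prod_le_prod' h2).trans (le_of_eq ?_)
  rw [Finset.prod_const, ← ENNReal.ofReal_pow (Real.exp_pos _).le, ← Real.exp_nat_mul]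
  congr 2
  ring

lemma sameHalf_prob (I : Finset ℕ) :
    coinLaw 2 {x | ∀ t ∈ I, (x (0, t, .arm) < 1 / 2 ↔ x (1, t, .arm) < 1 / 2)} =
      ENNReal.ofReal ((1 / 2) ^ I.card) := by
  let E : Set (Fin 2 → ℝ) := {y | y 0 < 1 / 2 ↔ y 1 < 1 / 2}
  have hE : MeasurableSet E := by
    refine measurableSet_setOfPred.2 (Measurable.iff ?_ ?_) <;>
      exact measurableSet_setOfPred.1 (measurableSet_lt (measurable_pi_apply _) measurable_const)
  have h1 : ∀ t ∈ I, coinLaw 2 ((fun x (j : Fin 2) => x (j, t, Coin.arm)) ⁻¹' E) =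
      ENNReal.ofReal (1 / 2) := by
    intro t _
    have e : (fun (x : Fin 2 × ℕ × Coin → ℝ) (j : Fin 2) => x (j, t, Coin.arm)) ⁻¹' E =
        {x | x (0, t, .arm) ∈ Set.Iio (1 / 2) ∧ x (1, t, .arm) ∈ Set.Iio (1 / 2)} ∪
          {x | x (0, t, .arm) ∈ Set.Ici (1 / 2) ∧ x (1, t, .arm) ∈ Set.Ici (1 / 2)} := by
      ext x
      simp only [E, Set.mem_preimage, Set.mem_ofPred_eq, Set.mem_union, Set.mem_Iio, Set.mem_Ici,
        ← not_lt]
      tauto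
    have hI : unif (Set.Iio (1 / 2)) = ENNReal.ofReal (1 / 2) := by
      rw [unif, Measure.restrict_apply measurableSet_Iio,
        show Set.Iio (1 / 2 : ℝ) ∩ Set.Ico 0 1 = Set.Ico 0 (1 / 2) by
          ext u
          simp only [Set.mem_inter_iff, Set.mem_Iio, Set.mem_Ico]
          constructor
          · rintro ⟨h, h', _⟩; exact ⟨h', h⟩
          · rintro ⟨h, h'⟩; exact ⟨h', h, by linarith⟩, Real.volume_Ico, sub_zero]
    have hI' : unif (Set.Ici (1 / 2)) = ENNReal.ofReal (1 / 2) := by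
      rw [unif, Measure.restrict_apply measurableSet_Ici,
        show Set.Ici (1 / 2 : ℝ) ∩ Set.Ico 0 1 = Set.Ico (1 / 2) 1 by
          ext u
          simp only [Set.mem_inter_iff, Set.mem_Ici, Set.mem_Ico]
          constructor
          · rintro ⟨h, _, h'⟩; exact ⟨h, h'⟩
          · rintro ⟨h, h'⟩; exact ⟨h, by linarith, h'⟩, Real.volume_Ico]
      norm_num
    have hm : ∀ j : Fin 2, Measurable fun x : Fin 2 × ℕ × Coin → ℝ => x (j, t, Coin.arm) :=
      fun j => measurable_pi_apply _
    have hd : MeasurableSet {x : Fin 2 × ℕ × Coin → ℝ |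
        x (0, t, .arm) ∈ Set.Ici (1 / 2) ∧ x (1, t, .arm) ∈ Set.Ici (1 / 2)} :=
      ((hm 0) measurableSet_Ici).inter ((hm 1) measurableSet_Ici)
    rw [e, measure_union _ hd, armCoins_pair measurableSet_Iio measurableSet_Iio,
      armCoins_pair measurableSet_Ici measurableSet_Ici, hI, hI',
      ← ENNReal.ofReal_mul (by norm_num), ← ENNReal.ofReal_add (by norm_num) (by norm_num)]
    · norm_num
    · rw [Set.disjoint_left]
      rintro x ⟨h, _⟩ ⟨h', _⟩
      exact absurd (Set.mem_Iio.1 h) (not_lt.2 h')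
  have h2 := (iIndepFun_armCoins 2).measure_inter_preimage_eq_mul I (sets := fun _ => E)
    fun _ _ => hE
  rw [Finset.prod_congr rfl h1, Finset.prod_const, ← ENNReal.ofReal_pow (by norm_num)] at h2
  rw [← h2]
  congr 1
  ext x
  simp [E]

end ArmCoins

/-! ### The estimated number of players -/

lemma nStar_eq_one {K : ℕ} {T₀ : ℕ} (h₀ : 1 ≤ T₀) {s : DMCState K} (h : s.colls = 0) :
    s.nStar T₀ = 1 := by
  have : (T₀ : ℝ) ≠ 0 := by exact_mod_cast (by omega : T₀ ≠ 0)
  rw [DMCState.nStar, if_neg (by omega), h]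
  simp [this]

/-- With `x = 1 / K` and `y = 1 - C / T₀`, rounding gives `2` iff `log y / log (1 - x)` lies in
`[1/2, 3/2)`. As the denominator is negative, it is enough that `(1 - x) ^ 3 < y ^ 2 < 1 - x`, which
holds for `y` within `x / 4` of `1 - x` when `x ≤ 1 / 2`. -/
lemma nStar_eq_two {K : ℕ} (hK : 2 ≤ K) {T₀ : ℕ} (h₀ : 1 ≤ T₀) {s : DMCState K}
    (h : |(s.colls : ℝ) - T₀ * (1 / K)| < 1 / (4 * K) * T₀) : s.nStar T₀ = 2 := by
  have hK' : (2 : ℝ) ≤ K := by exact_mod_cast hK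
  have hT : (0 : ℝ) < T₀ := by exact_mod_cast h₀
  set x : ℝ := 1 / K with hx
  have hx0 : 0 < x := by positivity
  have hx1 : x ≤ 1 / 2 := one_div_le_one_div_of_le (by norm_num) hK'
  rw [show (1 : ℝ) / (4 * K) = x / 4 by rw [hx]; field_simp] at h
  obtain ⟨h1, h2⟩ := abs_lt.1 h
  set y : ℝ := ((T₀ : ℝ) - s.colls) / T₀ with hy
  have hy1 : 1 - 5 * x / 4 < y := by
    rw [hy, lt_div_iff₀ hT]; nlinarith
  have hy2 : y < 1 - 3 * x / 4 := by
    rw [hy, div_lt_iff₀ hT]; nlinarith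
  have hy0 : 0 < y := by linarith
  have hne : s.colls ≠ T₀ := by
    intro h
    rw [hy, h, sub_self, zero_div] at hy0
    exact lt_irrefl _ hy0
  have hL : Real.log (1 - x) < 0 := Real.log_neg (by linarith) (by linarith)
  have hlow : 3 * Real.log (1 - x) < 2 * Real.log y := by
    rw [← Real.log_rpow (by linarith), ← Real.log_rpow hy0]
    refine Real.log_lt_log (Real.rpow_pos_of_pos (by linarith) _) ?_
    have e3 : (1 - x) ^ (3 : ℝ) = (1 - x) ^ 3 := by exact_mod_cast Real.rpow_natCast (1 - x) 3
    have e2 : y ^ (2 : ℝ) = y ^ 2 := by exact_mod_cast Real.rpow_natCast y 2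
    rw [e3, e2]
    have : (1 - 5 * x / 4) ^ 2 < y ^ 2 := pow_lt_pow_left₀ hy1 (by linarith) (by norm_num)
    -- `(1 - 5x/4)² - (1 - x)³ = x (1/2 - x)(15/16 - x) + x/32`.
    nlinarith [mul_nonneg hx0.le (mul_nonneg (by linarith : (0 : ℝ) ≤ 1 / 2 - x)
      (by linarith : (0 : ℝ) ≤ 15 / 16 - x))]
  have hupp : 2 * Real.log y < Real.log (1 - x) := by
    rw [← Real.log_rpow hy0]
    refine Real.log_lt_log (Real.rpow_pos_of_pos hy0 _) ?_
    have e2 : y ^ (2 : ℝ) = y ^ 2 := by exact_mod_cast Real.rpow_natCast y 2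
    rw [e2]
    have : y ^ 2 < (1 - 3 * x / 4) ^ 2 := pow_lt_pow_left₀ hy2 hy0.le (by norm_num)
    nlinarith
  have hround : round (Real.log y / Real.log (1 - x) + 1) = 2 := by
    rw [round_eq, Int.floor_eq_iff]
    push_cast
    constructor
    · have : 1 / 2 ≤ Real.log y / Real.log (1 - x) := by
        rw [le_div_iff_of_neg hL]; linarith
      linarith
    · have : Real.log y / Real.log (1 - x) < 3 / 2 := by
        rw [div_lt_iff_of_neg hL]; linarith
      linarith
  rw [DMCState.nStar, if_neg hne, hround]
  rfl

end

end MultiBandit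

namespace MultiBandit

noncomputable section

/-! ### The probability of a successful learning phase -/

section Learning

variable {K : ℕ} {T₀ T₁ : ℕ} {active : Fin 2 → ℕ → Prop} {ω : Sample 2 K}
  {ν : Fin K → Measure ℝ} {ε : ℝ}

lemma collides_iff {a : Fin 2 → Option (Fin K)} (j : Fin 2) :
    Collides a j ↔ a j ≠ none ∧ a (1 - j) = a j := by
  fin_cases j
  · exact collides_zero
  · exact collides_one

/-- The arm coins of a learning round for which player `j` is alone on arm `k`. -/
def soloCoins (active : Fin 2 → ℕ → Prop) (j : Fin 2) (k : Fin K) (t : ℕ) : Set (Fin 2 → ℝ) :=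
  {y | pick Finset.univ (y j) = some k ∧
    ¬ (active (1 - j) t ∧ pick Finset.univ (y (1 - j)) = some k)}

/-- The arm coins for which two exploring players choose the same arm. -/
def collisionCoins (K : ℕ) : Set (Fin 2 → ℝ) :=
  {y | ∃ k : Fin K, pick Finset.univ (y 0) = some k ∧ pick Finset.univ (y 1) = some k}

/-- The arm coins of round `t`. -/
def armCoins (t : ℕ) (x : Fin 2 × ℕ × Coin → ℝ) (j : Fin 2) : ℝ := x (j, t, .arm)

lemma measurable_armCoins (t : ℕ) : Measurable (armCoins t) := by
  unfold armCoins
  fun_prop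

lemma measurable_pick_eq (j : Fin 2) (k : Fin K) :
    Measurable fun y : Fin 2 → ℝ => pick Finset.univ (y j) = some k :=
  measurableSet_setOfPred.1 (measurableSet_eq_fun
    (measurable_pick measurable_const (measurable_pi_apply j)) measurable_const)

lemma measurableSet_soloCoins (j : Fin 2) (k : Fin K) (t : ℕ) :
    MeasurableSet (soloCoins active j k t) :=
  measurableSet_setOfPred.2 ((measurable_pick_eq j k).and
    (measurable_const.and (measurable_pick_eq (1 - j) k)).not)

lemma measurableSet_collisionCoins (K : ℕ) : MeasurableSet (collisionCoins K) :=
  measurableSet_setOfPred.2 (Measurable.exists fun k =>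
    (measurable_pick_eq 0 k).and (measurable_pick_eq 1 k))

lemma epochPos_lt_of_mem (hT : T₀ < T₁) {m t : ℕ}
    (ht : t ∈ Finset.Icc (m * T₁ + 1) (m * T₁ + T₀)) : epochPos T₁ t < T₀ := by
  rw [Finset.mem_Icc] at ht
  obtain ⟨i, rfl⟩ : ∃ i, t = m * T₁ + i + 1 := ⟨t - (m * T₁ + 1), by omega⟩
  rw [epochPos_eq (by omega)]
  omega

/-- The rounds in which a learning player observes arm `k` are determined by coins alone, hence
independent of the rewards. -/
lemma solo_iff (hT : T₀ < T₁) {m t : ℕ} {j : Fin 2} {k : Fin K}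
    (ht : t ∈ Finset.Icc (m * T₁ + 1) (m * T₁ + T₀)) (hj : active j t) :
    (played (dmc K T₀ T₁) active ω t j = some k ∧
      ¬ Collides (played (dmc K T₀ T₁) active ω t) j) ↔
      armCoins t ω.1 ∈ soloCoins active j k t := by
  have ht1 : 1 ≤ t := by rw [Finset.mem_Icc] at ht; omega
  have hp := epochPos_lt_of_mem hT ht
  rw [collides_iff, played_dmc_learning hj ht1 hp]
  by_cases ha : active (1 - j) t
  · rw [played_dmc_learning ha ht1 hp]
    simp only [soloCoins, armCoins, ha, true_and, Set.mem_ofPred_eq]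
    constructor
    · rintro ⟨h1, h2⟩
      exact ⟨h1, fun h => h2 ⟨by simp [h1], by rw [h, h1]⟩⟩
    · rintro ⟨h1, h2⟩
      exact ⟨h1, fun h => h2 (by rw [h.2, h1])⟩
  · rw [played_of_not_active ha]
    simp only [soloCoins, armCoins, ha, false_and, not_false_iff, and_true, Set.mem_ofPred_eq]
    constructor
    · exact And.left
    · exact fun h => ⟨h, fun h' => h'.1 h'.2.symm⟩

lemma collides_learning_iff (hT : T₀ < T₁) {m t : ℕ} {j : Fin 2}
    (ht : t ∈ Finset.Icc (m * T₁ + 1) (m * T₁ + T₀)) (h : ∀ j, active j t) :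
    Collides (played (dmc K T₀ T₁) active ω t) j ↔ armCoins t ω.1 ∈ collisionCoins K := by
  have ht1 : 1 ≤ t := by rw [Finset.mem_Icc] at ht; omega
  have hp := epochPos_lt_of_mem hT ht
  have h0 : Collides (played (dmc K T₀ T₁) active ω t) 0 ↔ armCoins t ω.1 ∈ collisionCoins K := by
    rw [collides_zero, played_dmc_learning (h 0) ht1 hp, played_dmc_learning (h 1) ht1 hp]
    constructor
    · rintro ⟨h1, h2⟩
      obtain ⟨k, hk⟩ := Option.ne_none_iff_exists'.1 h1
      exact ⟨k, hk, h2.trans hk⟩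
    · rintro ⟨k, h1, h2⟩
      change pick Finset.univ (ω.1 (0, t, .arm)) = some k at h1
      change pick Finset.univ (ω.1 (1, t, .arm)) = some k at h2
      exact ⟨by simp [h1], by rw [h1, h2]⟩
  fin_cases j
  · exact h0
  · exact collides_comm.symm.trans h0

lemma unif_pick_compl (k : Fin K) :
    unif {u : ℝ | pick (Finset.univ : Finset (Fin K)) u = some k}ᶜ =
      ENNReal.ofReal (1 - 1 / K) := by
  rw [measure_compl (measurableSet_pick k) (measure_ne_top _ _), measure_univ, unif_pick,
    ENNReal.ofReal_sub _ (by positivity), ENNReal.ofReal_one]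

/-- The worst case is a present opponent, with probability `(1/K)(1 - 1/K) ≥ 1/(2K)`; an absent one
only enlarges the event. -/
lemma soloCoins_prob (hK : 2 ≤ K) (j : Fin 2) (k : Fin K) (t : ℕ) :
    1 / (2 * K) ≤ (coinLaw 2).real {x | armCoins t x ∈ soloCoins active j k t} := by
  have hK' : (2 : ℝ) ≤ K := by exact_mod_cast hK
  set A : Set ℝ := {u : ℝ | pick (Finset.univ : Finset (Fin K)) u = some k} with hA
  have hsub : {x | x (j, t, .arm) ∈ A ∧ x (1 - j, t, .arm) ∈ Aᶜ} ⊆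
      {x | armCoins t x ∈ soloCoins active j k t} :=
    fun x hx => ⟨hx.1, fun h => hx.2 h.2⟩
  have hinv : (1 : ℝ) / K ≤ 1 / 2 := one_div_le_one_div_of_le (by norm_num) hK'
  have hpos : (0 : ℝ) < 1 / K := by positivity
  have hprob : coinLaw 2 {x | x (j, t, .arm) ∈ A ∧ x (1 - j, t, .arm) ∈ Aᶜ} =
      ENNReal.ofReal (1 / K * (1 - 1 / K)) := by
    rw [ENNReal.ofReal_mul hpos.le, ← unif_pick k, ← unif_pick_compl k]
    have hAm : MeasurableSet A := measurableSet_pick k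
    fin_cases j
    · exact armCoins_pair hAm hAm.compl t
    · rw [mul_comm, ← armCoins_pair hAm.compl hAm t]
      congr 1
      ext x
      exact and_comm
  have h1 : (coinLaw 2).real {x | x (j, t, .arm) ∈ A ∧ x (1 - j, t, .arm) ∈ Aᶜ} =
      1 / K * (1 - 1 / K) := by
    rw [Measure.real, hprob, ENNReal.toReal_ofReal (mul_nonneg hpos.le (by linarith))]
  refine le_trans ?_ (measureReal_mono hsub)
  rw [h1, show (1 : ℝ) / (2 * K) = 1 / K * (1 / 2) by field_simp]
  exact mul_le_mul_of_nonneg_left (by linarith) hpos.le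

lemma collisionCoins_prob (hK : 2 ≤ K) (t : ℕ) :
    (coinLaw 2).real {x | armCoins t x ∈ collisionCoins K} = 1 / K := by
  have hK' : (2 : ℝ) ≤ K := by exact_mod_cast hK
  have hU : {x : Fin 2 × ℕ × Coin → ℝ | armCoins t x ∈ collisionCoins K} =
      ⋃ k : Fin K, {x | x (0, t, .arm) ∈ {u : ℝ | pick (Finset.univ : Finset (Fin K)) u = some k} ∧
        x (1, t, .arm) ∈ {u : ℝ | pick (Finset.univ : Finset (Fin K)) u = some k}} := by
    ext x
    simp [collisionCoins, armCoins]
  have hk : ∀ k : Fin K, coinLaw 2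
      {x | x (0, t, .arm) ∈ {u : ℝ | pick (Finset.univ : Finset (Fin K)) u = some k} ∧
        x (1, t, .arm) ∈ {u : ℝ | pick (Finset.univ : Finset (Fin K)) u = some k}} =
      ENNReal.ofReal (1 / K * (1 / K)) := fun k => by
    rw [armCoins_pair (measurableSet_pick k) (measurableSet_pick k), unif_pick,
      ← ENNReal.ofReal_mul (by positivity)]
  have hm : ∀ (j : Fin 2) (k : Fin K), MeasurableSet {x : Fin 2 × ℕ × Coin → ℝ |
      x (j, t, .arm) ∈ {u : ℝ | pick (Finset.univ : Finset (Fin K)) u = some k}} := fun j k =>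
    (measurable_pi_apply (j, t, Coin.arm)) (measurableSet_pick k)
  rw [Measure.real, hU, measure_iUnion]
  · simp only [hk]
    rw [tsum_fintype, Finset.sum_const, Finset.card_univ, Fintype.card_fin, nsmul_eq_mul,
      ENNReal.toReal_mul, ENNReal.toReal_natCast, ENNReal.toReal_ofReal (by positivity)]
    field_simp
  · intro k l hkl
    rw [Function.onFun, Set.disjoint_left]
    rintro x ⟨h1, _⟩ ⟨h2, _⟩
    exact hkl (Option.some.inj (h1.symm.trans h2))
  · exact fun k => (hm 0 k).inter (hm 1 k)

/-- The empirical mean of arm `k` of player `j` is inaccurate in the rounds of `I`. -/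
def estimateBad (active : Fin 2 → ℕ → Prop) (ν : Fin K → Measure ℝ) (η : ℝ) (I : Finset ℕ)
    (j : Fin 2) (k : Fin K) : Set (Sample 2 K) :=
  {ω | η * ∑ t ∈ I, (soloCoins active j k t).indicator (fun _ => (1 : ℝ)) (armCoins t ω.1) ≤
    |∑ t ∈ I, (soloCoins active j k t).indicator (fun _ => (1 : ℝ)) (armCoins t ω.1) *
      (ω.2 (t, k) - mean ν k)|}

lemma measurableSet_estimateBad (η : ℝ) (I : Finset ℕ) (j : Fin 2) (k : Fin K) :
    MeasurableSet (estimateBad active ν η I j k) := by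
  have h : ∀ t, Measurable fun ω : Sample 2 K =>
      (soloCoins active j k t).indicator (fun _ => (1 : ℝ)) (armCoins t ω.1) := fun t =>
    (measurable_const.indicator (measurableSet_soloCoins j k t)).comp
      ((measurable_armCoins t).comp measurable_fst)
  exact measurableSet_le ((Finset.measurable_sum _ fun t _ => h t).const_mul η)
    (Finset.measurable_sum _ fun t _ => (h t).mul ((measurable_table t k).sub_const _)).abs

/-- Given the coins, Hoeffding bounds the failure by `2 exp (-ε² n / 2)`, where `n` is the number of
solo rounds. Averaging over the coins by `lintegral_exp_count` with `s = ε² / 2` and `p = 1 / (2K)`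
replaces `n` by a multiple of its mean, with no separate event that `n` is large. -/
lemma estimateBad_prob (hK : 2 ≤ K) (hν : ∀ k, IsProbabilityMeasure (ν k))
    (hs : ∀ k, ∀ᵐ x ∂(ν k), x ∈ Set.Icc (0 : ℝ) 1) (hε0 : 0 ≤ ε) (hε1 : ε ≤ 1) (I : Finset ℕ)
    (j : Fin 2) (k : Fin K) :
    law 2 ν (estimateBad active ν (ε / 2) I j k) ≤
      ENNReal.ofReal (2 * Real.exp (-(ε ^ 2 * I.card / (8 * K)))) := by
  classical
  rw [law, Measure.prod_apply (measurableSet_estimateBad _ _ _ _)]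
  have hsec : ∀ x : Fin 2 × ℕ × Coin → ℝ,
      (Measure.infinitePi fun i : ℕ × Fin K => ν i.2)
        (Prod.mk x ⁻¹' estimateBad active ν (ε / 2) I j k) ≤
      ENNReal.ofReal 2 * ENNReal.ofReal (Real.exp (-(ε ^ 2 / 2 * ∑ t ∈ I,
        (soloCoins active j k t).indicator (fun _ => (1 : ℝ)) fun j => x (j, t, .arm)))) := by
    intro x
    have h1 := table_deviation hs k (I.filter fun t => armCoins t x ∈ soloCoins active j k t)
      (η := ε / 2) (by linarith)
    have hcard : ∑ t ∈ I, (soloCoins active j k t).indicator (fun _ => (1 : ℝ)) (armCoins t x) =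
        ((I.filter fun t => armCoins t x ∈ soloCoins active j k t).card : ℝ) := by
      simp [Set.indicator_apply]
    have hsum : ∀ r : ℕ × Fin K → ℝ,
        ∑ t ∈ I, (soloCoins active j k t).indicator (fun _ => (1 : ℝ)) (armCoins t x) *
          (r (t, k) - mean ν k) =
        ∑ t ∈ I.filter fun t => armCoins t x ∈ soloCoins active j k t, (r (t, k) - mean ν k) := by
      intro r
      rw [Finset.sum_filter]
      refine Finset.sum_congr rfl fun t _ => ?_
      rw [Set.indicator_apply]
      split_ifs <;> simp
    rw [← ENNReal.ofReal_mul (by norm_num)]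
    refine le_trans (le_of_eq ?_) (h1.trans (le_of_eq ?_))
    · congr 1
      ext r
      simp only [estimateBad, Set.mem_preimage, Set.mem_ofPred_eq, hcard, hsum]
    · rw [← hcard]
      congr 3
      change _ = -(ε ^ 2 / 2 * ∑ t ∈ I,
        (soloCoins active j k t).indicator (fun _ => (1 : ℝ)) (armCoins t x))
      ring
  refine (lintegral_mono hsec).trans ?_
  rw [lintegral_const_mul']
  · rw [ENNReal.ofReal_mul (by norm_num)]
    refine mul_le_mul_right ((lintegral_exp_count (fun t => measurableSet_soloCoins j k t)
      (p := 1 / (2 * K)) (by positivity) (by nlinarith) I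
      fun t _ => soloCoins_prob hK j k t).trans (le_of_eq ?_)) _
    congr 3
    field_simp
    ring
  · exact ENNReal.ofReal_ne_top

/-- The number of collisions of two exploring players is far from its expectation. -/
def collisionsBad (K : ℕ) (η : ℝ) (I : Finset ℕ) : Set (Sample 2 K) :=
  {ω | η * I.card ≤ |∑ t ∈ I,
    ((collisionCoins K).indicator (fun _ => (1 : ℝ)) (armCoins t ω.1) - 1 / K)|}

lemma collisionsBad_prob (hK : 2 ≤ K) (hν : ∀ k, IsProbabilityMeasure (ν k)) (I : Finset ℕ)
    {η : ℝ} (hη : 0 ≤ η) :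
    law 2 ν (collisionsBad K η I) ≤ ENNReal.ofReal (2 * Real.exp (-2 * η ^ 2 * I.card)) := by
  have hprob : ∀ i : ℕ × Fin K, IsProbabilityMeasure (ν i.2) := fun i => hν i.2
  have hg : Measurable ((collisionCoins K).indicator fun _ => (1 : ℝ)) :=
    measurable_const.indicator (measurableSet_collisionCoins K)
  have hX : ∀ t, Measurable fun x => (collisionCoins K).indicator (fun _ => (1 : ℝ))
      (armCoins t x) := fun t => hg.comp (measurable_armCoins t)
  have hind : iIndepFun (fun (t : ℕ) (x : Fin 2 × ℕ × Coin → ℝ) =>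
      (collisionCoins K).indicator (fun _ => (1 : ℝ)) (armCoins t x)) (coinLaw 2) :=
    (iIndepFun_armCoins 2).comp (fun _ => (collisionCoins K).indicator fun _ => (1 : ℝ))
      fun _ => hg
  have h := hoeffding_two_sided hind hX
    (fun t => Filter.Eventually.of_forall fun x => by
      classical
      rw [Set.indicator_apply]; split_ifs <;> simp) (m := 1 / K) I (fun t _ => by
      have hm : MeasurableSet {x | armCoins t x ∈ collisionCoins K} :=
        measurable_armCoins t (measurableSet_collisionCoins K)
      rw [← collisionCoins_prob hK t, ← integral_indicator_one hm]
      rfl) hη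
  refine le_trans (le_of_eq ?_) h
  have hms : MeasurableSet {x : Fin 2 × ℕ × Coin → ℝ | η * I.card ≤ |∑ t ∈ I,
      ((collisionCoins K).indicator (fun _ => (1 : ℝ)) (armCoins t x) - 1 / K)|} :=
    measurableSet_le measurable_const
      (Finset.measurable_sum _ fun t _ => (hX t).sub_const _).abs
  exact (measurePreserving_fst (μ := coinLaw 2)
    (ν := Measure.infinitePi fun i : ℕ × Fin K => ν i.2)).measure_preimage hms.nullMeasurableSet

/-- Accurate empirical means give a correct ranking. -/
lemma epsCorrect_of_close {v est : Fin K → ℝ} (h : ∀ k, |est k - v k| < ε / 2) :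
    EpsCorrect v ε est := by
  intro i j hij
  refine ranking_symm_lt ?_
  have h1 := (abs_lt.1 (h i)).1
  have h2 := (abs_lt.1 (h j)).2
  linarith

lemma est_close (h₀ : 1 ≤ T₀) (hT : T₀ < T₁) {m : ℕ} {j : Fin 2} {k : Fin K}
    (hact : ∀ t ∈ Finset.Icc (m * T₁ + 1) (m * T₁ + T₀), active j t)
    (h : ω ∉ estimateBad active ν (ε / 2) (Finset.Icc (m * T₁ + 1) (m * T₁ + T₀)) j k) :
    |(dmcState T₀ T₁ active ω (m * T₁ + T₀) j).est k - mean ν k| < ε / 2 := by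
  classical
  obtain ⟨-, -, -, hobs, hsum⟩ := dmc_learning (ω := ω) (K := K) h₀ hT hact
  set I := Finset.Icc (m * T₁ + 1) (m * T₁ + T₀) with hI
  set n : ℝ := ∑ t ∈ I, (soloCoins active j k t).indicator (fun _ => (1 : ℝ)) (armCoins t ω.1)
    with hn
  have hobs' : ((dmcState T₀ T₁ active ω (m * T₁ + T₀) j).obs k : ℝ) = n := by
    rw [hobs k, hn, Nat.cast_sum]
    refine Finset.sum_congr rfl fun t ht => ?_
    rw [Set.indicator_apply]
    simp only [solo_iff hT ht (hact t ht)]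
    split_ifs <;> simp
  have hsum' : ∑ t ∈ I, (soloCoins active j k t).indicator (fun _ => (1 : ℝ)) (armCoins t ω.1) *
      (ω.2 (t, k) - mean ν k) =
      (dmcState T₀ T₁ active ω (m * T₁ + T₀) j).sum k - n * mean ν k := by
    rw [hsum k, hn, Finset.sum_mul, ← Finset.sum_sub_distrib]
    refine Finset.sum_congr rfl fun t ht => ?_
    rw [Set.indicator_apply]
    simp only [solo_iff hT ht (hact t ht)]
    split_ifs <;> ring
  have h' : |(dmcState T₀ T₁ active ω (m * T₁ + T₀) j).sum k - n * mean ν k| < ε / 2 * n := by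
    rw [← hsum']
    exact not_le.1 h
  have hn0 : 0 ≤ n := Finset.sum_nonneg fun t _ => Set.indicator_nonneg (fun _ _ => zero_le_one) _
  -- The strict inequality `h'` is impossible for `n = 0`, so outside the bad event every arm has
  -- been observed.
  have hnpos : 0 < n := by
    rcases hn0.lt_or_eq with h1 | h1
    · exact h1
    · rw [← h1] at h'
      simp only [mul_zero] at h'
      exact absurd h' (not_lt.2 (abs_nonneg _))
  rw [DMCState.est, hobs', div_sub' hnpos.ne', abs_div, abs_of_pos hnpos, div_lt_iff₀ hnpos]
  exact h'

lemma colls_close (h₀ : 1 ≤ T₀) (hT : T₀ < T₁) {m : ℕ} {j : Fin 2} {η : ℝ}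
    (hact : ∀ j, ∀ t ∈ Finset.Icc (m * T₁ + 1) (m * T₁ + T₀), active j t)
    (h : ω ∉ collisionsBad K η (Finset.Icc (m * T₁ + 1) (m * T₁ + T₀))) :
    |((dmcState T₀ T₁ active ω (m * T₁ + T₀) j).colls : ℝ) - T₀ * (1 / K)| < η * T₀ := by
  classical
  obtain ⟨-, -, hcolls, -⟩ := dmc_learning (ω := ω) (K := K) h₀ hT (hact j)
  have hcard : (Finset.Icc (m * T₁ + 1) (m * T₁ + T₀)).card = T₀ := by
    rw [Nat.card_Icc]; omega
  have h' : |∑ t ∈ Finset.Icc (m * T₁ + 1) (m * T₁ + T₀),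
      ((collisionCoins K).indicator (fun _ => (1 : ℝ)) (armCoins t ω.1) - 1 / K)| <
      η * (Finset.Icc (m * T₁ + 1) (m * T₁ + T₀)).card := not_le.1 h
  rw [Finset.sum_sub_distrib, Finset.sum_const, hcard, nsmul_eq_mul] at h'
  convert h' using 3
  rw [hcolls, Nat.cast_sum]
  refine Finset.sum_congr rfl fun t ht => ?_
  rw [Set.indicator_apply]
  simp only [collides_learning_iff hT ht fun i => hact i t ht]
  split_ifs <;> simp

lemma colls_eq_zero (h₀ : 1 ≤ T₀) (hT : T₀ < T₁) {m : ℕ} {j : Fin 2}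
    (hact : ∀ t ∈ Finset.Icc (m * T₁ + 1) (m * T₁ + T₀), active j t)
    (hother : ∀ t ∈ Finset.Icc (m * T₁ + 1) (m * T₁ + T₀), ¬ active (1 - j) t) :
    (dmcState T₀ T₁ active ω (m * T₁ + T₀) j).colls = 0 := by
  classical
  obtain ⟨-, -, hcolls, -⟩ := dmc_learning (ω := ω) (K := K) h₀ hT hact
  rw [hcolls]
  refine Finset.sum_eq_zero fun t ht => if_neg fun hc => ?_
  rw [collides_iff, played_of_not_active (hother t ht)] at hc
  exact hc.1 hc.2.symm

lemma numActive_eq_two {t : ℕ} (h : ∀ j, active j t) : numActive active t = 2 := by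
  rw [numActive_two, if_pos (h 0), if_pos (h 1)]

lemma numActive_eq_one {j : Fin 2} {t : ℕ} (h : active j t) (h' : ¬ active (1 - j) t) :
    numActive active t = 1 := by
  rw [numActive_two]
  obtain rfl | rfl : j = 0 ∨ j = 1 := by omega
  · change ¬ active 1 t at h'
    rw [if_pos h, if_neg h']
  · change ¬ active 0 t at h'
    rw [if_pos h, if_neg h']

/-- A lone player has no collisions and needs no event for `N* = 1`; the collision count matters for
two players only. Epochs completing their learning phase by round `T` have index below `T`, a crude
count that the logarithm in `T₀` pays for. -/
lemma dmcGood_compl_subset (hK : 2 ≤ K) (h₀ : 1 ≤ T₀) (hT : T₀ < T₁) (T : ℕ) :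
    (dmcGood T₀ T₁ T ε active ν)ᶜ ⊆ ⋃ m ∈ Finset.range T,
      ((⋃ j : Fin 2, ⋃ k : Fin K,
        estimateBad active ν (ε / 2) (Finset.Icc (m * T₁ + 1) (m * T₁ + T₀)) j k) ∪
      collisionsBad K (1 / (4 * K)) (Finset.Icc (m * T₁ + 1) (m * T₁ + T₀))) := by
  intro ω hω
  by_contra hc
  simp only [Set.mem_iUnion, Set.mem_union, not_exists, not_or, Finset.mem_range] at hc
  refine hω fun m hm j hact => ?_
  have hmT : m < T := by
    have : m * 1 ≤ m * T₁ := Nat.mul_le_mul_left _ (by omega)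
    omega
  obtain ⟨h1, h2⟩ := hc m hmT
  refine ⟨epsCorrect_of_close fun k => est_close h₀ hT hact (h1 j k), fun hsame => ?_⟩
  have hfirst : m * T₁ + 1 ∈ Finset.Icc (m * T₁ + 1) (m * T₁ + T₀) := by
    rw [Finset.mem_Icc]; omega
  by_cases ha : active (1 - j) (m * T₁ + 1)
  · have hall : ∀ i, active i (m * T₁ + 1) := by
      intro i
      have hj := hact _ hfirst
      fin_cases i <;> fin_cases j <;> first | exact ha | exact hj
    rw [numActive_eq_two hall]
    refine nStar_eq_two hK h₀ ?_
    exact colls_close h₀ hT (fun i t ht => (hsame i t ht).2 (hall i)) h2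
  · rw [numActive_eq_one (hact _ hfirst) ha]
    exact nStar_eq_one h₀ (colls_eq_zero h₀ hT hact fun t ht h => ha ((hsame _ t ht).1 h))

lemma dmcGood_compl_prob (hK : 2 ≤ K) (hν : ∀ k, IsProbabilityMeasure (ν k))
    (hs : ∀ k, ∀ᵐ x ∂(ν k), x ∈ Set.Icc (0 : ℝ) 1) (hε0 : 0 ≤ ε) (hε1 : ε ≤ 1)
    (h₀ : 1 ≤ T₀) (hT : T₀ < T₁) {T : ℕ} {p q : ℝ}
    (hp : 2 * Real.exp (-(ε ^ 2 * T₀ / (8 * K))) ≤ p)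
    (hq : 2 * Real.exp (-(T₀ / (8 * (K : ℝ) ^ 2))) ≤ q) :
    law 2 ν (dmcGood T₀ T₁ T ε active ν)ᶜ ≤ ENNReal.ofReal (T * (2 * K * p + q)) := by
  have hcard : ∀ m : ℕ, (Finset.Icc (m * T₁ + 1) (m * T₁ + T₀)).card = T₀ := fun m => by
    rw [Nat.card_Icc]; omega
  have hp0 : 0 ≤ p := le_trans (by positivity) hp
  have hq0 : 0 ≤ q := le_trans (by positivity) hq
  have hKpos : (0 : ℝ) < K := by exact_mod_cast (by omega : 0 < K)
  have hest : ∀ (m : ℕ) (j : Fin 2) (k : Fin K), law 2 ν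
      (estimateBad active ν (ε / 2) (Finset.Icc (m * T₁ + 1) (m * T₁ + T₀)) j k) ≤
      ENNReal.ofReal p := fun m j k =>
    (estimateBad_prob hK hν hs hε0 hε1 _ j k).trans (ENNReal.ofReal_le_ofReal (by rwa [hcard]))
  have hcol : ∀ m : ℕ, law 2 ν
      (collisionsBad K (1 / (4 * K)) (Finset.Icc (m * T₁ + 1) (m * T₁ + T₀))) ≤
      ENNReal.ofReal q := fun m => by
    refine (collisionsBad_prob hK hν _ (by positivity)).trans (ENNReal.ofReal_le_ofReal ?_)
    rw [hcard]
    refine le_trans (le_of_eq ?_) hq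
    congr 2
    field_simp
    ring
  refine (measure_mono (dmcGood_compl_subset hK h₀ hT T)).trans ?_
  refine (measure_biUnion_finset_le _ _).trans ?_
  have hm : ∀ m ∈ Finset.range T, law 2 ν
      ((⋃ j : Fin 2, ⋃ k : Fin K,
        estimateBad active ν (ε / 2) (Finset.Icc (m * T₁ + 1) (m * T₁ + T₀)) j k) ∪
      collisionsBad K (1 / (4 * K)) (Finset.Icc (m * T₁ + 1) (m * T₁ + T₀))) ≤
      ENNReal.ofReal (2 * K * p + q) := by
    intro m _
    rw [ENNReal.ofReal_add (by positivity) hq0]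
    refine (measure_union_le _ _).trans (add_le_add ?_ (hcol m))
    calc _ ≤ ∑ j : Fin 2, ∑ k : Fin K, ENNReal.ofReal p :=
          (measure_iUnion_fintype_le _ _).trans (Finset.sum_le_sum fun j _ =>
            (measure_iUnion_fintype_le _ _).trans (Finset.sum_le_sum fun k _ => hest m j k))
      _ = ENNReal.ofReal (2 * K * p) := by
          simp only [Finset.sum_const, Finset.card_univ, Fintype.card_fin, nsmul_eq_mul]
          rw [ENNReal.ofReal_mul (by positivity), ENNReal.ofReal_mul (by norm_num),
            ENNReal.ofReal_natCast, ← mul_assoc]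
          simp
  refine (Finset.sum_le_sum hm).trans (le_of_eq ?_)
  rw [Finset.sum_const, Finset.card_range, nsmul_eq_mul, ENNReal.ofReal_mul (by positivity),
    ENNReal.ofReal_natCast]

lemma measurableSet_dmcGood (T : ℕ) : MeasurableSet (dmcGood T₀ T₁ T ε active ν) := by
  have hM := fun t j => (measurableStates_dmc K 2 T₀ T₁).states active t j
  unfold dmcGood
  refine measurableSet_setOfPred.2 (Measurable.forall fun m => Measurable.forall fun _ =>
    Measurable.forall fun j => Measurable.forall fun _ => Measurable.and ?_ ?_)
  · unfold EpsCorrect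
    refine Measurable.forall fun i => Measurable.forall fun l => Measurable.forall fun _ => ?_
    exact (Measurable.of_discrete (f := fun σ : Equiv.Perm (Fin K) => σ.symm i < σ.symm l)).comp
      (measurable_ranking (hM _ j).est)
  · refine Measurable.forall fun _ => measurableSet_setOfPred.1 ?_
    exact measurableSet_eq_fun ((hM _ j).nStar T₀) measurable_const

end Learning

end

end MultiBandit

namespace MultiBandit

noncomputable section

/-! ### The length of the learning phase -/

section Phase

variable {K T : ℕ} {ε δ : ℝ}

lemma le_dmcT₀ (K : ℕ) (ε δ : ℝ) (T : ℕ) :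
    16 * (K : ℝ) / ε ^ 2 * Real.log (4 * (K : ℝ) ^ 2 / (δ / (2 * T))) ≤ dmcT₀ K ε δ T ∧
      (K : ℝ) ^ 2 * Real.log (4 * T / δ) / 0.02 ≤ dmcT₀ K ε δ T :=
  ⟨le_trans ((le_max_right _ _).trans (le_max_left _ _)) (Nat.le_ceil _),
    le_trans (le_max_right _ _) (Nat.le_ceil _)⟩

lemma dmcT₀_pos (hK : 2 ≤ K) (hδ0 : 0 < δ) (hδ1 : δ < 1) (hT : 2 ≤ T) :
    1 ≤ dmcT₀ K ε δ T := by
  have hT' : (2 : ℝ) ≤ T := by exact_mod_cast hT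
  have hK' : (2 : ℝ) ≤ K := by exact_mod_cast hK
  have hlog : 0 < Real.log (4 * T / δ) := Real.log_pos (by rw [lt_div_iff₀ hδ0]; linarith)
  have h : (0 : ℝ) < dmcT₀ K ε δ T := lt_of_lt_of_le (by positivity) (le_dmcT₀ K ε δ T).2
  exact_mod_cast h

lemma dmcT₀_rewards (hK : 2 ≤ K) (hε : 0 < ε) (hδ0 : 0 < δ) (hδ1 : δ < 1) (hT : 2 ≤ T) :
    2 * Real.exp (-(ε ^ 2 * dmcT₀ K ε δ T / (8 * K))) ≤ δ / (4 * (K : ℝ) ^ 2 * T) := by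
  have hT' : (2 : ℝ) ≤ T := by exact_mod_cast hT
  have hK' : (2 : ℝ) ≤ K := by exact_mod_cast hK
  have h := (le_dmcT₀ K ε δ T).1
  set z : ℝ := 4 * (K : ℝ) ^ 2 / (δ / (2 * T)) with hz
  have hz1 : 1 ≤ z := by
    rw [hz, div_div_eq_mul_div, le_div_iff₀ hδ0]
    nlinarith
  have hlog := Real.log_nonneg hz1
  have h2 : Real.log z ≤ ε ^ 2 * dmcT₀ K ε δ T / (8 * K) := by
    rw [le_div_iff₀ (by positivity)]
    calc Real.log z * (8 * K) ≤ ε ^ 2 * (16 * (K : ℝ) / ε ^ 2 * Real.log z) := by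
          rw [show ε ^ 2 * (16 * (K : ℝ) / ε ^ 2 * Real.log z) = 16 * K * Real.log z by
            field_simp]
          nlinarith
      _ ≤ _ := mul_le_mul_of_nonneg_left h (by positivity)
  calc 2 * Real.exp (-(ε ^ 2 * dmcT₀ K ε δ T / (8 * K))) ≤ 2 * Real.exp (-Real.log z) := by gcongr
    _ = δ / (4 * (K : ℝ) ^ 2 * T) := by
      rw [Real.exp_neg, Real.exp_log (by linarith), hz]
      field_simp

lemma dmcT₀_collisions (hK : 2 ≤ K) (hδ0 : 0 < δ) (hδ1 : δ < 1) (hT : 2 ≤ T) :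
    2 * Real.exp (-(dmcT₀ K ε δ T / (8 * (K : ℝ) ^ 2))) ≤ δ / (2 * T) := by
  have hT' : (2 : ℝ) ≤ T := by exact_mod_cast hT
  have hK' : (2 : ℝ) ≤ K := by exact_mod_cast hK
  have h := (le_dmcT₀ K ε δ T).2
  set z : ℝ := 4 * T / δ with hz
  have hz1 : 1 ≤ z := by
    rw [hz, le_div_iff₀ hδ0]
    linarith
  have hlog := Real.log_nonneg hz1
  have h2 : Real.log z ≤ dmcT₀ K ε δ T / (8 * (K : ℝ) ^ 2) := by
    rw [le_div_iff₀ (by positivity)]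
    refine le_trans ?_ h
    rw [le_div_iff₀ (by norm_num)]
    nlinarith [mul_nonneg (sq_nonneg (K : ℝ)) hlog]
  calc 2 * Real.exp (-(dmcT₀ K ε δ T / (8 * (K : ℝ) ^ 2))) ≤ 2 * Real.exp (-Real.log z) := by
        gcongr
    _ = δ / (2 * T) := by
      rw [Real.exp_neg, Real.exp_log (by linarith), hz]
      field_simp
      norm_num

lemma le_log_horizon (hδ0 : 0 < δ) (hδ1 : δ < 1) (hT : 2 ≤ T) : 0.69 ≤ Real.log (T / δ) := by
  have hT' : (2 : ℝ) ≤ T := by exact_mod_cast hT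
  have : Real.log 2 ≤ Real.log (T / δ) :=
    Real.log_le_log (by norm_num) (by rw [le_div_iff₀ hδ0]; linarith)
  linarith [Real.log_two_gt_d9]

/-- All three terms are at most a constant times `x² L` with `x = K / ε`, and `L ≤ 5 x ℓ`. Finally
`336 = 67 * 5 + 1`, the last unit covering the ceiling since `x³ ℓ ≥ 1`. -/
lemma dmcT₀_le (hK : 2 ≤ K) (hε : 0 < ε) (hε1 : ε ≤ 1) (hδ0 : 0 < δ) (hδ1 : δ < 1) (hT : 2 ≤ T) :
    (dmcT₀ K ε δ T : ℝ) ≤ 336 * (K / ε) ^ 3 * Real.log (T / δ) := by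
  have hT' : (2 : ℝ) ≤ T := by exact_mod_cast hT
  have hK' : (2 : ℝ) ≤ K := by exact_mod_cast hK
  have hℓ := le_log_horizon hδ0 hδ1 hT
  set ℓ := Real.log (T / δ) with hℓdef
  set x : ℝ := K / ε with hx
  have hKx : (K : ℝ) ≤ x := by rw [hx, le_div_iff₀ hε]; nlinarith
  have hx2 : 2 ≤ x := hK'.trans hKx
  have hKε : (K : ℝ) / ε ^ 2 ≤ x ^ 2 := by
    rw [hx, div_pow]
    gcongr
    nlinarith
  have hKK : (K : ℝ) ^ 2 ≤ x ^ 2 := by gcongr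
  set L : ℝ := Real.log (4 * (K : ℝ) ^ 2 / (δ / (2 * T))) with hL
  have hLeq : L = 3 * Real.log 2 + 2 * Real.log K + ℓ := by
    rw [hL, hℓdef, show 4 * (K : ℝ) ^ 2 / (δ / (2 * T)) = 2 ^ 3 * (K : ℝ) ^ 2 * (T / δ) by
      field_simp; norm_num, Real.log_mul (by positivity) (by positivity),
      Real.log_mul (by positivity) (by positivity), Real.log_pow, Real.log_pow]
    norm_num
  have hLle : L ≤ 5 * x * ℓ := by
    have h1 : Real.log K ≤ K - 1 := Real.log_le_sub_one_of_pos (by linarith)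
    have h2 := Real.log_two_lt_d9
    rw [hLeq]
    nlinarith
  have hL1 : Real.log (2 * (K : ℝ) ^ 2 / (δ / (2 * T))) ≤ L := by
    refine Real.log_le_log (by positivity) ?_
    gcongr
    norm_num
  have hL2 : Real.log (4 * T / δ) ≤ L := by
    refine Real.log_le_log (by positivity) ?_
    rw [div_div_eq_mul_div]
    gcongr <;> nlinarith
  have hL0 : 0 ≤ L := by
    have := Real.log_nonneg (by linarith : (1 : ℝ) ≤ K)
    have := Real.log_two_gt_d9
    rw [hLeq]
    linarith
  have hlog0 : 0 ≤ Real.log (4 * T / δ) := Real.log_nonneg (by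
    rw [le_div_iff₀ hδ0]
    linarith)
  have hmax : max (max ((K : ℝ) / 2 * Real.log (2 * (K : ℝ) ^ 2 / (δ / (2 * T))))
      (16 * (K : ℝ) / ε ^ 2 * L)) ((K : ℝ) ^ 2 * Real.log (4 * T / δ) / 0.02) ≤
      67 * x ^ 2 * L := by
    have hxL : 0 ≤ x ^ 2 * L := by positivity
    refine max_le (max_le ?_ ?_) ?_
    · calc (K : ℝ) / 2 * Real.log (2 * (K : ℝ) ^ 2 / (δ / (2 * T))) ≤ x ^ 2 * L := by
            refine mul_le_mul ?_ hL1 (Real.log_nonneg ?_) (by positivity)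
            · nlinarith
            · rw [div_div_eq_mul_div, le_div_iff₀ hδ0]
              nlinarith
        _ ≤ _ := by linarith
    · calc 16 * (K : ℝ) / ε ^ 2 * L = 16 * (K / ε ^ 2 * L) := by ring
        _ ≤ 16 * (x ^ 2 * L) := by gcongr
        _ ≤ _ := by linarith
    · calc (K : ℝ) ^ 2 * Real.log (4 * T / δ) / 0.02 = 50 * (K ^ 2 * Real.log (4 * T / δ)) := by ring
        _ ≤ 50 * (x ^ 2 * L) := by gcongr
        _ ≤ _ := by linarith
  calc (dmcT₀ K ε δ T : ℝ) ≤ 67 * x ^ 2 * L + 1 := by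
        refine (Nat.ceil_lt_add_one ?_).le.trans (add_le_add_left hmax 1)
        exact le_max_of_le_left (le_max_of_le_right (by positivity))
    _ ≤ 67 * x ^ 2 * (5 * x * ℓ) + 1 := by gcongr
    _ ≤ 336 * x ^ 3 * ℓ := by
        have h3 : 8 ≤ x ^ 3 := by
          calc (8 : ℝ) = 2 ^ 3 := by norm_num
            _ ≤ x ^ 3 := by gcongr
        nlinarith

/-- The failure probabilities sum to `δ / (2K) + δ / 2`. The slack from `3/4` to `1` matters: for
every `δ < 1` the good event has probability at least `1/4`, so conditioning on it costs a bounded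
factor, which the bound `1 - δ` would not give. -/
lemma dmcGood_prob {ν : Fin K → Measure ℝ} {a₁ a₂ : Fin K} (hK : 2 ≤ K) (hε : 0 < ε)
    (hε1 : ε ≤ 1) (hI : Instance ν a₁ a₂ ε) (hδ0 : 0 < δ) (hδ1 : δ < 1) (hT : 2 ≤ T) {T₁ : ℕ}
    (hT₁ : dmcT₀ K ε δ T < T₁) (active : Fin 2 → ℕ → Prop) :
    1 - 3 / 4 * δ ≤ (law 2 ν).real (dmcGood (dmcT₀ K ε δ T) T₁ T ε active ν) := by
  have := law_isProbabilityMeasure (N := 2) hI.prob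
  have hT' : (2 : ℝ) ≤ T := by exact_mod_cast hT
  have hK' : (2 : ℝ) ≤ K := by exact_mod_cast hK
  have h := dmcGood_compl_prob (active := active) hK hI.prob hI.supp hε.le hε1
    (dmcT₀_pos hK hδ0 hδ1 hT) hT₁ (T := T) (dmcT₀_rewards hK hε hδ0 hδ1 hT)
    (dmcT₀_collisions hK hδ0 hδ1 hT)
  have hle : (T : ℝ) * (2 * K * (δ / (4 * (K : ℝ) ^ 2 * T)) + δ / (2 * T)) ≤ 3 / 4 * δ := by
    have e : (T : ℝ) * (2 * K * (δ / (4 * (K : ℝ) ^ 2 * T)) + δ / (2 * T)) =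
        δ / 2 * (1 / K) + δ / 2 := by field_simp; ring
    have : (1 : ℝ) / K ≤ 1 / 2 := one_div_le_one_div_of_le (by norm_num) hK'
    rw [e]
    nlinarith
  have h2 : (law 2 ν).real (dmcGood (dmcT₀ K ε δ T) T₁ T ε active ν)ᶜ ≤ 3 / 4 * δ :=
    ENNReal.toReal_le_of_le_ofReal (by positivity) (h.trans (ENNReal.ofReal_le_ofReal hle))
  rw [probReal_compl_eq_one_sub (measurableSet_dmcGood T)] at h2
  linarith

end Phase

/-! ### The expected regret of DMC -/

section Expectation

variable {K : ℕ} {T₀ T₁ T : ℕ} {active : Fin 2 → ℕ → Prop} {ν : Fin K → Measure ℝ} {a₁ a₂ : Fin K}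
  {ε : ℝ}

lemma ae_armCoins_mem (hν : ∀ k, IsProbabilityMeasure (ν k)) :
    ∀ᵐ ω ∂(law 2 ν), ∀ (j : Fin 2) (s : ℕ), ω.1 (j, s, .arm) ∈ Set.Ico (0 : ℝ) 1 := by
  have : ∀ i : ℕ × Fin K, IsProbabilityMeasure (ν i.2) := fun i => hν i.2
  rw [ae_all_iff]
  intro j
  rw [ae_all_iff]
  intro s
  have h1 := (measurePreserving_eval_infinitePi (fun _ : Fin 2 × ℕ × Coin => unif)
    (j, s, .arm)).quasiMeasurePreserving.ae ae_unif
  exact (measurePreserving_fst (μ := coinLaw 2)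
    (ν := Measure.infinitePi fun i : ℕ × Fin K => ν i.2)).quasiMeasurePreserving.ae h1

lemma law_sameHalf (hν : ∀ k, IsProbabilityMeasure (ν k)) (I : Finset ℕ) :
    MeasurableSet {ω : Sample 2 K | ∀ s ∈ I, SameHalf ω s} ∧
      law 2 ν {ω | ∀ s ∈ I, SameHalf ω s} = ENNReal.ofReal ((1 / 2) ^ I.card) := by
  have : ∀ i : ℕ × Fin K, IsProbabilityMeasure (ν i.2) := fun i => hν i.2
  have hm : MeasurableSet {x : Fin 2 × ℕ × Coin → ℝ |
      ∀ t ∈ I, (x (0, t, .arm) < 1 / 2 ↔ x (1, t, .arm) < 1 / 2)} := by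
    refine measurableSet_setOfPred.2 (Measurable.forall fun t => Measurable.forall fun _ =>
      Measurable.iff ?_ ?_) <;>
      exact measurableSet_setOfPred.1 (measurableSet_lt (measurable_pi_apply _) measurable_const)
  refine ⟨measurable_fst hm, ?_⟩
  rw [← sameHalf_prob I]
  exact (measurePreserving_fst (μ := coinLaw 2)
    (ν := Measure.infinitePi fun i : ℕ × Fin K => ν i.2)).measure_preimage hm.nullMeasurableSet

lemma integrable_roundRegret {alg : Algorithm K} {Q : (Sample 2 K → alg.State) → Prop}
    (hM : MeasurableStates alg 2 Q) (active : Fin 2 → ℕ → Prop) (hK : 2 ≤ K) (hε : 0 ≤ ε)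
    (hI : Instance ν a₁ a₂ ε) (t : ℕ) (P : Measure (Sample 2 K)) [IsFiniteMeasure P] :
    Integrable (roundRegret alg active ν t) P :=
  Integrable.of_mem_Icc 0 2 (hM.roundRegret active ν t).aemeasurable
    (Filter.Eventually.of_forall fun _ => roundRegret_mem hK hε hI)

lemma integral_roundRegret_le_two {alg : Algorithm K} {Q : (Sample 2 K → alg.State) → Prop}
    (hM : MeasurableStates alg 2 Q) (hK : 2 ≤ K) (hε : 0 ≤ ε)
    (hI : Instance ν a₁ a₂ ε) (t : ℕ) (P : Measure (Sample 2 K)) [IsProbabilityMeasure P] :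
    ∫ ω, roundRegret alg active ν t ω ∂P ≤ 2 := by
  calc ∫ ω, roundRegret alg active ν t ω ∂P ≤ ∫ _, (2 : ℝ) ∂P :=
        integral_mono (integrable_roundRegret hM active hK hε hI t P) (integrable_const _)
          fun _ => (roundRegret_mem hK hε hI).2
    _ = 2 := by simp

/-- On the good event the regret is at most `2` and vanishes unless all coin pairs since the
learning phase agreed. The good event is not independent of these coins, so the conditional
probability is only bounded by `4` times the unconditional one. -/
lemma integral_roundRegret_late (hK : 2 ≤ K) (h₀ : 1 ≤ T₀) (hT : T₀ < T₁) (hε : 0 ≤ ε)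
    (hI : Instance ν a₁ a₂ ε) {m i : ℕ} (hi : T₀ ≤ i) (hi' : i < T₁) (hiT : m * T₁ + i + 1 ≤ T)
    (hconst : ∀ j, ∀ s ∈ Finset.Icc (m * T₁ + 1) (m * T₁ + i + 1),
      (active j s ↔ active j (m * T₁ + 1)))
    (hgood : 1 / 4 ≤ (law 2 ν).real (dmcGood T₀ T₁ T ε active ν)) :
    ∫ ω, roundRegret (dmc K T₀ T₁) active ν (m * T₁ + i + 1) ω
      ∂((law 2 ν)[|dmcGood T₀ T₁ T ε active ν]) ≤ 8 * (1 / 2) ^ (i + 1 - T₀) := by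
  classical
  have := law_isProbabilityMeasure (N := 2) hI.prob
  set G := dmcGood T₀ T₁ T ε active ν with hG
  have hGm : MeasurableSet G := measurableSet_dmcGood T
  have hG0 : law 2 ν G ≠ 0 := by
    intro h
    rw [Measure.real, h] at hgood
    norm_num at hgood
  have hprob : IsProbabilityMeasure ((law 2 ν)[|G]) := cond_isProbabilityMeasure hG0
  set I := Finset.Icc (m * T₁ + T₀ + 1) (m * T₁ + i + 1) with hIdef
  obtain ⟨hDm, hD⟩ := law_sameHalf hI.prob I
  set D : Set (Sample 2 K) := {ω | ∀ s ∈ I, SameHalf ω s} with hDdef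
  have hcard : I.card = i + 1 - T₀ := by rw [hIdef, Nat.card_Icc]; omega
  have hle : ∀ᵐ ω ∂((law 2 ν)[|G]), roundRegret (dmc K T₀ T₁) active ν (m * T₁ + i + 1) ω ≤
      D.indicator (fun _ => (2 : ℝ)) ω := by
    filter_upwards [ae_cond_mem hGm, cond_absolutelyContinuous.ae_le (ae_armCoins_mem hI.prob)]
      with ω h1 h2
    rw [Set.indicator_apply]
    refine (dmc_roundRegret_le hK h₀ hT hε hI hi hi' hiT hconst h2 h1).trans (le_of_eq ?_)
    congr
  have hreal : ((law 2 ν)[|G]).real D ≤ 4 * (1 / 2) ^ (i + 1 - T₀) := by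
    have h1 : (law 2 ν).real (G ∩ D) ≤ (1 / 2) ^ (i + 1 - T₀) := by
      refine (measureReal_mono Set.inter_subset_right).trans (le_of_eq ?_)
      rw [Measure.real, hD, hcard, ENNReal.toReal_ofReal (by positivity)]
    rw [Measure.real, cond_apply hGm, ENNReal.toReal_mul, ENNReal.toReal_inv]
    have h2 : ((law 2 ν).real G)⁻¹ ≤ 4 := by
      rw [inv_le_comm₀ (by linarith) (by norm_num)]
      linarith
    exact mul_le_mul h2 h1 measureReal_nonneg (by norm_num)
  calc _ ≤ ∫ ω, D.indicator (fun _ => (2 : ℝ)) ω ∂((law 2 ν)[|G]) :=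
        integral_mono_ae (integrable_roundRegret (measurableStates_dmc K 2 T₀ T₁) active hK hε hI _ _)
          ((integrable_const _).indicator hDm) hle
    _ = ((law 2 ν)[|G]).real D * 2 := by
        rw [integral_indicator hDm, setIntegral_const, smul_eq_mul]
    _ ≤ _ := by linarith

end Expectation

/-! ### Summation over the epochs -/

section Epochs

lemma sum_range_mul (g : ℕ → ℝ) (M n : ℕ) :
    ∑ t ∈ Finset.range (M * n), g t = ∑ m ∈ Finset.range M, ∑ i ∈ Finset.range n, g (m * n + i) := by
  induction M with
  | zero => simp
  | succ M ih => rw [Nat.succ_mul, Finset.sum_range_add, ih, Finset.sum_range_succ]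

lemma sum_Icc_le_sum_epochs {F : ℕ → ℝ} {G : ℕ → ℕ → ℝ} {T n : ℕ} (hn : 0 < n)
    (hG : ∀ m i, 0 ≤ G m i)
    (hF : ∀ m i, i < n → m * n + i + 1 ≤ T → F (m * n + i + 1) ≤ G m i) :
    ∑ t ∈ Finset.Icc 1 T, F t ≤ ∑ m ∈ Finset.range (T / n + 1), ∑ i ∈ Finset.range n, G m i := by
  have h1 : ∑ t ∈ Finset.Icc 1 T, F t = ∑ t ∈ Finset.range T, F (t + 1) := by
    rw [Finset.range_eq_Ico, Finset.sum_Ico_add' (fun t => F t) 0 T 1]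
    rfl
  have h2 : ∀ t ∈ Finset.range T, F (t + 1) ≤ G (t / n) (t % n) := by
    intro t ht
    rw [Finset.mem_range] at ht
    have e := Nat.div_add_mod' t n
    have := hF (t / n) (t % n) (Nat.mod_lt _ hn) (by omega)
    rwa [e] at this
  have hT : T ≤ (T / n + 1) * n := by
    have := Nat.lt_div_mul_add hn (a := T)
    nlinarith
  rw [h1]
  refine (Finset.sum_le_sum h2).trans ?_
  refine (Finset.sum_le_sum_of_subset_of_nonneg (Finset.range_mono hT) fun _ _ _ =>
    hG _ _).trans (le_of_eq ?_)
  rw [sum_range_mul]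
  refine Finset.sum_congr rfl fun m _ => Finset.sum_congr rfl fun i hi => ?_
  rw [Finset.mem_range] at hi
  rw [Nat.mul_comm, Nat.mul_add_div hn, Nat.mul_add_mod, Nat.div_eq_of_lt hi, Nat.mod_eq_of_lt hi,
    add_zero]

lemma sum_geometric_late (T₀ n : ℕ) :
    ∑ i ∈ Finset.range n, (if T₀ ≤ i then (1 / 2 : ℝ) ^ (i + 1 - T₀) else 0) ≤
      1 - (1 / 2) ^ (n - T₀) := by
  induction n with
  | zero => simp
  | succ n ih =>
    rw [Finset.sum_range_succ]
    split_ifs with h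
    · rw [Nat.succ_sub h] at *
      rw [pow_succ]
      linarith
    · rw [Nat.sub_eq_zero_of_le (by omega : n ≤ T₀)] at ih
      rw [Nat.sub_eq_zero_of_le (by omega : n + 1 ≤ T₀)]
      linarith

/-- Per epoch: `2 * T₀` for learning and `8` for the geometric tail. The exceptional epochs `m₁` and
`m₂` cost up to `2 * n` each, once in total. -/
lemma sum_epochs_le (T₀ n M m₁ m₂ : ℕ) (hT : T₀ ≤ n) :
    ∑ m ∈ Finset.range M, ∑ i ∈ Finset.range n,
      ((if i < T₀ then (2 : ℝ) else 0) + (if m = m₁ then 2 else 0) + (if m = m₂ then 2 else 0) +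
        8 * (if T₀ ≤ i then (1 / 2) ^ (i + 1 - T₀) else 0)) ≤ M * (2 * T₀ + 8) + 4 * n := by
  have h1 : ∑ i ∈ Finset.range n, (if i < T₀ then (2 : ℝ) else 0) = 2 * T₀ := by
    rw [← Finset.sum_filter, Finset.sum_const, nsmul_eq_mul]
    have : (Finset.range n).filter (fun i => i < T₀) = Finset.range T₀ := by
      ext i
      simp only [Finset.mem_filter, Finset.mem_range]
      omega
    rw [this, Finset.card_range, mul_comm]
  have h2 : ∑ i ∈ Finset.range n, (if T₀ ≤ i then (1 / 2 : ℝ) ^ (i + 1 - T₀) else 0) ≤ 1 :=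
    (sum_geometric_late T₀ n).trans (sub_le_self _ (by positivity))
  have h3 : ∀ m' : ℕ, ∑ m ∈ Finset.range M, (if m = m' then (2 : ℝ) else 0) ≤ 2 := by
    intro m'
    rw [Finset.sum_ite_eq']
    split_ifs <;> norm_num
  calc _ ≤ ∑ m ∈ Finset.range M, (2 * T₀ + 8 + n * (if m = m₁ then (2 : ℝ) else 0) +
        n * (if m = m₂ then (2 : ℝ) else 0)) := by
        refine Finset.sum_le_sum fun m _ => ?_
        simp only [Finset.sum_add_distrib, ← Finset.mul_sum, Finset.sum_const, Finset.card_range,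
          nsmul_eq_mul, h1]
        linarith
    _ = M * (2 * T₀ + 8) + n * ∑ m ∈ Finset.range M, (if m = m₁ then (2 : ℝ) else 0) +
        n * ∑ m ∈ Finset.range M, (if m = m₂ then (2 : ℝ) else 0) := by
        simp only [Finset.sum_add_distrib, ← Finset.mul_sum, Finset.sum_const, Finset.card_range,
          nsmul_eq_mul]
        ring
    _ ≤ M * (2 * T₀ + 8) + n * 2 + n * 2 := by
        have := h3 m₁
        have := h3 m₂
        gcongr
    _ = _ := by ring

end Epochs

end

end MultiBandit

/-! ### The regret of DMC in the scenario, epoch by epoch -/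

namespace MultiBandit

noncomputable section

section Final

variable {K : ℕ} {T₀ T₁ T : ℕ} {ν : Fin K → Measure ℝ} {a₁ a₂ : Fin K} {ε : ℝ}

/-- The threshold `c` can separate two rounds of epoch `m` only if it lies in that epoch, whose
index is then `(c - 1) / n` because rounds start at `1`. -/
lemma lt_iff_of_div_ne {n m c s : ℕ} (hm : m ≠ (c - 1) / n) (h1 : m * n + 1 ≤ s)
    (h2 : s < m * n + 1 + n) : s < c ↔ m * n + 1 < c := by
  refine ⟨fun h => by omega, fun h => ?_⟩
  by_contra hc
  refine hm ?_
  obtain ⟨r, rfl⟩ : ∃ r, c = m * n + r + 1 := ⟨c - (m * n + 1), by omega⟩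
  have hr : r < n := by omega
  rw [Nat.add_sub_cancel, Nat.mul_comm, Nat.mul_add_div (by omega), Nat.div_eq_of_lt hr, add_zero]

/-- The players are the same in all rounds of an epoch in which nobody enters or leaves. -/
lemma scenario_const {f : ℝ} {m i : ℕ} (hi : i < T₁)
    (h0 : m ≠ (⌈(T : ℝ) / 2 + f * T⌉₊ - 1) / T₁) (h1 : m ≠ (⌈(T : ℝ) / 2⌉₊ - 1) / T₁)
    (j : Fin 2) (s : ℕ) (hs : s ∈ Finset.Icc (m * T₁ + 1) (m * T₁ + i + 1)) :
    scenario T f j s ↔ scenario T f j (m * T₁ + 1) := by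
  rw [Finset.mem_Icc] at hs
  obtain rfl | rfl : j = 0 ∨ j = 1 := by omega
  · rw [scenario_zero, scenario_zero]
    exact lt_iff_of_div_ne h0 hs.1 (by omega)
  · rw [scenario_one, scenario_one, ← not_lt, ← not_lt]
    exact not_congr (lt_iff_of_div_ne h1 hs.1 (by omega))

lemma dmc_expected_regret_le (hK : 2 ≤ K) (h₀ : 1 ≤ T₀) (hT : T₀ < T₁) (hε : 0 ≤ ε)
    (hI : Instance ν a₁ a₂ ε) (f : ℝ)
    (hgood : 1 / 4 ≤ (law 2 ν).real (dmcGood T₀ T₁ T ε (scenario T f) ν)) :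
    ∫ ω, regret (dmc K T₀ T₁) (scenario T f) ν T ω
      ∂((law 2 ν)[|dmcGood T₀ T₁ T ε (scenario T f) ν]) ≤
      ((T / T₁ : ℕ) + 1) * (2 * T₀ + 8) + 4 * T₁ := by
  have := law_isProbabilityMeasure (N := 2) hI.prob
  have hM := measurableStates_dmc K 2 T₀ T₁
  have hG0 : law 2 ν (dmcGood T₀ T₁ T ε (scenario T f) ν) ≠ 0 := by
    intro h
    rw [Measure.real, h] at hgood
    norm_num at hgood
  have hprob := cond_isProbabilityMeasure hG0
  simp only [regret_eq_sum]
  rw [integral_finsetSum _ fun t _ => integrable_roundRegret hM _ hK hε hI t _]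
  -- The exceptional epochs are those of the departure and the entrance. The extra epoch in `T / T₁
  -- + 1` accounts for an incomplete last one.
  refine (sum_Icc_le_sum_epochs (by omega : 0 < T₁) (fun m i => ?_) fun m i hi hiT => ?_).trans
    ((sum_epochs_le T₀ T₁ (T / T₁ + 1) ((⌈(T : ℝ) / 2 + f * T⌉₊ - 1) / T₁)
      ((⌈(T : ℝ) / 2⌉₊ - 1) / T₁) hT.le).trans (le_of_eq (by push_cast; ring)))
  · positivity
  · have htwo := integral_roundRegret_le_two (active := scenario T f) hM hK hε hI (m * T₁ + i + 1)
      ((law 2 ν)[|dmcGood T₀ T₁ T ε (scenario T f) ν])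
    have hnn : ∀ (p : Prop) [Decidable p], (0 : ℝ) ≤ if p then 2 else 0 := by
      intro p _
      split_ifs <;> norm_num
    have hgeo : (0 : ℝ) ≤ if T₀ ≤ i then (1 / 2) ^ (i + 1 - T₀) else 0 := by positivity
    have c1 := hnn (i < T₀)
    have c2 := hnn (m = (⌈(T : ℝ) / 2 + f * T⌉₊ - 1) / T₁)
    have c3 := hnn (m = (⌈(T : ℝ) / 2⌉₊ - 1) / T₁)
    by_cases h1 : i < T₀
    · rw [if_pos h1] at c1 ⊢
      linarith
    by_cases h2 : m = (⌈(T : ℝ) / 2 + f * T⌉₊ - 1) / T₁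
    · rw [if_pos h2] at c2 ⊢
      linarith
    by_cases h3 : m = (⌈(T : ℝ) / 2⌉₊ - 1) / T₁
    · rw [if_pos h3] at c3 ⊢
      linarith
    have hlate := integral_roundRegret_late (T := T) hK h₀ hT hε hI (not_lt.1 h1) hi hiT
      (scenario_const (f := f) hi h2 h3) hgood
    rw [if_pos (not_lt.1 h1)] at hgeo ⊢
    linarith

lemma epsilon_lt_one (hI : Instance ν a₁ a₂ ε) : ε < 1 := by
  linarith [hI.gap_one, (mean_mem hI a₁).2, (mean_mem hI a₂).1]

/-- The number of epochs and their length under the assumption of order `√T` epochs. -/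
lemma epochs_bounds {a b : ℝ} (ha : 0 < a) (hT : 1 ≤ T) (hT₁ : 0 < T₁)
    (h1 : a * √(T : ℝ) ≤ (T : ℝ) / T₁) (h2 : (T : ℝ) / T₁ ≤ b * √(T : ℝ)) :
    ((T / T₁ : ℕ) : ℝ) + 1 ≤ (b + 1) * √(T : ℝ) ∧ (T₁ : ℝ) ≤ √(T : ℝ) / a := by
  have hT' : (1 : ℝ) ≤ T := by exact_mod_cast hT
  have hT₁' : (0 : ℝ) < T₁ := by exact_mod_cast hT₁
  have hsq : 1 ≤ √(T : ℝ) := Real.one_le_sqrt.2 hT'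
  have hmul : √(T : ℝ) * √(T : ℝ) = T := Real.mul_self_sqrt (by linarith)
  constructor
  · have := (Nat.cast_div_le (α := ℝ) (m := T) (n := T₁)).trans h2
    linarith
  · rw [le_div_iff₀ hT₁'] at h1
    rw [le_div_iff₀ ha]
    nlinarith

end Final

end

end MultiBandit

theorem theorem3 :
    -- MEGA: linear expected regret
    (∀ (K : ℕ), 2 ≤ K →
      ∀ (ν : Fin K → Measure ℝ) (a₁ a₂ : Fin K), Instance ν a₁ a₂ 0 →
      ∀ f : ℝ, 0 < f → f < 1 / 2 →
      ∀ c d : ℝ, 0 < c → 0 < d →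
      ∃ C : ℝ, 0 < C ∧ ∃ T' : ℕ, ∀ T : ℕ, T' ≤ T →
        (c * (K : ℝ) ^ 2 / (d ^ 2 * ((K : ℝ) - 1))) / T ≤ f →
        f ≤ d ^ 2 * ((K : ℝ) - 1) / (8 * c * (K : ℝ) ^ 2) →
        ∀ β p₀ α : ℝ, 0 ≤ p₀ → p₀ ≤ 1 → 0 ≤ α → α ≤ 1 - 4 * Real.log (4 * f * T) / T →
          Integrable (regret (mega K c d p₀ α β) (scenario T f) ν T) (law 2 ν) ∧
          C * T ≤ ∫ ω, regret (mega K c d p₀ α β) (scenario T f) ν T ω ∂(law 2 ν)) ∧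
    -- DMC with a number of epochs between `a √T` and `b √T`
    (∀ a b : ℝ, 0 < a → a ≤ b →
      ∃ (C : ℝ) (q : ℕ), ∀ (K : ℕ), 2 ≤ K →
      ∀ (ν : Fin K → Measure ℝ) (a₁ a₂ : Fin K) (ε : ℝ), 0 < ε → Instance ν a₁ a₂ ε →
      ∀ f : ℝ, 0 < f → f < 1 / 2 →
      ∀ δ : ℝ, 0 < δ → δ < 1 →
      ∀ T T₁ : ℕ, 2 ≤ T → dmcT₀ K ε δ T < T₁ →
        a * √(T : ℝ) ≤ (T : ℝ) / T₁ → (T : ℝ) / T₁ ≤ b * √(T : ℝ) →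
        let T₀ := dmcT₀ K ε δ T
        let good := dmcGood T₀ T₁ T ε (scenario T f) ν
        MeasurableSet good ∧
        ENNReal.ofReal (1 - δ) ≤ law 2 ν good ∧
        Integrable (regret (dmc K T₀ T₁) (scenario T f) ν T) ((law 2 ν)[|good]) ∧
        ∫ ω, regret (dmc K T₀ T₁) (scenario T f) ν T ω ∂((law 2 ν)[|good])
          ≤ C * ((K : ℝ) / ε) ^ q * √(T : ℝ) * Real.log (T / δ) ^ q) := by
  refine ⟨fun K hK ν a₁ a₂ hI f hf0 hf1 c d hc hd => ?_, fun a b ha hab => ?_⟩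
  · obtain ⟨C, hC, T', h⟩ := mega_linear_regret hK hI hf0 hf1 hc hd
    refine ⟨C, hC, T', fun T hT _ _ β p₀ α hp0 hp1 hα0 hα1 =>
      ⟨?_, h T hT β p₀ α hp0 hp1 hα0 hα1⟩⟩
    have := law_isProbabilityMeasure (N := 2) hI.prob
    exact integrable_regret (measurableStates_mega K 2 c d p₀ α β) (scenario T f) hK le_rfl hI T
      (law 2 ν)
  -- `3360` comes from `2 * T₀ + 8 ≤ 10 * T₀` and `T₀ ≤ 336 x³ ℓ`. The summand `4 / a` is the cost
  -- of the exceptional epochs, with `T₁ ≤ √T / a`. The factor `3` raises `ℓ` to the common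
  -- exponent, since `ℓ ≤ 3 ℓ³` for `ℓ ≥ 0.69`.
  · refine ⟨3 * ((b + 1) * 3360 + 4 / a), 3, ?_⟩
    intro K hK ν a₁ a₂ ε hε hI f hf0 hf1 δ hδ0 hδ1 T T₁ hT hT₁ hlow hupp T₀ good
    have := law_isProbabilityMeasure (N := 2) hI.prob
    have hε1 := (epsilon_lt_one hI).le
    have hprob : 1 - 3 / 4 * δ ≤ (law 2 ν).real good :=
      dmcGood_prob hK hε hε1 hI hδ0 hδ1 hT hT₁ (scenario T f)
    refine ⟨measurableSet_dmcGood T, ?_, ?_, ?_⟩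
    · rw [← ofReal_measureReal]
      exact ENNReal.ofReal_le_ofReal (by linarith)
    · exact integrable_regret (measurableStates_dmc K 2 T₀ T₁) (scenario T f) hK hε.le hI T _
    · have h₀ : 1 ≤ T₀ := dmcT₀_pos hK hδ0 hδ1 hT
      have hquarter : 1 / 4 ≤ (law 2 ν).real good := by linarith
      have hreg := dmc_expected_regret_le hK h₀ hT₁ hε.le hI f hquarter
      refine hreg.trans ?_
      obtain ⟨hM, hL⟩ := epochs_bounds ha (by omega : 1 ≤ T) (by omega) hlow hupp
      have hT₀ : (T₀ : ℝ) ≤ 336 * (K / ε) ^ 3 * Real.log (T / δ) :=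
        dmcT₀_le hK hε hε1 hδ0 hδ1 hT
      have hℓ := le_log_horizon hδ0 hδ1 hT
      set ℓ := Real.log (T / δ)
      have hx : 2 ≤ (K : ℝ) / ε := by
        have : (2 : ℝ) ≤ K := by exact_mod_cast hK
        rw [le_div_iff₀ hε]
        nlinarith
      set x := (K : ℝ) / ε
      have hb : 0 < b := lt_of_lt_of_le ha hab
      have hs : 0 ≤ √(T : ℝ) := Real.sqrt_nonneg _
      have h1 : (1 : ℝ) ≤ T₀ := by exact_mod_cast h₀
      have hx3 : 8 ≤ x ^ 3 := by
        calc (8 : ℝ) = 2 ^ 3 := by norm_num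
          _ ≤ x ^ 3 := by gcongr
      have hxℓ : 1 ≤ x ^ 3 * ℓ := by nlinarith
      have hℓ3 : ℓ ≤ 3 * ℓ ^ 3 := by
        have h2 : 0 ≤ 3 * ℓ ^ 2 - 1 := by nlinarith
        nlinarith [mul_nonneg (by linarith : 0 ≤ ℓ) h2]
      calc (((T / T₁ : ℕ) : ℝ) + 1) * (2 * T₀ + 8) + 4 * T₁
          ≤ (b + 1) * √(T : ℝ) * (3360 * (x ^ 3 * ℓ)) + 4 * (√(T : ℝ) / a * (x ^ 3 * ℓ)) := by
            refine add_le_add (mul_le_mul hM (by linarith) (by positivity) (by positivity)) ?_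
            have : √(T : ℝ) / a ≤ √(T : ℝ) / a * (x ^ 3 * ℓ) :=
              le_mul_of_one_le_right (by positivity) hxℓ
            linarith
        _ = ((b + 1) * 3360 + 4 / a) * x ^ 3 * √(T : ℝ) * ℓ := by ring
        _ ≤ ((b + 1) * 3360 + 4 / a) * x ^ 3 * √(T : ℝ) * (3 * ℓ ^ 3) :=
            mul_le_mul_of_nonneg_left hℓ3 (by positivity)
        _ = 3 * ((b + 1) * 3360 + 4 / a) * x ^ 3 * √(T : ℝ) * ℓ ^ 3 := by ring
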